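/- A decision tree over $x_1,\dots,x_n$ is a rooted binary tree whose internal nodes are labeled with variables and whose leaves are labeled with bits; on input $x\in\{0,1\}^n$ one follows, from the root, the left or right child according to whether the variable at the node is $0$ or $1$, and outputs the bit at the leaf reached. Its size is its number of leaves, its depth the maximal number of edges from the root to a leaf. Let $\mathbb{DT}_d^s$ be the class of Boolean functions $f:\{0,1\}^n\to\{0,1\}$ computed by a decision tree of depth at most $d$ and size at most $s$. **Theorem.** The class $\mathbb{DT}_d^s$ is exactly properly learnable by a randomized algorithm from $m=O\big(s(2^d\log(s/\delta)+\log n)\big)$ black box queries in time $s^{O(d)}\log(1/\delta)+O(mn)$. That is: there are an absolute constant $c$ and one randomized random-access machine program (unit-cost addition, truncated subtraction, indirect addressing and fair coin flips; a black box query at a point $x\in\{0,1\}^n$ returns $f(x)$ and costs $n$ further steps) such that for all $n\ge 1$, all $d,s$ and all $0<\delta\le 1/2$ there is $m\le c\,s\,(2^d\log_2(s/\delta)+\log_2 n)$ with the following property. For every $f\in\mathbb{DT}_d^s$, the program, given $n$, $d$, $s$, $\lceil 1/\delta\rceil$ and black box access to $f$, always halts after at most $m$ black box queries and at most $s^{cd}\log_2(1/\delta)+c\,m\,n$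 steps, and with probability at least $1-\delta$ over its coin flips it outputs a decision tree of depth at most $d$ and size at most $s$ that computes $f$ exactly. -/

import Mathlib

namespace DTLearn

/-! ### Decision trees over `n` Boolean variables -/

/-- Points of the cube `{0,1}^n`. -/
abbrev Cube (n : ℕ) : Type := Fin n → Bool

/-- Decision trees: leaves carry an output bit, internal nodes carry a variable and have a left
child (followed when the variable is `0`) and a right child (followed when it is `1`). -/
inductive DTree (n : ℕ) : Type where
  | leaf (b : Bool) : DTree n
  | node (i : Fin n) (l r : DTree n) : DTree n

namespace DTree

variable {n : ℕ}

/-- The Boolean function computed by a tree. -/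
def eval : DTree n → Cube n → Bool
  | leaf b, _ => b
  | node i l r, x => if x i then r.eval x else l.eval x

/-- The number of leaves. -/
def size : DTree n → ℕ
  | leaf _ => 1
  | node _ l r => l.size + r.size

/-- The largest number of edges on a path from the root to a leaf. -/
def depth : DTree n → ℕ
  | leaf _ => 0
  | node _ l r => max l.depth r.depth + 1

/-- `T.StoredAt mem a`: the memory `mem` holds the tree `T` as a linked structure with root at
address `a`. A leaf with output `b` is a cell with content `b`; a node labeled with the variable of
index `i` is a cell with content `i + 2`, followed by two cells that hold the addresses of the
left and of the right child. -/
def StoredAt (mem : ℕ → ℕ) : DTree n → ℕ → Prop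
  | leaf b, a => mem a = b.toNat
  | node i l r, a =>
      mem a = (i : ℕ) + 2 ∧ l.StoredAt mem (mem (a + 1)) ∧ r.StoredAt mem (mem (a + 2))

end DTree

/-- The class of Boolean functions of `n` variables that are computed by a decision tree of depth
at most `d` and size at most `s`. -/
def DT (n d s : ℕ) : Set (Cube n → Bool) :=
  {f | ∃ T : DTree n, T.depth ≤ d ∧ T.size ≤ s ∧ T.eval = f}

/-! ### Randomized random-access machines with a black box

Registers and memory cells hold natural numbers. Programs are structured: assignments, indirect
stores, coin flips, black box queries, sequencing, conditionals and loops. The only arithmetic is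
addition and truncated subtraction, at unit cost; a black box query costs `n` further steps. -/

/-- Expressions; `load e` is the content of the memory cell whose address is the value of `e`. -/
inductive Expr : Type where
  | lit (k : ℕ) : Expr
  | reg (x : ℕ) : Expr
  | add (e₁ e₂ : Expr) : Expr
  | sub (e₁ e₂ : Expr) : Expr
  | load (e : Expr) : Expr

/-- The state of a machine: registers, memory, and the numbers of coins flipped, of black box
queries asked and of steps made so far. -/
structure State : Type where
  reg : ℕ → ℕ
  mem : ℕ → ℕ
  flips : ℕ
  queries : ℕ
  time : ℕ

namespace Expr

/-- The value of an expression (`sub` is truncated). -/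
def eval (σ : State) : Expr → ℕ
  | lit k => k
  | reg x => σ.reg x
  | add e₁ e₂ => e₁.eval σ + e₂.eval σ
  | sub e₁ e₂ => e₁.eval σ - e₂.eval σ
  | load e => σ.mem (e.eval σ)

/-- The number of steps needed to evaluate an expression: one for each of its operations and
operands. -/
def cost : Expr → ℕ
  | lit _ => 1
  | reg _ => 1
  | add e₁ e₂ => e₁.cost + e₂.cost + 1
  | sub e₁ e₂ => e₁.cost + e₂.cost + 1
  | load e => e.cost + 1

end Expr

/-- Programs. -/
inductive Prog : Type where
  | skip : Prog
  | set (x : ℕ) (e : Expr) : Prog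
  | store (a e : Expr) : Prog
  | flip (x : ℕ) : Prog
  | query (x : ℕ) (a : Expr) : Prog
  | seq (p q : Prog) : Prog
  | cond (e : Expr) (p q : Prog) : Prog
  | loop (e : Expr) (p : Prog) : Prog

namespace State

/-- Let `k` steps pass. -/
def tick (σ : State) (k : ℕ) : State := { σ with time := σ.time + k }

/-- Assign the value `v` to register `x`. -/
def setReg (σ : State) (x v : ℕ) : State := { σ with reg := Function.update σ.reg x v }

/-- Write the value `v` to the memory cell with address `a`. -/
def setMem (σ : State) (a v : ℕ) : State := { σ with mem := Function.update σ.mem a v }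

/-- The point of `{0,1}^n` written in the `n` memory cells from address `a` on (a nonzero content
is read as `1`). -/
def point (σ : State) (n a : ℕ) : Cube n := fun i => decide (σ.mem (a + i) ≠ 0)

/-- The initial state on input `(n, d, s, N)`: the input is in registers `0, 1, 2, 3`, and all
other registers and all memory cells are `0`. -/
def init (n d s N : ℕ) : State where
  reg := fun x => if x = 0 then n else if x = 1 then d else if x = 2 then s else
    if x = 3 then N else 0
  mem := fun _ => 0
  flips := 0
  queries := 0
  time := 0

end State

/-- `Exec f ω p σ σ'`: the program `p`, started in the state `σ` with black box `f` and with the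
sequence of coins `ω`, halts in the state `σ'`. -/
inductive Exec {n : ℕ} (f : Cube n → Bool) (ω : ℕ → Bool) : Prog → State → State → Prop where
  | skip (σ : State) : Exec f ω Prog.skip σ (σ.tick 1)
  | set (σ : State) (x : ℕ) (e : Expr) :
      Exec f ω (Prog.set x e) σ ((σ.setReg x (e.eval σ)).tick (e.cost + 1))
  | store (σ : State) (a e : Expr) :
      Exec f ω (Prog.store a e) σ
        ((σ.setMem (a.eval σ) (e.eval σ)).tick (a.cost + e.cost + 1))
  | flip (σ : State) (x : ℕ) :
      Exec f ω (Prog.flip x) σ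
        { (σ.setReg x (ω σ.flips).toNat).tick 1 with flips := σ.flips + 1 }
  | query (σ : State) (x : ℕ) (a : Expr) :
      Exec f ω (Prog.query x a) σ
        { (σ.setReg x (f (σ.point n (a.eval σ))).toNat).tick (a.cost + n + 1) with
          queries := σ.queries + 1 }
  | seq {σ σ' σ'' : State} {p q : Prog} (hp : Exec f ω p σ σ') (hq : Exec f ω q σ' σ'') :
      Exec f ω (Prog.seq p q) σ σ''
  | cond_true {σ σ' : State} {e : Expr} {p q : Prog} (he : e.eval σ ≠ 0)
      (hp : Exec f ω p (σ.tick (e.cost + 1)) σ') : Exec f ω (Prog.cond e p q) σ σ'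
  | cond_false {σ σ' : State} {e : Expr} {p q : Prog} (he : e.eval σ = 0)
      (hq : Exec f ω q (σ.tick (e.cost + 1)) σ') : Exec f ω (Prog.cond e p q) σ σ'
  | loop_true {σ σ' σ'' : State} {e : Expr} {p : Prog} (he : e.eval σ ≠ 0)
      (hp : Exec f ω p (σ.tick (e.cost + 1)) σ') (hl : Exec f ω (Prog.loop e p) σ' σ'') :
      Exec f ω (Prog.loop e p) σ σ''
  | loop_false {σ : State} {e : Expr} {p : Prog} (he : e.eval σ = 0) :
      Exec f ω (Prog.loop e p) σ (σ.tick (e.cost + 1))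

/-- Executions are deterministic once the coins are fixed. -/
theorem Exec.unique {n : ℕ} {f : Cube n → Bool} {ω : ℕ → Bool} {p : Prog} {σ σ₁ σ₂ : State}
    (h₁ : Exec f ω p σ σ₁) (h₂ : Exec f ω p σ σ₂) : σ₁ = σ₂ := by
  induction h₁ generalizing σ₂ with
  | skip | set | store | flip | query => cases h₂; rfl
  | seq _ _ ihp ihq =>
    cases h₂ with
    | seq hp hq => obtain rfl := ihp hp; exact ihq hq
  | cond_true he _ ih =>
    cases h₂ with
    | cond_true _ h => exact ih h
    | cond_false he' _ => exact absurd he' he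
  | cond_false he _ ih =>
    cases h₂ with
    | cond_true he' _ => exact absurd he he'
    | cond_false _ h => exact ih h
  | loop_true he _ _ ihp ihl =>
    cases h₂ with
    | loop_true _ hp hl => obtain rfl := ihp hp; exact ihl hl
    | loop_false he' => exact absurd he' he
  | loop_false he =>
    cases h₂ with
    | loop_true he' _ _ => exact absurd he he'
    | loop_false _ => rfl

/-- The law of an infinite sequence of independent fair coins. -/
noncomputable def coins : MeasureTheory.Measure (ℕ → Bool) :=
  MeasureTheory.Measure.infinitePi fun _ => (PMF.uniformOfFintype Bool).toMeasure

/-- In the state `σ`, register `0` holds the address of a decision tree of depth at most `d` and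
size at most `s` that computes exactly the function `f`. -/
def OutputsTree {n : ℕ} (d s : ℕ) (f : Cube n → Bool) (σ : State) : Prop :=
  ∃ T : DTree n, T.depth ≤ d ∧ T.size ≤ s ∧ T.StoredAt σ.mem (σ.reg 0) ∧ T.eval = f

/-- The program `p`, given `n`, `d`, `s` and `⌈1/δ⌉`, exactly properly learns `DT n d s` from at
most `m` black box queries in time at most `t`: for every target `f` in the class, every run halts
after at most `m` queries and at most `t` steps, and with probability at least `1 - δ` over the
coins the output is a decision tree of depth at most `d` and size at most `s` that computes `f`. -/
def ExactlyProperlyLearns (p : Prog) (n d s : ℕ) (δ m t : ℝ) : Prop :=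
  ∀ f ∈ DT n d s,
    (∀ ω : ℕ → Bool, ∃ σ : State, Exec f ω p (State.init n d s ⌈1 / δ⌉₊) σ ∧
      (σ.queries : ℝ) ≤ m ∧ (σ.time : ℝ) ≤ t) ∧
    1 - δ ≤ coins.real {ω | ∃ σ : State, Exec f ω p (State.init n d s ⌈1 / δ⌉₊) σ ∧
      OutputsTree d s f σ}

end DTLearn

/-!
The learner draws random points and keeps a set `R` of variables known to be relevant. Whenever `f`
takes different values at a sample `x` and at the point obtained from `x` by clearing the
coordinates outside `R`, a binary search along the hybrids of these two points finds a new relevant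
variable with `⌈log₂ n⌉` queries, and `f` has less than `s` relevant variables.

The difference of two functions computed by trees of depth at most `d` is a polynomial of degree at
most `d` over the field with two elements, so if it does not vanish, it is nonzero on at least a
`2⁻ᵈ` fraction of the cube. Hence a sample enlarges `R` with probability at least `2⁻ᵈ` as long as
`R` does not contain all relevant variables, and it rules out any given wrong tree with the same
probability. There are at most `(s + 2) ^ (2 * s)` trees of size at most `s` over the relevant
variables, so by the union bound about `2ᵈ s log (s / δ)` samples single out `f`.

It remains to find a small tree over `R` that agrees with the samples. A node of such a tree is
reached along a path of at most `d` edges, each of which is one of `|R|` variables with a value;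
there are at most `(2 * |R| + 1) ^ d` such paths, and from the longest to the shortest one computes
for each of them a smallest tree that agrees with the samples that follow the path.
-/

namespace DTLearn

/-! ### Symbolic execution -/

section

variable {n : ℕ} {f : Cube n → Bool} {ω : ℕ → Bool}

infixr:60 " ;; " => Prog.seq

namespace State

variable (σ : State) (x v k y a b : ℕ)

@[simp] theorem tick_reg : (σ.tick k).reg = σ.reg := rfl
@[simp] theorem tick_mem : (σ.tick k).mem = σ.mem := rfl
@[simp] theorem tick_flips : (σ.tick k).flips = σ.flips := rfl
@[simp] theorem tick_queries : (σ.tick k).queries = σ.queries := rfl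
@[simp] theorem tick_time : (σ.tick k).time = σ.time + k := rfl
@[simp] theorem setReg_reg : (σ.setReg x v).reg y = if y = x then v else σ.reg y :=
  Function.update_apply ..
@[simp] theorem setReg_mem : (σ.setReg x v).mem = σ.mem := rfl
@[simp] theorem setReg_flips : (σ.setReg x v).flips = σ.flips := rfl
@[simp] theorem setReg_queries : (σ.setReg x v).queries = σ.queries := rfl
@[simp] theorem setReg_time : (σ.setReg x v).time = σ.time := rfl
@[simp] theorem setMem_reg : (σ.setMem a v).reg = σ.reg := rfl
@[simp] theorem setMem_mem : (σ.setMem a v).mem b = if b = a then v else σ.mem b :=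
  Function.update_apply ..
@[simp] theorem setMem_flips : (σ.setMem a v).flips = σ.flips := rfl
@[simp] theorem setMem_queries : (σ.setMem a v).queries = σ.queries := rfl
@[simp] theorem setMem_time : (σ.setMem a v).time = σ.time := rfl

end State

attribute [simp] Expr.eval Expr.cost

namespace Prog

/-- Whether the program `p` contains an assignment to the register `x`. -/
@[simp] def writes (x : ℕ) : Prog → Bool
  | skip | store _ _ => false
  | set y _ | flip y | query y _ => x == y
  | seq p q | cond _ p q => p.writes x || q.writes x
  | loop _ p => p.writes x

/-- Whether a program contains an indirect store. -/
@[simp] def stores : Prog → Bool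
  | skip | set _ _ | flip _ | query _ _ => false
  | store _ _ => true
  | seq p q | cond _ p q => p.stores || q.stores
  | loop _ p => p.stores

/-- Whether a program contains a coin flip. -/
@[simp] def flips : Prog → Bool
  | skip | set _ _ | store _ _ | query _ _ => false
  | flip _ => true
  | seq p q | cond _ p q => p.flips || q.flips
  | loop _ p => p.flips

/-- Whether a program contains a black box query. -/
@[simp] def queries : Prog → Bool
  | skip | set _ _ | store _ _ | flip _ => false
  | query _ _ => true
  | seq p q | cond _ p q => p.queries || q.queries
  | loop _ p => p.queries

end Prog

/-- The states `σ` and `τ` agree on every component that the text of `p` does not touch. -/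
structure Frame (p : Prog) (σ τ : State) : Prop where
  reg {x : ℕ} : p.writes x = false → τ.reg x = σ.reg x
  mem : p.stores = false → τ.mem = σ.mem
  flips : p.flips = false → τ.flips = σ.flips
  queries : p.queries = false → τ.queries = σ.queries

namespace Frame

variable {p q : Prog} {σ τ υ : State}

theorem refl (p : Prog) (σ : State) : Frame p σ σ :=
  ⟨fun _ => rfl, fun _ => rfl, fun _ => rfl, fun _ => rfl⟩

theorem trans (h₁ : Frame p σ τ) (h₂ : Frame p τ υ) : Frame p σ υ :=
  ⟨fun h => (h₂.reg h).trans (h₁.reg h), fun h => (h₂.mem h).trans (h₁.mem h),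
    fun h => (h₂.flips h).trans (h₁.flips h), fun h => (h₂.queries h).trans (h₁.queries h)⟩

theorem tick_left {k : ℕ} (h : Frame p (σ.tick k) τ) : Frame p σ τ :=
  ⟨h.reg, h.mem, h.flips, h.queries⟩

theorem tick_right {k : ℕ} (h : Frame p σ τ) : Frame p σ (τ.tick k) :=
  ⟨h.reg, h.mem, h.flips, h.queries⟩

theorem seq_left (h : Frame p σ τ) : Frame (p ;; q) σ τ := by
  constructor <;> intros <;> simp_all [h.reg, h.mem, h.flips, h.queries]

theorem seq_right (h : Frame q σ τ) : Frame (p ;; q) σ τ := by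
  constructor <;> intros <;> simp_all [h.reg, h.mem, h.flips, h.queries]

theorem cond_left {e : Expr} (h : Frame p σ τ) : Frame (.cond e p q) σ τ :=
  let h' := h.seq_left (q := q)
  ⟨h'.reg, h'.mem, h'.flips, h'.queries⟩

theorem cond_right {e : Expr} (h : Frame q σ τ) : Frame (.cond e p q) σ τ :=
  let h' := h.seq_right (p := p)
  ⟨h'.reg, h'.mem, h'.flips, h'.queries⟩

theorem loop {e : Expr} (h : Frame p σ τ) : Frame (.loop e p) σ τ :=
  ⟨h.reg, h.mem, h.flips, h.queries⟩

end Frame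

theorem Exec.frame {p : Prog} {σ τ : State} (h : Exec f ω p σ τ) : Frame p σ τ := by
  induction h with
  | skip | set | store | flip | query => constructor <;> intros <;> simp_all
  | seq _ _ ihp ihq => exact ihp.seq_left.trans ihq.seq_right
  | cond_true _ _ ih => exact ih.tick_left.cond_left
  | cond_false _ _ ih => exact ih.tick_left.cond_right
  | loop_true _ _ _ ihp ihl => exact ihp.tick_left.loop.trans ihl
  | loop_false => exact (Frame.refl _ _).tick_right

/-- Total correctness: the program `p` started in `σ` halts in a state that satisfies `Q`. -/
def Run {n : ℕ} (f : Cube n → Bool) (ω : ℕ → Bool) (p : Prog) (σ : State) (Q : State → Prop) :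
    Prop :=
  ∃ τ, Exec f ω p σ τ ∧ Q τ

section Run

variable {σ : State} {Q R : State → Prop} {p q : Prog} {e a : Expr} {x : ℕ}

theorem Run.mono (h : Run f ω p σ R) (hQ : ∀ τ, Frame p σ τ → R τ → Q τ) : Run f ω p σ Q :=
  let ⟨τ, hp, hR⟩ := h
  ⟨τ, hp, hQ τ hp.frame hR⟩

theorem run_seq : Run f ω (p ;; q) σ Q ↔ Run f ω p σ (fun τ => Run f ω q τ Q) :=
  ⟨fun ⟨_, h, hQ⟩ => by cases h with | seq hp hq => exact ⟨_, hp, _, hq, hQ⟩,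
    fun ⟨_, hp, _, hq, hQ⟩ => ⟨_, .seq hp hq, hQ⟩⟩

theorem Run.seq (hp : Run f ω p σ R) (hq : ∀ τ, Frame p σ τ → R τ → Run f ω q τ Q) :
    Run f ω (p ;; q) σ Q :=
  run_seq.2 (hp.mono hq)

theorem run_skip : Run f ω .skip σ Q ↔ Q (σ.tick 1) :=
  ⟨fun ⟨_, h, hQ⟩ => by cases h; exact hQ, fun h => ⟨_, .skip σ, h⟩⟩

theorem run_set :
    Run f ω (.set x e) σ Q ↔ Q ((σ.setReg x (e.eval σ)).tick (e.cost + 1)) :=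
  ⟨fun ⟨_, h, hQ⟩ => by cases h; exact hQ, fun h => ⟨_, .set σ x e, h⟩⟩

theorem run_store :
    Run f ω (.store a e) σ Q ↔
      Q ((σ.setMem (a.eval σ) (e.eval σ)).tick (a.cost + e.cost + 1)) :=
  ⟨fun ⟨_, h, hQ⟩ => by cases h; exact hQ, fun h => ⟨_, .store σ a e, h⟩⟩

theorem run_flip :
    Run f ω (.flip x) σ Q ↔
      Q { (σ.setReg x (ω σ.flips).toNat).tick 1 with flips := σ.flips + 1 } :=
  ⟨fun ⟨_, h, hQ⟩ => by cases h; exact hQ, fun h => ⟨_, .flip σ x, h⟩⟩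

theorem run_query :
    Run f ω (.query x a) σ Q ↔
      Q { (σ.setReg x (f (σ.point n (a.eval σ))).toNat).tick (a.cost + n + 1) with
          queries := σ.queries + 1 } :=
  ⟨fun ⟨_, h, hQ⟩ => by cases h; exact hQ, fun h => ⟨_, .query σ x a, h⟩⟩

theorem run_cond :
    Run f ω (.cond e p q) σ Q ↔
      (e.eval σ ≠ 0 → Run f ω p (σ.tick (e.cost + 1)) Q) ∧
      (e.eval σ = 0 → Run f ω q (σ.tick (e.cost + 1)) Q) := by
  by_cases he : e.eval σ = 0
  · exact ⟨fun ⟨_, h, hQ⟩ => by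
      cases h with
      | cond_true he' => exact absurd he he'
      | cond_false _ hq => exact ⟨fun h => absurd he h, fun _ => ⟨_, hq, hQ⟩⟩,
      fun h => let ⟨τ, hq, hQ⟩ := h.2 he; ⟨τ, .cond_false he hq, hQ⟩⟩
  · exact ⟨fun ⟨_, h, hQ⟩ => by
      cases h with
      | cond_true _ hp => exact ⟨fun _ => ⟨_, hp, hQ⟩, fun h => absurd h he⟩
      | cond_false he' => exact absurd he' he,
      fun h => let ⟨τ, hp, hQ⟩ := h.1 he; ⟨τ, .cond_true he hp, hQ⟩⟩

theorem run_loop (I : ℕ → State → Prop) (N : ℕ) (zero : I 0 σ)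
    (step : ∀ k τ, Frame p σ τ → I k τ → e.eval τ ≠ 0 →
      k < N ∧ Run f ω p (τ.tick (e.cost + 1)) (I (k + 1)))
    (done : ∀ k τ, Frame p σ τ → I k τ → e.eval τ = 0 → Q (τ.tick (e.cost + 1))) :
    Run f ω (.loop e p) σ Q := by
  have from_round : ∀ j k τ, N ≤ k + j → Frame p σ τ → I k τ → Run f ω (.loop e p) τ Q := by
    intro j
    induction j with
    | zero =>
      intro k τ hk hF hI
      have he : e.eval τ = 0 := by
        by_contra he
        exact absurd (step k τ hF hI he).1 (by omega)
      exact ⟨_, .loop_false he, done k τ hF hI he⟩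
    | succ j ih =>
      intro k τ hk hF hI
      by_cases he : e.eval τ = 0
      · exact ⟨_, .loop_false he, done k τ hF hI he⟩
      · obtain ⟨-, τ₁, hp, hI₁⟩ := step k τ hF hI he
        obtain ⟨τ₂, hl, hQ⟩ :=
          ih (k + 1) τ₁ (by omega) (hF.trans hp.frame.tick_left) hI₁
        exact ⟨τ₂, .loop_true he hp hl, hQ⟩
  exact from_round N 0 σ (by omega) (Frame.refl p σ) zero

end Run

/-- `for x < reg y do p`, where `p` changes neither register. -/
def forLoop (x y : ℕ) (p : Prog) : Prog :=
  .set x (.lit 0) ;;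
  .loop (.sub (.reg y) (.reg x)) (p ;; .set x (.add (.reg x) (.lit 1)))

section ForLoop

variable {σ : State} {Q : State → Prop} {p : Prog} {x y N : ℕ}

theorem run_forLoop (hN : σ.reg y = N) (hxy : x ≠ y) (hx : p.writes x = false)
    (hy : p.writes y = false) (I : ℕ → State → Prop) (zero : I 0 ((σ.setReg x 0).tick 2))
    (step : ∀ k τ, k < N → τ.reg x = k → Frame (forLoop x y p) σ τ → I k τ →
      Run f ω p (τ.tick 4) fun υ => I (k + 1) ((υ.setReg x (k + 1)).tick 4)) :
    Run f ω (forLoop x y p) σ fun τ => τ.reg x = N ∧ ∃ υ, I N υ ∧ τ = υ.tick 4 := by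
  rw [forLoop, run_seq, run_set]
  have hframe : ∀ τ, Frame (p ;; .set x (.add (.reg x) (.lit 1))) ((σ.setReg x 0).tick 2) τ →
      Frame (forLoop x y p) σ τ ∧ τ.reg y = N := fun τ hF => by
    refine ⟨⟨fun {z} hz => ?_, fun h => hF.mem (by simpa [forLoop] using h),
      fun h => hF.flips (by simpa [forLoop] using h),
      fun h => hF.queries (by simpa [forLoop] using h)⟩, ?_⟩
    · simp only [forLoop, Prog.writes, Bool.or_eq_false_iff, beq_eq_false_iff_ne] at hz
      rw [hF.reg (by simp [hz])]
      simp [hz.1]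
    · rw [hF.reg (by simp [hy, hxy.symm])]
      simp [hxy.symm, hN]
  refine run_loop (fun k τ => k ≤ N ∧ τ.reg x = k ∧ I k τ) N ⟨Nat.zero_le N, by simp, zero⟩ ?_ ?_
  · rintro k τ hF ⟨-, hk, hI⟩ he
    obtain ⟨hF, hyN⟩ := hframe τ hF
    have hkN : k < N := by simpa [hk, hyN, Nat.sub_eq_zero_iff_le] using he
    refine ⟨hkN, (step k τ hkN hk hF hI).seq fun υ hυ hI => run_set.2 ?_⟩
    have hxk : υ.reg x = k := (hυ.reg hx).trans hk
    simpa [hxk, Nat.succ_le_iff, hkN] using hI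
  · rintro k τ hF ⟨hkN, hk, hI⟩ he
    obtain ⟨-, hyN⟩ := hframe τ hF
    obtain rfl : k = N := by
      simp only [Expr.eval, hk, hyN] at he
      omega
    exact ⟨hk, τ, hI, rfl⟩

theorem run_forLoop_of_time_le (hN : σ.reg y = N) (hxy : x ≠ y) (hx : p.writes x = false)
    (hy : p.writes y = false) (c : ℕ) (I : ℕ → State → Prop)
    (clock : ∀ k τ t, I k τ → I k (τ.tick t)) (zero : I 0 (σ.setReg x 0))
    (step : ∀ k τ, k < N → τ.reg x = k → Frame (forLoop x y p) σ τ → I k τ →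
      Run f ω p τ fun υ => υ.time ≤ τ.time + c ∧ I (k + 1) (υ.setReg x (k + 1))) :
    Run f ω (forLoop x y p) σ fun τ =>
      I N τ ∧ τ.reg x = N ∧ τ.time ≤ σ.time + N * (c + 8) + 6 := by
  refine (run_forLoop hN hxy hx hy
    (fun k τ => I k τ ∧ τ.time ≤ σ.time + k * (c + 8) + 2)
    ⟨clock _ _ _ zero, by simp⟩ ?_).mono ?_
  · rintro k τ hk hxk hF ⟨hI, ht⟩
    refine (step k (τ.tick 4) hk hxk hF.tick_right (clock _ _ _ hI)).mono ?_
    rintro υ - ⟨hυ, hI⟩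
    refine ⟨clock _ _ _ hI, ?_⟩
    simp only [State.tick_time, State.setReg_time] at hυ ⊢
    linarith
  · rintro τ - ⟨hx, υ, ⟨hI, ht⟩, rfl⟩
    exact ⟨clock _ _ _ hI, hx, by simp only [State.tick_time]; omega⟩

end ForLoop

/-! ### The number of samples -/

/-! The input `n`, `d`, `s`, `⌈1/δ⌉` is in the first four registers. -/

namespace Reg

abbrev dim : ℕ := 0
abbrev maxDepth : ℕ := 1
abbrev maxSize : ℕ := 2
abbrev conf : ℕ := 3
abbrev numSamples : ℕ := 4
abbrev base : ℕ := 5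
abbrev numVars : ℕ := 6
abbrev power : ℕ := 7
abbrev lenSize : ℕ := 8
abbrev lenConf : ℕ := 9
abbrev bound : ℕ := 10
abbrev index : ℕ := 11
abbrev coord : ℕ := 12
abbrev threshold : ℕ := 13
abbrev lower : ℕ := 14
abbrev upper : ℕ := 15
abbrev mirror : ℕ := 16
abbrev label : ℕ := 17
abbrev value : ℕ := 18
abbrev round : ℕ := 19
abbrev numInternal : ℕ := 20
abbrev level : ℕ := 21
abbrev total : ℕ := 22
abbrev recLen : ℕ := 23
abbrev parent : ℕ := 24
abbrev child : ℕ := 25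
abbrev node : ℕ := 26
abbrev var : ℕ := 27
abbrev mark : ℕ := 28
abbrev feature : ℕ := 29
abbrev location : ℕ := 30
abbrev hasZero : ℕ := 31
abbrev hasOne : ℕ := 32
abbrev leafAddr : ℕ := 33
abbrev size : ℕ := 34

end Reg

open DTLearn.Expr DTLearn.Reg

/-- Register `z` grows by register `y` times the value of `e`; `x` is the loop counter. -/
def addMul (x y z : ℕ) (e : Expr) : Prog := forLoop x y (.set z (add (reg z) e))

/-- Register `y` becomes the length in binary of register `x`. -/
def binLength (x y : ℕ) : Prog :=
  .set power (lit 1) ;; .set y (lit 0) ;;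
  .loop (sub (add (reg x) (lit 1)) (reg power))
    (.set power (add (reg power) (reg power)) ;; .set y (add (reg y) (lit 1)))

/-- The number of samples for depth `d`, size `s` and `N = ⌈1/δ⌉`, of order
`s * 2 ^ d * log (s / δ)`. -/
def sampleCount (d s N : ℕ) : ℕ := 2 ^ (d + 1) * (2 * s * (s.size + 1) + N.size + 1)

/-- Compute the number of samples and the address of the first one. -/
def setup : Prog :=
  binLength maxSize lenSize ;; binLength conf lenConf ;;
  .set numSamples (add (reg lenConf) (lit 1)) ;; .set bound (add (reg maxSize) (reg maxSize)) ;;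
  addMul index bound numSamples (add (reg lenSize) (lit 1)) ;;
  .set bound (add (reg maxDepth) (lit 1)) ;;
  forLoop index bound (.set numSamples (add (reg numSamples) (reg numSamples))) ;;
  .set base (add (reg dim) (add (reg dim) (reg dim)))

theorem run_addMul {x y z N v : ℕ} {e : Expr} (σ : State) (hxy : x ≠ y) (hxz : x ≠ z) (hyz : y ≠ z)
    (hN : σ.reg y = N) (he : ∀ τ, Frame (addMul x y z e) σ τ → e.eval τ = v) :
    Run f ω (addMul x y z e) σ fun τ =>
      τ.reg z = σ.reg z + N * v ∧ τ.time ≤ σ.time + N * (e.cost + 11) + 6 := by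
  refine (run_forLoop_of_time_le hN hxy (by simpa) (by simpa) (e.cost + 3)
    (fun k τ => τ.reg z = σ.reg z + k * v) (fun _ _ _ => id) (by simp [hxz.symm]) ?_).mono
    fun τ _ h => ⟨h.1, by linarith [h.2.2]⟩
  intro k τ _ _ hF hI
  have hev : e.eval τ = v := he τ hF
  refine run_set.2 ⟨by simp only [State.tick_time, State.setReg_time, Expr.cost]; omega, ?_⟩
  simp only [State.setReg_reg, State.tick_reg, Expr.eval, hI, hev, hxz.symm, if_true, if_false]
  ring

theorem size_eq_of_lt_of_le {k a : ℕ} (h : a < 2 ^ k) (h' : 2 ^ k ≤ 2 * a) : k = a.size := by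
  refine le_antisymm ?_ (Nat.size_le.2 h)
  cases k with
  | zero => exact Nat.zero_le _
  | succ k => exact Nat.lt_size.2 (by rw [pow_succ] at h'; omega)

theorem run_binLength {x y : ℕ} (σ : State) (hx : x ≠ power) (hy : y ≠ power) (hxy : x ≠ y)
    (hσ : 0 < σ.reg x) :
    Run f ω (binLength x y) σ fun τ => τ.reg y = (σ.reg x).size ∧
      τ.time ≤ σ.time + 14 * (σ.reg x).size + 10 := by
  simp only [binLength, run_seq, run_set]
  have hframe : ∀ τ, Frame (.set power (add (reg power) (reg power)) ;;
      .set y (add (reg y) (lit 1))) ((((σ.setReg power 1).tick 2).setReg y 0).tick 2) τ →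
      τ.reg x = σ.reg x := fun τ hF => by
    rw [hF.reg (by simp [hx, hxy])]
    simp [hx, hxy]
  refine run_loop (fun k τ => τ.reg power = 2 ^ k ∧ τ.reg y = k ∧ 2 ^ k ≤ 2 * σ.reg x ∧
    τ.time ≤ σ.time + 14 * k + 4) (σ.reg x) ?_ ?_ ?_
  · refine ⟨by simp [hy.symm], by simp, by omega, by simp⟩
  · rintro k τ hF ⟨hpow, hyk, -, ht⟩ he
    simp only [Expr.eval, hpow, hframe τ hF] at he
    have hk : k < 2 ^ k := Nat.lt_two_pow_self
    refine ⟨by omega, ?_⟩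
    simp only [run_seq, run_set]
    refine ⟨by simp [hy.symm, hpow, pow_succ, mul_two], by simp [hy, hyk], ?_, ?_⟩
    · rw [pow_succ]; omega
    · simp only [State.tick_time, State.setReg_time, Expr.cost]; omega
  · rintro k τ hF ⟨hpow, hyk, hk, ht⟩ he
    simp only [Expr.eval, hpow, hframe τ hF] at he
    have hsize : k = (σ.reg x).size := size_eq_of_lt_of_le (by omega) hk
    simp only [State.tick_reg, State.tick_time, hyk, Expr.cost]
    exact ⟨hsize, by omega⟩

theorem run_double (σ : State) {N : ℕ} (hN : σ.reg bound = N) :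
    Run f ω (forLoop index bound (.set numSamples (add (reg numSamples) (reg numSamples)))) σ
      fun τ => τ.reg numSamples = 2 ^ N * σ.reg numSamples ∧ τ.time ≤ σ.time + N * 12 + 6 := by
  refine (run_forLoop_of_time_le hN (by decide) rfl rfl 4
    (fun k τ => τ.reg numSamples = 2 ^ k * σ.reg numSamples) (fun _ _ _ => id) (by simp) ?_).mono
    fun τ _ h => ⟨h.1, h.2.2⟩
  intro k τ _ _ _ hI
  refine run_set.2 ⟨by simp, ?_⟩
  simp only [State.setReg_reg, State.tick_reg, Expr.eval, hI, pow_succ, if_true]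
  simp only [OfNat.ofNat_eq_ofNat, Nat.reduceEqDiff, reduceIte]
  ring

theorem add_le_sampleCount {d s N : ℕ} (hs : 0 < s) :
    s.size + s + N.size + d + 1 ≤ sampleCount d s N := by
  have hd : d + 2 ≤ 2 ^ (d + 1) := Nat.lt_two_pow_self
  rw [sampleCount]
  nlinarith [Nat.mul_le_mul_right (2 * s * (s.size + 1) + N.size + 1) hd,
    Nat.le_mul_of_pos_left s.size hs]

theorem run_setup {d s N : ℕ} (hs : 0 < s) (hN : 0 < N) :
    Run f ω setup (State.init n d s N) fun τ => τ.reg numSamples = sampleCount d s N ∧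
      τ.reg base = 3 * n ∧ τ.time ≤ 80 * sampleCount d s N := by
  refine (run_binLength _ (by decide) (by decide) (by decide) hs).seq ?_
  rintro τ₁ F₁ ⟨hlen₁, ht₁⟩
  have hconf : τ₁.reg conf = N := F₁.reg rfl
  refine (run_binLength _ (by decide) (by decide) (by decide) (hconf ▸ hN)).seq ?_
  rintro τ₂ F₂ ⟨hlenConf, ht₂⟩
  rw [hconf] at hlenConf ht₂
  change τ₁.reg lenSize = s.size at hlen₁
  change τ₁.time ≤ 0 + 14 * s.size + 10 at ht₁
  have hlen : τ₂.reg lenSize = s.size := (F₂.reg rfl).trans hlen₁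
  have hdim : τ₂.reg dim = n := (F₂.reg rfl).trans (F₁.reg rfl)
  have hdepth : τ₂.reg maxDepth = d := (F₂.reg rfl).trans (F₁.reg rfl)
  have hsize : τ₂.reg maxSize = s := (F₂.reg rfl).trans (F₁.reg rfl)
  simp only [run_seq, run_set]
  refine (run_addMul (N := 2 * s) (v := s.size + 1) _ (by decide) (by decide) (by decide)
    (by simp [hsize, two_mul]) fun τ F => ?_).mono ?_
  · simp [F.reg (x := lenSize) rfl, hlen]
  rintro τ₃ F₃ ⟨hm, ht₃⟩
  have hdepth₃ : τ₃.reg maxDepth = d := (F₃.reg rfl).trans hdepth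
  have hdim₃ : τ₃.reg dim = n := (F₃.reg rfl).trans hdim
  refine (run_double (N := d + 1) _ (by simp [hdepth₃])).mono ?_
  rintro τ₄ F₄ ⟨hM, ht₄⟩
  have hdim₄ : τ₄.reg dim = n := (F₄.reg rfl).trans hdim₃
  have hE : τ₃.reg numSamples = 2 * s * (s.size + 1) + N.size + 1 := by
    rw [hm]
    simp only [Expr.eval, hlenConf, State.tick_reg, State.setReg_reg, OfNat.ofNat_eq_ofNat,
      Nat.reduceEqDiff, reduceIte]
    ring
  rw [State.tick_reg, State.setReg_reg, if_neg (by decide), hE] at hM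
  refine ⟨by simp [hM, sampleCount], ?_, ?_⟩
  · simp only [Expr.eval, hdim₄, State.tick_reg, State.setReg_reg, reduceIte]
    ring
  have hM' := add_le_sampleCount (d := d) (N := N) hs
  simp only [State.tick_time, State.setReg_time, Expr.cost] at ht₂ ht₃ ht₄ ⊢
  omega

/-! ### Collecting relevant variables -/

/-- The point that agrees with `x` on the coordinates in `R` and on those below `m`, and is `0`
elsewhere. -/
def hybrid (R : Finset (Fin n)) (m : ℕ) (x : Cube n) : Cube n :=
  fun i => if (i : ℕ) < m ∨ i ∈ R then x i else false

/-- The point that agrees with `x` on `R` and is `0` elsewhere. -/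
def project (R : Finset (Fin n)) (x : Cube n) : Cube n := fun i => if i ∈ R then x i else false

/-- `f` depends on the variable `i`. -/
def Relevant (f : Cube n → Bool) (i : Fin n) : Prop :=
  ∃ x y : Cube n, (∀ j, j ≠ i → x j = y j) ∧ f x ≠ f y

/-- The effect of the sample `x` on the set of known relevant variables: unless the projection of
`x` to this set has the same value as `x`, a new relevant variable is found. -/
inductive Step (f : Cube n → Bool) (R : Finset (Fin n)) (x : Cube n) : Finset (Fin n) → Prop
  | consistent (h : f (project R x) = f x) : Step f R x R
  | inconsistent (h : f (project R x) ≠ f x) {i : Fin n} (hi : i ∉ R) (hrel : Relevant f i) :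
      Step f R x (insert i R)

/-- The samples `X` may turn the set `R` of known relevant variables into `R'`. -/
def Leads (f : Cube n → Bool) :
    ∀ {t : ℕ}, (Fin t → Cube n) → Finset (Fin n) → Finset (Fin n) → Prop
  | 0, _, R, R' => R' = R
  | _ + 1, X, R, R' => ∃ S, Step f R (X 0) S ∧ Leads f (Fin.tail X) S R'

/-- The `t`-th sample drawn with the coins `ω`. -/
def drawn (n : ℕ) (ω : ℕ → Bool) (t : ℕ) : Cube n := fun i => ω (t * n + i)

theorem hybrid_zero (R : Finset (Fin n)) (x : Cube n) : hybrid R 0 x = project R x := by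
  funext i
  simp [hybrid, project]

theorem hybrid_self (R : Finset (Fin n)) (x : Cube n) : hybrid R n x = x := by
  funext i
  simp [hybrid]

theorem notMem_and_relevant_of_hybrid_ne {R : Finset (Fin n)} {x : Cube n} {i : Fin n}
    (h : f (hybrid R i x) ≠ f (hybrid R (i + 1) x)) : i ∉ R ∧ Relevant f i := by
  have hagree : ∀ j, j ≠ i ∨ i ∈ R → hybrid R i x j = hybrid R (i + 1) x j := by
    intro j hj
    have : (j : ℕ) < i + 1 ∨ j ∈ R ↔ (j : ℕ) < i ∨ j ∈ R := by grind
    simp only [hybrid, this]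
  exact ⟨fun hi => h (congrArg f (funext fun j => hagree j (.inr hi))),
    _, _, fun j hj => hagree j (.inl hj), h⟩

theorem Leads.snoc {X : ℕ → Cube n} {t : ℕ} {R R' R'' : Finset (Fin n)}
    (h : Leads f (fun k : Fin t => X k) R R') (hstep : Step f R' (X t) R'') :
    Leads f (fun k : Fin (t + 1) => X k) R R'' := by
  induction t generalizing X R with
  | zero =>
    obtain rfl : R' = R := h
    exact ⟨R'', hstep, rfl⟩
  | succ t ih =>
    obtain ⟨S, hS, h⟩ := h
    exact ⟨S, hS, ih (X := fun k => X (k + 1)) h hstep⟩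

theorem card_lt_of_notMem {R : Finset (Fin n)} {i : Fin n} (hi : i ∉ R) : R.card < n := by
  simpa using Finset.card_lt_univ_of_notMem hi

/-- The point `x` is written in the `n` cells from `a` on. -/
def PointAt (mem : ℕ → ℕ) (a : ℕ) (x : Cube n) : Prop := ∀ i : Fin n, mem (a + i) = (x i).toNat

/-- The point `x` and the bit `f x` are written in the `n + 1` cells from `a` on. -/
def SampleAt (f : Cube n → Bool) (mem : ℕ → ℕ) (a : ℕ) (x : Cube n) : Prop :=
  PointAt mem a x ∧ mem (a + n) = (f x).toNat

/-- The address of the `t`-th sample. The cells below the first sample hold the point to be queried,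
a flag for every variable, and a list of variables, each in a block of `n` cells. -/
def sampleAddr (n t : ℕ) : ℕ := 3 * n + t * (n + 1)

/-- The state `σ` records the set `R` of variables, in the form of flags and of a list, and none of
the cells below the address in register `base` is needed for the samples to come. -/
structure Records (R : Finset (Fin n)) (σ : State) : Prop where
  dim : σ.reg dim = n
  le_base : 3 * n ≤ σ.reg base
  numVars : σ.reg numVars = R.card
  flags (i : Fin n) : σ.mem (n + i) ≠ 0 ↔ i ∈ R
  list : (Finset.range R.card).image (fun v => σ.mem (2 * n + v)) = R.image (↑)

theorem PointAt.point {σ : State} {a : ℕ} {x : Cube n} (h : PointAt σ.mem a x) :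
    σ.point n a = x := by
  funext i
  simp [State.point, h i]

theorem PointAt.congr {mem mem' : ℕ → ℕ} {a : ℕ} {x : Cube n} (h : PointAt mem a x)
    (hmem : ∀ i < n, mem' (a + i) = mem (a + i)) : PointAt mem' a x :=
  fun i => (hmem i i.2).trans (h i)

theorem SampleAt.congr {mem mem' : ℕ → ℕ} {a : ℕ} {x : Cube n} (h : SampleAt f mem a x)
    (hmem : ∀ i ≤ n, mem' (a + i) = mem (a + i)) : SampleAt f mem' a x :=
  ⟨h.1.congr fun i hi => hmem i hi.le, (hmem n le_rfl).trans h.2⟩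

theorem Records.congr {R : Finset (Fin n)} {σ τ : State} (h : Records R σ)
    (hdim : τ.reg Reg.dim = σ.reg Reg.dim) (hbase : σ.reg base ≤ τ.reg base)
    (hvars : τ.reg Reg.numVars = σ.reg Reg.numVars)
    (hmem : ∀ a, n ≤ a → a < 3 * n → τ.mem a = σ.mem a) : Records R τ := by
  refine ⟨hdim.trans h.dim, h.le_base.trans hbase, hvars.trans h.numVars,
    fun i => by rw [hmem _ (by omega) (by omega), h.flags], ?_⟩
  rw [← h.list]
  refine Finset.image_congr fun v hv => hmem _ (by omega) ?_
  have : R.card ≤ n := by simpa using R.card_le_univ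
  have : v < R.card := by simpa using hv
  omega

theorem Records.insert {R : Finset (Fin n)} {i : Fin n} {σ τ : State} (h : Records R σ)
    (hi : i ∉ R) (hdim : τ.reg Reg.dim = σ.reg Reg.dim) (hbase : τ.reg base = σ.reg base)
    (hvars : τ.reg Reg.numVars = σ.reg Reg.numVars + 1)
    (hmem : τ.mem = Function.update (Function.update σ.mem (n + i) 1) (2 * n + R.card) i) :
    Records (insert i R) τ := by
  have : R.card < n := card_lt_of_notMem hi
  refine ⟨hdim.trans h.dim, h.le_base.trans hbase.ge, by
    rw [hvars, h.numVars, Finset.card_insert_of_notMem hi], fun j => ?_, ?_⟩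
  · rw [hmem, Function.update_of_ne (by omega), Function.update_apply]
    split_ifs with hij
    · obtain rfl : j = i := Fin.ext (by omega)
      simp
    · rw [h.flags, Finset.mem_insert]
      exact (or_iff_right fun hji : j = i => hij (hji ▸ rfl)).symm
  · rw [Finset.card_insert_of_notMem hi, Finset.range_add_one, Finset.image_insert,
      Finset.image_insert, ← h.list]
    congr 1
    · simp [hmem]
    · refine Finset.image_congr fun v hv => ?_
      have : v < R.card := by simpa using hv
      simp only [hmem]
      rw [Function.update_of_ne (by omega), Function.update_of_ne (by omega)]

/-- Register `value` becomes the value of `f` at the hybrid of the current sample. -/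
def ask : Prog :=
  forLoop coord dim
    (.cond (add (sub (reg threshold) (reg coord)) (load (add (reg dim) (reg coord))))
      (.store (reg coord) (load (add (reg base) (reg coord))))
      (.store (reg coord) (lit 0))) ;;
  .query value (lit 0)

/-- Register `threshold` becomes the middle between the registers `lower` and `upper`. -/
def halve : Prog :=
  .set threshold (reg lower) ;; .set mirror (reg upper) ;;
  .loop (sub (reg mirror) (reg threshold))
    (.set threshold (add (reg threshold) (lit 1)) ;; .set mirror (sub (reg mirror) (lit 1)))

/-- An expression that vanishes when the sample and its hybrid have the same value. -/
def differ : Expr := add (sub (reg label) (reg value)) (sub (reg value) (reg label))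

/-- One round of the binary search for a relevant variable. -/
def narrow : Prog :=
  halve ;; ask ;; .cond differ (.set lower (reg threshold)) (.set upper (reg threshold))

/-- Register `lower` becomes the index of a new relevant variable. -/
def search : Prog :=
  .set lower (lit 0) ;; .set upper (reg dim) ;;
  .loop (sub (reg upper) (add (reg lower) (lit 1))) narrow

/-- Add the variable with index in register `lower` to the set of known relevant variables. -/
def record : Prog :=
  .store (add (reg dim) (reg lower)) (lit 1) ;;
  .store (add (add (reg dim) (reg dim)) (reg numVars)) (reg lower) ;;
  .set numVars (add (reg numVars) (lit 1))

/-- Draw a random point, query its value, and store both from address `base` on. -/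
def draw : Prog :=
  forLoop coord dim (.flip value ;; .store (add (reg base) (reg coord)) (reg value)) ;;
  .query label (reg base) ;; .store (add (reg base) (reg dim)) (reg label)

/-- Look for a new relevant variable if there must be one. -/
def explore : Prog := .cond differ (search ;; record) .skip

/-- Draw a sample, and let it contribute to the set of known relevant variables. -/
def sample : Prog :=
  draw ;; .set threshold (lit 0) ;; ask ;; explore ;;
  .set base (add (reg base) (add (reg dim) (lit 1)))

/-- Draw all the samples. -/
def sampling : Prog := forLoop round numSamples sample

theorem eval_differ_ne_zero {σ : State} {b c : Bool} (hlabel : σ.reg label = b.toNat)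
    (hvalue : σ.reg value = c.toNat) : differ.eval σ ≠ 0 ↔ b ≠ c := by
  simp only [differ, Expr.eval, hlabel, hvalue]
  cases b <;> cases c <;> simp

/-- Between `a` and `b`, which differ by at most `w`, the value of `f` at the hybrids of `x` and
the zero point changes. -/
structure Brackets (f : Cube n → Bool) (R : Finset (Fin n)) (x : Cube n) (w a b : ℕ) : Prop where
  lt : a < b
  le : b ≤ n
  le_add : b ≤ a + w
  ne : f (hybrid R a x) ≠ f x
  eq : f (hybrid R b x) = f x

theorem run_ask {R : Finset (Fin n)} {x : Cube n} (σ : State) (hR : Records R σ)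
    (hx : PointAt σ.mem (σ.reg base) x) :
    Run f ω ask σ fun τ => τ.reg value = (f (hybrid R (σ.reg threshold) x)).toNat ∧
      (∀ a, n ≤ a → τ.mem a = σ.mem a) ∧ τ.queries = σ.queries + 1 ∧
      τ.time ≤ σ.time + 24 * n + 8 := by
  have hbase := hR.le_base
  refine (run_forLoop_of_time_le hR.dim (by decide) rfl rfl 15 (fun k τ =>
    (∀ i : Fin n, (i : ℕ) < k → τ.mem i = (hybrid R (σ.reg threshold) x i).toNat) ∧
    ∀ a, n ≤ a → τ.mem a = σ.mem a) (fun _ _ _ => id) ?_ ?_).seq ?_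
  · exact ⟨fun _ h => absurd h (Nat.not_lt_zero _), fun _ _ => rfl⟩
  · rintro k τ hk hcoord hF ⟨hpoint, hmem⟩
    have hthreshold : τ.reg threshold = σ.reg threshold := hF.reg rfl
    have hflag : σ.mem (n + k) ≠ 0 ↔ ⟨k, hk⟩ ∈ R := hR.flags ⟨k, hk⟩
    have hbit := hx ⟨k, hk⟩
    have hround (v : ℕ) (hv : v = (hybrid R (σ.reg threshold) x ⟨k, hk⟩).toNat) :
        (∀ i : Fin n, (i : ℕ) < k + 1 → (τ.setMem k v).mem i =
          (hybrid R (σ.reg threshold) x i).toNat) ∧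
        ∀ a, n ≤ a → (τ.setMem k v).mem a = σ.mem a := by
      refine ⟨fun i hi => ?_, fun a ha => ?_⟩
      · rw [State.setMem_mem]
        split_ifs with hik
        · rw [hv, ← show i = ⟨k, hk⟩ from Fin.ext hik]
        · exact hpoint i (by omega)
      · rw [State.setMem_mem, if_neg (by omega), hmem a ha]
    simp only [run_cond, run_store, Expr.eval, State.tick_reg, State.tick_mem, hcoord, hthreshold,
      hF.reg (x := dim) rfl, hF.reg (x := base) rfl, hR.dim, hmem _ (Nat.le_add_right n k),
      hmem (σ.reg base + k) (by omega)]
    have hcond : σ.reg threshold - k + σ.mem (n + k) ≠ 0 ↔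
        k < σ.reg threshold ∨ ⟨k, hk⟩ ∈ R := by
      rw [← hflag]
      omega
    refine ⟨fun h => ⟨by simp, hround _ ?_⟩, fun h => ⟨by simp, hround _ ?_⟩⟩
    · rw [hybrid, if_pos (hcond.1 h), ← hbit]
    · rw [hybrid, if_neg (mt hcond.2 (not_not.2 h)), Bool.toNat_false]
  · rintro τ hF ⟨⟨hpoint, hmem⟩, -, ht⟩
    have hquery : τ.point n 0 = hybrid R (σ.reg threshold) x :=
      PointAt.point fun i => by simpa using hpoint i i.2
    refine run_query.2 ⟨by simp [hquery], hmem, ?_, ?_⟩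
    · exact congrArg (· + 1) (hF.queries rfl)
    · simp only [State.tick_time, State.setReg_time, Expr.cost]
      omega

theorem run_halve (σ : State) (h : σ.reg lower ≤ σ.reg upper) :
    Run f ω halve σ fun τ => τ.reg threshold = σ.reg lower + (σ.reg upper - σ.reg lower + 1) / 2 ∧
      τ.time ≤ σ.time + 12 * (σ.reg upper - σ.reg lower) + 8 := by
  simp only [halve, run_seq, run_set]
  refine run_loop (fun k τ => 2 * k ≤ σ.reg upper - σ.reg lower + 1 ∧
    τ.reg threshold = σ.reg lower + k ∧ τ.reg mirror = σ.reg upper - k ∧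
    τ.time ≤ σ.time + 4 + 12 * k) (σ.reg upper - σ.reg lower) ?_ ?_ ?_
  · simp
  · rintro k τ - ⟨hk, hthreshold, hmirror, ht⟩ he
    simp only [Expr.eval, hthreshold, hmirror] at he
    refine ⟨by omega, ?_⟩
    simp only [run_seq, run_set, Expr.eval, Expr.cost, State.tick_reg, State.setReg_reg,
      State.tick_time, State.setReg_time, hthreshold, hmirror]
    simp only [OfNat.ofNat_eq_ofNat, Nat.reduceEqDiff, reduceIte]
    omega
  · rintro k τ - ⟨hk, hthreshold, hmirror, ht⟩ he
    simp only [Expr.eval, hthreshold, hmirror] at he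
    simp only [State.tick_reg, State.tick_time, Expr.cost]
    omega

theorem run_narrow {R : Finset (Fin n)} {x : Cube n} {w : ℕ} (σ : State) (hR : Records R σ)
    (hx : PointAt σ.mem (σ.reg base) x) (hlabel : σ.reg label = (f x).toNat)
    (hw : Brackets f R x (2 * w) (σ.reg lower) (σ.reg upper))
    (hgap : σ.reg lower + 1 < σ.reg upper) :
    Run f ω narrow σ fun τ => Brackets f R x w (τ.reg lower) (τ.reg upper) ∧
      (∀ a, n ≤ a → τ.mem a = σ.mem a) ∧ τ.queries = σ.queries + 1 ∧
      τ.time ≤ σ.time + 36 * n + 26 := by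
  obtain ⟨-, hupper, hwidth, hne, heq⟩ := hw
  refine (run_halve σ (by omega)).seq ?_
  rintro τ₁ F₁ ⟨hmid, ht₁⟩
  have hbase : τ₁.reg base = σ.reg base := F₁.reg rfl
  refine (run_ask τ₁ (hR.congr (F₁.reg rfl) hbase.ge (F₁.reg rfl) (by simp [F₁.mem rfl]))
    (by rwa [hbase, F₁.mem rfl])).seq ?_
  rintro τ F₂ ⟨hvalue, hmem, hq, ht⟩
  have hlower : τ.reg lower = σ.reg lower := (F₂.reg rfl).trans (F₁.reg rfl)
  have hupper' : τ.reg upper = σ.reg upper := (F₂.reg rfl).trans (F₁.reg rfl)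
  have hthreshold : τ.reg threshold = τ₁.reg threshold := F₂.reg rfl
  have hdiffer := eval_differ_ne_zero
    (((F₂.reg rfl).trans (F₁.reg (x := label) rfl)).trans hlabel) hvalue
  have hcost : differ.cost = 7 := rfl
  rw [F₁.mem rfl] at hmem
  rw [F₁.queries rfl] at hq
  simp only [run_cond, run_set, Expr.eval, Expr.cost, State.tick_reg, State.tick_mem,
    State.setReg_mem, State.tick_time, State.setReg_time, hthreshold, hcost]
  refine ⟨fun h => ⟨⟨?_, ?_, ?_, ?_, ?_⟩, hmem, hq, by omega⟩,
    fun h => ⟨⟨?_, ?_, ?_, ?_, ?_⟩, hmem, hq, by omega⟩⟩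
  all_goals simp [hlower, hupper']
  all_goals grind

theorem run_search {R : Finset (Fin n)} {x : Cube n} (σ : State) (hR : Records R σ)
    (hx : PointAt σ.mem (σ.reg base) x) (hlabel : σ.reg label = (f x).toNat)
    (hne : f (project R x) ≠ f x) (hn : 0 < n) :
    Run f ω search σ fun τ => (∃ i ∉ R, Relevant f i ∧ τ.reg lower = i) ∧
      (∀ a, n ≤ a → τ.mem a = σ.mem a) ∧ τ.queries ≤ σ.queries + Nat.clog 2 n ∧
      τ.time ≤ σ.time + (Nat.clog 2 n + 1) * (80 * n) := by
  simp only [search, run_seq, run_set]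
  refine run_loop (fun k τ => k ≤ Nat.clog 2 n ∧
    Brackets f R x (2 ^ (Nat.clog 2 n - k)) (τ.reg lower) (τ.reg upper) ∧
    (∀ a, n ≤ a → τ.mem a = σ.mem a) ∧ τ.queries = σ.queries + k ∧
    τ.time ≤ σ.time + k * (80 * n) + 4) (Nat.clog 2 n) ?_ ?_ ?_
  · refine ⟨Nat.zero_le _, ⟨?_, ?_, ?_, ?_, ?_⟩, fun _ _ => rfl, rfl, by simp⟩
    all_goals simp [hR.dim, hybrid_zero, hybrid_self, hne, hn, Nat.le_pow_clog]
  · rintro k τ F ⟨-, hw, hmem, hq, ht⟩ he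
    have hgap : τ.reg lower + 1 < τ.reg upper := by
      simp only [Expr.eval] at he
      omega
    have hk : k < Nat.clog 2 n := by
      by_contra! hk
      have := hw.le_add
      rw [Nat.sub_eq_zero_of_le hk] at this
      omega
    rw [← Nat.sub_add_cancel (Nat.sub_pos_of_lt hk), pow_succ', Nat.sub_sub] at hw
    have hbase : τ.reg base = σ.reg base := F.reg rfl
    refine ⟨hk, (run_narrow (τ.tick 6)
      (hR.congr (F.reg rfl) hbase.ge (F.reg rfl) fun a ha _ => hmem a ha) ?_
      ((F.reg rfl).trans hlabel) hw hgap).mono ?_⟩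
    · rw [State.tick_reg, hbase]
      have := hR.le_base
      exact hx.congr fun i _ => hmem _ (by omega)
    · rintro υ - ⟨hw, hmem', hq', ht'⟩
      simp only [State.tick_queries, State.tick_time] at hq' ht'
      refine ⟨hk, hw, fun a ha => (hmem' a ha).trans (hmem a ha), by omega, ?_⟩
      rw [add_one_mul]
      omega
  · rintro k τ - ⟨hk, ⟨hlt, hle, -, hne, heq⟩, hmem, hq, ht⟩ he
    have hgap : τ.reg upper = τ.reg lower + 1 := by
      simp only [Expr.eval] at he
      omega
    have hfound := notMem_and_relevant_of_hybrid_ne (f := f) (R := R) (x := x)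
      (i := ⟨τ.reg lower, by omega⟩) (by rw [← hgap, heq]; exact hne)
    have hround : k * (80 * n) ≤ Nat.clog 2 n * (80 * n) := Nat.mul_le_mul_right _ hk
    refine ⟨⟨_, hfound.1, hfound.2, rfl⟩, hmem, ?_, ?_⟩
    · exact hq.trans_le (by omega)
    · simp only [State.tick_time, Expr.cost, add_one_mul]
      omega

theorem run_record {R : Finset (Fin n)} {i : Fin n} (σ : State) (hR : Records R σ) (hi : i ∉ R)
    (hlower : σ.reg lower = i) :
    Run f ω record σ fun τ => Records (insert i R) τ ∧ (∀ a, 3 * n ≤ a → τ.mem a = σ.mem a) ∧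
      τ.time ≤ σ.time + 18 := by
  have hcard := card_lt_of_notMem hi
  simp only [record, run_seq, run_set, run_store]
  refine ⟨hR.insert hi (by simp) (by simp) (by simp) ?_, fun a ha => ?_, by simp⟩
  · simp [State.setMem, State.tick, State.setReg, hR.dim, hR.numVars, hlower, two_mul]
  · simp only [Expr.eval, State.tick_mem, State.setReg_mem, State.setMem_mem, State.tick_reg,
      State.setMem_reg, hR.dim, hR.numVars, hlower]
    rw [if_neg (by omega), if_neg (by omega)]

theorem run_explore {R : Finset (Fin n)} {x : Cube n} (σ : State) (hR : Records R σ)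
    (hx : PointAt σ.mem (σ.reg base) x) (hlabel : σ.reg label = (f x).toNat)
    (hvalue : σ.reg value = (f (project R x)).toNat) (hn : 0 < n) :
    Run f ω explore σ fun τ => ∃ R', Step f R x R' ∧ Records R' τ ∧
      (∀ a, 3 * n ≤ a → τ.mem a = σ.mem a) ∧
      τ.queries + R.card * Nat.clog 2 n ≤ σ.queries + R'.card * Nat.clog 2 n ∧
      τ.time + R.card * ((Nat.clog 2 n + 2) * (80 * n)) ≤
        σ.time + 9 + R'.card * ((Nat.clog 2 n + 2) * (80 * n)) := by
  have hcost : differ.cost = 7 := rfl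
  refine run_cond.2 ⟨fun h => ?_, fun h => run_skip.2 ?_⟩
  · have hne : f (project R x) ≠ f x := ((eval_differ_ne_zero hlabel hvalue).1 h).symm
    refine (run_search (σ.tick 8) ⟨hR.dim, hR.le_base, hR.numVars, hR.flags, hR.list⟩ hx hlabel hne
      hn).seq ?_
    rintro τ F ⟨⟨i, hi, hrel, hlower⟩, hmem, hq, ht⟩
    have hbase : τ.reg base = σ.reg base := F.reg rfl
    refine (run_record τ (hR.congr (F.reg rfl) hbase.ge (F.reg rfl) fun a ha _ => hmem a ha) hi
      hlower).mono ?_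
    rintro υ F' ⟨hR', hmem', ht'⟩
    refine ⟨_, .inconsistent hne hi hrel, hR', fun a ha => ?_, ?_, ?_⟩
    · rw [hmem' a ha, hmem a (by omega), State.tick_mem]
    · rw [F'.queries rfl, Finset.card_insert_of_notMem hi, add_one_mul]
      simp only [State.tick_queries] at hq
      omega
    · rw [Finset.card_insert_of_notMem hi]
      simp only [State.tick_time] at ht
      linarith
  · have heq : f (project R x) = f x :=
      (not_ne_iff.1 (mt (eval_differ_ne_zero hlabel hvalue).2 (not_ne_iff.2 h))).symm
    exact ⟨R, .consistent heq, ⟨hR.dim, hR.le_base, hR.numVars, hR.flags, hR.list⟩,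
      fun _ _ => rfl, le_rfl, by simp [hcost]⟩

theorem run_draw {x : Cube n} (σ : State) (hdim : σ.reg dim = n)
    (hx : ∀ i : Fin n, x i = ω (σ.flips + i)) :
    Run f ω draw σ fun τ => SampleAt f τ.mem (σ.reg base) x ∧ τ.reg label = (f x).toNat ∧
      (∀ a < σ.reg base, τ.mem a = σ.mem a) ∧ τ.flips = σ.flips + n ∧
      τ.queries = σ.queries + 1 ∧ τ.time ≤ σ.time + 20 * n + 20 := by
  refine (run_forLoop_of_time_le hdim (by decide) rfl rfl 6 (fun k τ =>
    (∀ i : Fin n, (i : ℕ) < k → τ.mem (σ.reg base + i) = (x i).toNat) ∧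
    (∀ a < σ.reg base, τ.mem a = σ.mem a) ∧ τ.flips = σ.flips + k) (fun _ _ _ => id) ?_ ?_).seq ?_
  · exact ⟨fun _ h => absurd h (Nat.not_lt_zero _), fun _ _ => rfl, rfl⟩
  · rintro k τ - hcoord F ⟨hpoint, hmem, hflips⟩
    have hbase : τ.reg base = σ.reg base := F.reg rfl
    simp only [run_seq, run_flip, run_store, Expr.eval, Expr.cost, State.tick_reg,
      State.setReg_reg, State.setReg_mem, State.tick_mem, State.setMem_mem, hcoord, hbase]
    refine ⟨by simp [State.tick], fun i hi => ?_, fun a ha => ?_, ?_⟩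
    · simp only [reduceIte, show coord ≠ value by decide, show base ≠ value by decide,
        add_right_inj]
      split_ifs with hik
      · rw [hx, hik, hflips]
      · exact hpoint i (by omega)
    · simp only [show coord ≠ value by decide, show base ≠ value by decide, reduceIte]
      rw [if_neg (by omega), hmem a ha]
    · simp [State.tick, hflips, add_assoc]
  · rintro τ F ⟨⟨hpoint, hmem, hflips⟩, -, ht⟩
    have hbase : τ.reg base = σ.reg base := F.reg rfl
    have hpoint' : PointAt τ.mem (σ.reg base) x := fun i => hpoint i i.2
    have hdim' : τ.reg dim = n := (F.reg rfl).trans hdim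
    have hqueries : τ.queries = σ.queries := F.queries rfl
    simp only [run_seq, run_query, run_store, Expr.eval, Expr.cost, hbase, hpoint'.point]
    refine ⟨⟨hpoint'.congr fun i _ => ?_, ?_⟩, ?_, fun a ha => ?_, hflips, ?_, ?_⟩
    · have : σ.reg base + i ≠ τ.reg base + τ.reg dim := by omega
      simp [this]
    · simp [hdim', hbase]
    · simp
    · have : a ≠ τ.reg base + τ.reg dim := by omega
      simp [this, hmem a ha]
    · simp [hqueries]
    · simp only [State.tick_time, State.setMem_time, State.setReg_time]
      omega

theorem run_sample {R : Finset (Fin n)} {x : Cube n} (σ : State) (hR : Records R σ)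
    (hx : ∀ i : Fin n, x i = ω (σ.flips + i)) (hn : 0 < n) :
    Run f ω sample σ fun τ => ∃ R', Step f R x R' ∧ Records R' τ ∧
      τ.reg base = σ.reg base + (n + 1) ∧ SampleAt f τ.mem (σ.reg base) x ∧
      (∀ a, 3 * n ≤ a → a < σ.reg base → τ.mem a = σ.mem a) ∧ τ.flips = σ.flips + n ∧
      τ.queries + R.card * Nat.clog 2 n ≤ σ.queries + 2 + R'.card * Nat.clog 2 n ∧
      τ.time + R.card * ((Nat.clog 2 n + 2) * (80 * n)) ≤
        σ.time + 100 * n + R'.card * ((Nat.clog 2 n + 2) * (80 * n)) := by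
  have hle := hR.le_base
  refine (run_draw σ hR.dim hx).seq ?_
  rintro τ₁ F₁ ⟨hsample, hlabel, hmem₁, hflips₁, hq₁, ht₁⟩
  rw [run_seq, run_set]
  have hbase₁ : τ₁.reg base = σ.reg base := F₁.reg rfl
  have hR₁ : Records R ((τ₁.setReg threshold 0).tick 2) :=
    hR.congr (F₁.reg rfl) hbase₁.ge (F₁.reg rfl) fun a _ ha => hmem₁ a (by omega)
  have hpoint₁ : PointAt τ₁.mem (τ₁.reg base) x := by rw [hbase₁]; exact hsample.1
  refine (run_ask ((τ₁.setReg threshold 0).tick 2) hR₁ hpoint₁).seq ?_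
  rintro τ₂ F₂ ⟨hvalue, hmem₂, hq₂, ht₂⟩
  have hbase₂ : τ₂.reg base = σ.reg base := (F₂.reg rfl).trans hbase₁
  have hvalue' : τ₂.reg value = (f (project R x)).toNat := by simpa [hybrid_zero] using hvalue
  refine (run_explore τ₂ (hR₁.congr (F₂.reg rfl) (hbase₂.trans hbase₁.symm).ge (F₂.reg rfl)
    fun a ha _ => hmem₂ a ha) ?_ ((F₂.reg rfl).trans hlabel) hvalue' hn).seq ?_
  · rw [hbase₂]
    exact hsample.1.congr fun i hi => hmem₂ _ (by omega)
  rintro τ F ⟨R', hstep, hR', hmem, hq, ht⟩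
  have hbase : τ.reg base = σ.reg base := (F.reg rfl).trans hbase₂
  have hmem' : ∀ a, 3 * n ≤ a → τ.mem a = τ₁.mem a := fun a ha =>
    (hmem a ha).trans (hmem₂ a (by omega))
  refine run_set.2 ⟨R', hstep, hR'.congr rfl (by simp) rfl fun _ _ _ => rfl,
    by simp [hbase, hR'.dim], hsample.congr fun i _ => hmem' _ (by omega),
    fun a ha ha' => (hmem' a ha).trans (hmem₁ a ha'), ?_, ?_, ?_⟩
  · exact (F.flips rfl).trans ((F₂.flips rfl).trans hflips₁)
  · simp only [State.tick_queries, State.setReg_queries] at hq₂ ⊢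
    omega
  · simp only [State.tick_time, State.setReg_time, Expr.cost] at ht₂ ⊢
    omega

theorem sampleAddr_add_lt {t k i : ℕ} (ht : t < k) (hi : i ≤ n) :
    sampleAddr n t + i < sampleAddr n k := by
  have : (t + 1) * (n + 1) ≤ k * (n + 1) := Nat.mul_le_mul_right _ ht
  rw [add_one_mul] at this
  simp only [sampleAddr]
  omega

theorem run_sampling {m : ℕ} (σ : State) (hR : Records (∅ : Finset (Fin n)) σ)
    (hm : σ.reg numSamples = m) (hbase : σ.reg base = 3 * n) (hflips : σ.flips = 0) (hn : 0 < n) :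
    Run f ω sampling σ fun τ => ∃ R, Leads f (fun t : Fin m => drawn n ω t) ∅ R ∧ Records R τ ∧
      τ.reg base = sampleAddr n m ∧
      (∀ t < m, SampleAt f τ.mem (sampleAddr n t) (drawn n ω t)) ∧
      τ.queries ≤ σ.queries + 2 * m + R.card * Nat.clog 2 n ∧
      τ.time ≤ σ.time + m * (108 * n) + R.card * ((Nat.clog 2 n + 2) * (80 * n)) + 6 := by
  refine (run_forLoop hm (by decide) rfl rfl (fun k τ => ∃ R,
    Leads f (fun t : Fin k => drawn n ω t) ∅ R ∧ Records R τ ∧ τ.reg base = sampleAddr n k ∧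
    (∀ t < k, SampleAt f τ.mem (sampleAddr n t) (drawn n ω t)) ∧ τ.flips = k * n ∧
    τ.queries ≤ σ.queries + 2 * k + R.card * Nat.clog 2 n ∧
    τ.time ≤ σ.time + k * (108 * n) + R.card * ((Nat.clog 2 n + 2) * (80 * n)) + 2) ?_ ?_).mono ?_
  · exact ⟨∅, rfl, hR.congr rfl le_rfl rfl fun _ _ _ => rfl, by simp [hbase, sampleAddr],
      fun _ h => absurd h (Nat.not_lt_zero _), by simp [hflips], by simp, by simp⟩
  · rintro k τ - - - ⟨R, hlead, hR, hbase, hsamples, hflips, hq, ht⟩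
    refine (run_sample (τ.tick 4) (x := drawn n ω k) (hR.congr rfl le_rfl rfl fun _ _ _ => rfl)
      (fun i => ?_) hn).mono ?_
    · simp only [drawn, State.tick_flips, hflips]
    rintro υ - ⟨R', hstep, hR', hbase', hsample, hmem, hflips', hq', ht'⟩
    refine ⟨R', hlead.snoc hstep, hR'.congr rfl le_rfl rfl fun _ _ _ => rfl, ?_, ?_, ?_, ?_, ?_⟩
    · rw [State.tick_reg, State.setReg_reg, if_neg (by decide), hbase', State.tick_reg, hbase,
        sampleAddr, sampleAddr, add_one_mul, add_assoc]
    · intro t ht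
      obtain rfl | ht := Nat.eq_or_lt_of_le (Nat.lt_succ_iff.1 ht)
      · exact hbase ▸ hsample
      · refine (hsamples t ht).congr fun i hi => hmem _ ?_ ?_
        · exact (Nat.le_add_right _ _).trans (Nat.le_add_right _ _)
        · exact (sampleAddr_add_lt ht hi).trans_eq hbase.symm
    · rw [add_one_mul]
      exact hflips'.trans (by simp [hflips])
    · simp only [State.tick_queries, State.setReg_queries] at hq' ⊢
      omega
    · simp only [State.tick_time, State.setReg_time, add_one_mul] at ht' ⊢
      omega
  · rintro τ - ⟨-, υ, ⟨R, hlead, hR, hbase, hsamples, -, hq, ht⟩, rfl⟩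
    exact ⟨R, hlead, ⟨hR.dim, hR.le_base, hR.numVars, hR.flags, hR.list⟩, hbase, hsamples, hq,
      by simp only [State.tick_time]; omega⟩

/-! ### Splitting the samples -/

section

/-- The number of nodes with fewer than `k` edges above them in the complete tree in which every
node has two children for each of `r` variables. -/
def internal (r : ℕ) : ℕ → ℕ
  | 0 => 0
  | k + 1 => r * (internal r k + internal r k) + 1

/-- The address of the record of the `j`-th node: an output tree node in three cells, the size of
the output tree, and `m` cells that mark the samples that reach the node. -/
def nodeAddr (n m j : ℕ) : ℕ := sampleAddr n m + j * (m + 4)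

/-- Register `numInternal` becomes the number of nodes that are split. -/
def countInternal : Prog :=
  .set numInternal (lit 0) ;;
  forLoop level maxDepth
    (.set total (lit 1) ;; addMul var numVars total (add (reg numInternal) (reg numInternal)) ;;
      .set numInternal (reg total))

/-- Pass the sample with index in register `mark` from the node with record address in register
`parent` on to one of the two children with record addresses from register `child` on, depending on
its coordinate in register `feature`. -/
def splitSample : Prog :=
  .store (add (add (reg child) (lit 4)) (reg mark))
    (sub (load (add (add (reg parent) (lit 4)) (reg mark)))
      (load (add (reg location) (reg feature)))) ;;
  .store (add (add (add (reg child) (reg recLen)) (lit 4)) (reg mark))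
    (sub (load (add (add (reg parent) (lit 4)) (reg mark)))
      (sub (lit 1) (load (add (reg location) (reg feature))))) ;;
  .set location (add (reg location) (add (reg dim) (lit 1)))

/-- Split the samples at one node according to the variable in position `var` of the list. -/
def split : Prog :=
  .set feature (load (add (add (reg dim) (reg dim)) (reg var))) ;;
  .set location (add (reg dim) (add (reg dim) (reg dim))) ;;
  forLoop mark numSamples splitSample

/-- Split the samples at one node according to all variables. -/
def expand : Prog :=
  forLoop var numVars (split ;; .set child (add (reg child) (add (reg recLen) (reg recLen))))

/-- All samples reach the root. -/
def markRoot : Prog :=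
  forLoop mark numSamples (.store (add (add (reg base) (lit 4)) (reg mark)) (lit 1))

/-- Split the samples at one node, and go to the next node. -/
def splitNext : Prog := expand ;; .set parent (add (reg parent) (reg recLen))

/-- Mark the samples that reach each node. -/
def splitting : Prog :=
  .set recLen (add (reg numSamples) (lit 4)) ;; markRoot ;;
  .set parent (reg base) ;; .set child (add (reg base) (reg recLen)) ;;
  forLoop node numInternal splitNext

/-- The samples at the record address `p` are split by the variable in position `v` of the list
among the two records from the address `c` on. -/
def SplitAt (n m : ℕ) (mem : ℕ → ℕ) (p c v : ℕ) : Prop :=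
  ∀ t < m,
    mem (c + 4 + t) = mem (p + 4 + t) - mem (sampleAddr n t + mem (2 * n + v)) ∧
    mem (c + (m + 4) + 4 + t) =
      mem (p + 4 + t) - (1 - mem (sampleAddr n t + mem (2 * n + v)))

/-- The samples at all nodes `j < I` are split among their children. -/
def SplitBelow (n m r : ℕ) (mem : ℕ → ℕ) (I : ℕ) : Prop :=
  ∀ j < I, ∀ v < r, SplitAt n m mem (nodeAddr n m j) (nodeAddr n m (2 * r * j + 1 + 2 * v)) v

variable {m d r : ℕ}

theorem nodeAddr_add_le {i j : ℕ} (h : i < j) : nodeAddr n m i + (m + 4) ≤ nodeAddr n m j := by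
  have := Nat.mul_le_mul_right (m + 4) (Nat.succ_le_of_lt h)
  rw [Nat.succ_mul] at this
  simp only [nodeAddr]
  omega

theorem SplitAt.congr {mem mem' : ℕ → ℕ} {p c v a : ℕ} (h : SplitAt n m mem p c v)
    (hmem : ∀ b < a, mem' b = mem b) (hpa : p + (m + 4) ≤ a) (hca : c + 2 * (m + 4) ≤ a)
    (hsamples : sampleAddr n m ≤ a) (hv : v < n) (hvar : mem (2 * n + v) < n) :
    SplitAt n m mem' p c v := by
  intro t ht
  have := sampleAddr_add_lt ht hvar.le
  have : 3 * n ≤ sampleAddr n m := Nat.le_add_right _ _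
  rw [hmem (2 * n + v) (by omega), hmem (sampleAddr n t + _) (by omega), hmem _ (by omega),
    hmem _ (by omega), hmem _ (by omega)]
  exact h t ht

theorem run_countInternal (σ : State) (hd : σ.reg maxDepth = d) (hr : σ.reg numVars = r) :
    Run f ω countInternal σ fun τ => τ.reg numInternal = internal r d ∧
      τ.time ≤ σ.time + d * (20 + 20 * r) + 10 := by
  rw [countInternal, run_seq, run_set]
  refine Run.mono (run_forLoop_of_time_le (by exact hd) (by decide) rfl rfl (14 * r + 10)
    (fun k τ => τ.reg numInternal = internal r k) (fun _ _ _ => id) rfl ?_) ?_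
  · intro k τ _ _ F hI
    rw [run_seq, run_set]
    refine (run_addMul (N := r) (v := internal r k + internal r k) _ (by decide) (by decide)
      (by decide) ?_ ?_).seq ?_
    · exact (F.reg (x := numVars) rfl).trans hr
    · intro υ F'
      simp only [Expr.eval, F'.reg (x := numInternal) rfl]
      exact congrArg (fun i => i + i) hI
    · rintro υ - ⟨htotal, ht⟩
      simp only [State.tick_time, State.setReg_time, Expr.cost] at ht
      refine run_set.2 ⟨?_, ?_⟩
      · simp only [State.tick_time, State.setReg_time, Expr.cost]
        omega
      · simpa [internal, add_comm] using htotal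
  · rintro τ - ⟨hI, -, ht⟩
    refine ⟨hI, ht.trans ?_⟩
    simp only [State.tick_time, State.setReg_time, Expr.cost]
    nlinarith

theorem run_splitSample {p c i k : ℕ} (σ : State) (hdim : σ.reg dim = n)
    (hlen : σ.reg recLen = m + 4) (hparent : σ.reg parent = p) (hchild : σ.reg child = c)
    (hfeature : σ.reg feature = i) (hmark : σ.reg mark = k)
    (hlocation : σ.reg location = sampleAddr n k) (hp : sampleAddr n m ≤ p)
    (hc : p + (m + 4) ≤ c) (hk : k < m) (hi : i < n) :
    Run f ω splitSample σ fun τ => τ.reg location = sampleAddr n (k + 1) ∧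
      τ.mem (c + 4 + k) = σ.mem (p + 4 + k) - σ.mem (sampleAddr n k + i) ∧
      τ.mem (c + (m + 4) + 4 + k) = σ.mem (p + 4 + k) - (1 - σ.mem (sampleAddr n k + i)) ∧
      (∀ a, a ≠ c + 4 + k → a ≠ c + (m + 4) + 4 + k → τ.mem a = σ.mem a) ∧
      τ.time ≤ σ.time + 50 := by
  have hlt := sampleAddr_add_lt hk hi.le
  simp only [splitSample, run_seq, run_set, run_store, Expr.eval, Expr.cost, State.tick_reg,
    State.tick_mem, State.setMem_reg, State.setMem_mem, State.setReg_reg, State.setReg_mem,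
    State.tick_time, State.setMem_time, State.setReg_time, hdim, hlen, hparent, hchild, hfeature,
    hmark, hlocation]
  rw [if_neg (by omega : sampleAddr n k + i ≠ c + 4 + k),
    if_neg (by omega : p + 4 + k ≠ c + 4 + k)]
  refine ⟨by simp [sampleAddr, add_one_mul, add_assoc], ?_, if_pos trivial, fun a ha ha' => ?_,
    by omega⟩
  · rw [if_neg (by omega), if_pos trivial]
  · rw [if_neg ha', if_neg ha]

theorem run_split {p c v : ℕ} (σ : State) (hdim : σ.reg dim = n) (hm : σ.reg numSamples = m)
    (hlen : σ.reg recLen = m + 4) (hparent : σ.reg parent = p) (hchild : σ.reg child = c)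
    (hvar : σ.reg var = v) (hp : sampleAddr n m ≤ p) (hc : p + (m + 4) ≤ c) (hv : v < n)
    (hV : σ.mem (2 * n + v) < n) :
    Run f ω split σ fun τ => SplitAt n m τ.mem p c v ∧ (∀ a < c, τ.mem a = σ.mem a) ∧
      τ.time ≤ σ.time + m * 60 + 20 := by
  have hsamples : 3 * n ≤ sampleAddr n m := Nat.le_add_right _ _
  generalize hi : σ.mem (2 * n + v) = i at hV
  simp only [split, run_seq, run_set]
  refine Run.mono (run_forLoop_of_time_le (by exact hm) (by decide) rfl rfl 50 (fun k τ =>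
    τ.reg location = sampleAddr n k ∧ (∀ a < c, τ.mem a = σ.mem a) ∧
    ∀ t < k, τ.mem (c + 4 + t) = σ.mem (p + 4 + t) - σ.mem (sampleAddr n t + i) ∧
      τ.mem (c + (m + 4) + 4 + t) = σ.mem (p + 4 + t) - (1 - σ.mem (sampleAddr n t + i)))
    (fun _ _ _ => id) ?_ ?_) ?_
  · refine ⟨?_, fun _ _ => rfl, fun _ h => absurd h (Nat.not_lt_zero _)⟩
    simp only [State.setReg_reg, State.tick_reg, Expr.eval, hdim, sampleAddr, reduceIte,
      show location ≠ mark by decide, show dim ≠ feature by decide]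
    omega
  · rintro k τ hk hmark F ⟨hlocation, hmem, hs⟩
    have hlt := sampleAddr_add_lt hk hV.le
    refine (run_splitSample τ ((F.reg rfl).trans hdim) ((F.reg rfl).trans hlen)
      ((F.reg rfl).trans hparent) ((F.reg rfl).trans hchild)
      ((F.reg rfl).trans (by simp [hdim, hvar, two_mul, ← hi])) hmark hlocation hp hc hk hV).mono ?_
    rintro υ - ⟨hlocation', hleft, hright, hoff, ht⟩
    refine ⟨ht, hlocation', fun a ha => (hoff a (by omega) (by omega)).trans (hmem a ha),
      fun t ht => ?_⟩
    · rw [State.setReg_mem]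
      obtain rfl | ht := Nat.eq_or_lt_of_le (Nat.lt_succ_iff.1 ht)
      · rw [hleft, hright, hmem _ (by omega), hmem _ (by omega)]
        exact ⟨rfl, rfl⟩
      · rw [hoff _ (by omega) (by omega), hoff _ (by omega) (by omega)]
        exact hs t ht
  · rintro τ - ⟨⟨-, hmem, hs⟩, -, ht⟩
    refine ⟨fun t ht => ?_, hmem, ht.trans ?_⟩
    · have := sampleAddr_add_lt ht hV.le
      rw [hmem (2 * n + v) (by omega), hi, hmem (p + 4 + t) (by omega),
        hmem (sampleAddr n t + i) (by omega)]
      exact hs t ht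
    · simp only [State.tick_time, State.setReg_time, Expr.cost]
      omega

theorem run_expand {p c : ℕ} (σ : State) (hdim : σ.reg dim = n) (hm : σ.reg numSamples = m)
    (hr : σ.reg numVars = r) (hlen : σ.reg recLen = m + 4) (hparent : σ.reg parent = p)
    (hchild : σ.reg child = c) (hp : sampleAddr n m ≤ p) (hc : 0 < r → p + (m + 4) ≤ c)
    (hrn : r ≤ n) (hV : ∀ v < r, σ.mem (2 * n + v) < n) :
    Run f ω expand σ fun τ => (∀ v < r, SplitAt n m τ.mem p (c + 2 * v * (m + 4)) v) ∧
      τ.reg child = c + 2 * r * (m + 4) ∧ (∀ a < c, τ.mem a = σ.mem a) ∧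
      τ.time ≤ σ.time + r * (40 + m * 60) + 6 := by
  have hsamples : 3 * n ≤ sampleAddr n m := Nat.le_add_right _ _
  refine Run.mono (run_forLoop_of_time_le hr (by decide) rfl rfl (m * 60 + 30) (fun k τ =>
    (∀ v < k, SplitAt n m τ.mem p (c + 2 * v * (m + 4)) v) ∧
    τ.reg child = c + 2 * k * (m + 4) ∧ ∀ a < c, τ.mem a = σ.mem a)
    (fun _ _ _ => id) ?_ ?_) ?_
  · exact ⟨fun _ h => absurd h (Nat.not_lt_zero _), by simp [hchild], fun _ _ => rfl⟩
  · rintro k τ hk hvar F ⟨hs, hchild', hmem⟩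
    have hc := hc (by omega)
    have hVτ : ∀ v < r, τ.mem (2 * n + v) < n := fun v hv => by
      rw [hmem _ (by omega)]
      exact hV v hv
    have hlen' : τ.reg recLen = m + 4 := (F.reg rfl).trans hlen
    refine (run_split τ ((F.reg rfl).trans hdim) ((F.reg rfl).trans hm) hlen'
      ((F.reg rfl).trans hparent) hchild' hvar hp (by omega) (by omega) (hVτ k hk)).seq ?_
    rintro υ F' ⟨hs', hmem', ht⟩
    have hchild'' : υ.reg child = τ.reg child := F'.reg rfl
    have hlen'' : υ.reg recLen = τ.reg recLen := F'.reg rfl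
    have hsucc (v : ℕ) : 2 * (v + 1) * (m + 4) = 2 * v * (m + 4) + 2 * (m + 4) := by ring
    refine run_set.2 ⟨?_, fun v hv => ?_, ?_, fun a ha => ?_⟩
    · simp only [State.tick_time, State.setReg_time, Expr.cost]
      omega
    · obtain rfl | hv := Nat.eq_or_lt_of_le (Nat.lt_succ_iff.1 hv)
      · exact hs'
      · have : 2 * (v + 1) * (m + 4) ≤ 2 * k * (m + 4) := by gcongr; omega
        exact (hs v hv).congr hmem' (by omega) (by rw [hsucc] at this; omega) (by omega)
          (by omega) (hVτ v (by omega))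
    · simp only [Expr.eval, State.tick_reg, State.setReg_reg, hchild'', hlen'', hchild', hlen',
        hsucc, OfNat.ofNat_eq_ofNat, Nat.reduceEqDiff, reduceIte]
      omega
    · exact (hmem' a (by omega)).trans (hmem a ha)
  · rintro τ - ⟨⟨hs, hchild', hmem⟩, -, ht⟩
    have : r * (m * 60 + 30 + 8) ≤ r * (40 + m * 60) := Nat.mul_le_mul_left _ (by omega)
    exact ⟨hs, hchild', hmem, by omega⟩

theorem run_markRoot {a : ℕ} (σ : State) (hm : σ.reg numSamples = m) (hbase : σ.reg base = a) :
    Run f ω markRoot σ fun τ => (∀ t < m, τ.mem (a + 4 + t) = 1) ∧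
      (∀ b < a, τ.mem b = σ.mem b) ∧ τ.time ≤ σ.time + m * 20 + 6 := by
  refine Run.mono (run_forLoop_of_time_le hm (by decide) rfl rfl 7 (fun k τ =>
    (∀ t < k, τ.mem (a + 4 + t) = 1) ∧ ∀ b < a, τ.mem b = σ.mem b) (fun _ _ _ => id) ?_ ?_) ?_
  · exact ⟨fun _ h => absurd h (Nat.not_lt_zero _), fun _ _ => rfl⟩
  · rintro k τ - hmark F ⟨hones, hmem⟩
    have hbase' : τ.reg base = a := (F.reg rfl).trans hbase
    simp only [run_store, Expr.eval, Expr.cost, hmark, hbase']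
    refine ⟨le_rfl, fun t ht => ?_, fun b hb => ?_⟩
    · obtain rfl | ht := Nat.eq_or_lt_of_le (Nat.lt_succ_iff.1 ht)
      · simp
      · simp [ht.ne, hones t ht]
    · have : b ≠ a + 4 + k := by omega
      simp [this, hmem b hb]
  · rintro τ - ⟨⟨hones, hmem⟩, -, ht⟩
    exact ⟨hones, hmem, by omega⟩

theorem nodeAddr_mono {i j : ℕ} (h : i ≤ j) : nodeAddr n m i ≤ nodeAddr n m j :=
  Nat.add_le_add_left (Nat.mul_le_mul_right _ h) _

theorem nodeAddr_add (i j : ℕ) : nodeAddr n m (i + j) = nodeAddr n m i + j * (m + 4) := by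
  simp only [nodeAddr]
  ring

theorem SplitBelow.succ {mem mem' : ℕ → ℕ} {j : ℕ} (h : SplitBelow n m r mem j)
    (hmem : ∀ a < nodeAddr n m (2 * r * j + 1), mem' a = mem a)
    (hj : ∀ v < r, SplitAt n m mem' (nodeAddr n m j) (nodeAddr n m (2 * r * j + 1 + 2 * v)) v)
    (hrn : r ≤ n) (hV : ∀ v < r, mem (2 * n + v) < n) : SplitBelow n m r mem' (j + 1) := by
  intro i hi v hv
  obtain rfl | hi := Nat.eq_or_lt_of_le (Nat.lt_succ_iff.1 hi)
  · exact hj v hv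
  · have hle : 2 * r * (i + 1) ≤ 2 * r * j := Nat.mul_le_mul_left _ hi
    rw [Nat.mul_succ] at hle
    have hi' : 1 * i ≤ 2 * r * i := Nat.mul_le_mul_right _ (by omega)
    have hchild := nodeAddr_add_le (n := n) (m := m)
      (show 2 * r * i + 1 + 2 * v + 1 < 2 * r * j + 1 by omega)
    have hsib := nodeAddr_add_le (n := n) (m := m)
      (show 2 * r * i + 1 + 2 * v < 2 * r * i + 1 + 2 * v + 1 by omega)
    exact (h i hi v hv).congr hmem (nodeAddr_add_le (by omega)) (by omega)
      (Nat.le_add_right _ _) (by omega) (hV v hv)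

theorem run_splitNext {j : ℕ} (σ : State) (hdim : σ.reg dim = n) (hm : σ.reg numSamples = m)
    (hr : σ.reg numVars = r) (hlen : σ.reg recLen = m + 4) (hparent : σ.reg parent = nodeAddr n m j)
    (hchild : σ.reg child = nodeAddr n m (2 * r * j + 1)) (hs : SplitBelow n m r σ.mem j)
    (hrn : r ≤ n) (hV : ∀ v < r, σ.mem (2 * n + v) < n) :
    Run f ω splitNext σ fun τ => SplitBelow n m r τ.mem (j + 1) ∧
      τ.reg parent = nodeAddr n m (j + 1) ∧
      τ.reg child = nodeAddr n m (2 * r * (j + 1) + 1) ∧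
      (∀ a < nodeAddr n m 1, τ.mem a = σ.mem a) ∧
      τ.time ≤ σ.time + r * (40 + m * 60) + 10 := by
  refine (run_expand σ hdim hm hr hlen hparent hchild (Nat.le_add_right _ _)
    (fun hr' => nodeAddr_add_le ?_) hrn hV).seq ?_
  · have : 1 * j ≤ 2 * r * j := Nat.mul_le_mul_right _ (by omega)
    omega
  rintro τ F ⟨hs', hchild', hmem, ht⟩
  have hlen' : τ.reg recLen = m + 4 := (F.reg rfl).trans hlen
  have hparent' : τ.reg parent = nodeAddr n m j := (F.reg rfl).trans hparent
  refine run_set.2 ⟨hs.succ hmem (fun v hv => ?_) hrn hV, ?_, ?_,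
    fun a ha => hmem a (ha.trans_le (nodeAddr_mono (by omega))), ?_⟩
  · rw [nodeAddr_add (2 * r * j + 1)]
    exact hs' v hv
  · simp [hparent', hlen', nodeAddr_add]
  · rw [mul_add_one, add_right_comm, nodeAddr_add (2 * r * j + 1)]
    exact hchild'
  · simp only [State.tick_time, State.setReg_time, Expr.cost]
    omega

theorem run_splitting {I : ℕ} (σ : State) (hdim : σ.reg dim = n) (hm : σ.reg numSamples = m)
    (hbase : σ.reg base = sampleAddr n m) (hr : σ.reg numVars = r) (hI : σ.reg numInternal = I)
    (hrn : r ≤ n) (hV : ∀ v < r, σ.mem (2 * n + v) < n) :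
    Run f ω splitting σ fun τ => (∀ t < m, τ.mem (nodeAddr n m 0 + 4 + t) = 1) ∧
      SplitBelow n m r τ.mem I ∧ τ.reg parent = nodeAddr n m I ∧
      τ.reg child = nodeAddr n m (2 * r * I + 1) ∧ τ.reg recLen = m + 4 ∧
      (∀ a < sampleAddr n m, τ.mem a = σ.mem a) ∧
      τ.time ≤ σ.time + m * 20 + I * (40 + r * (40 + m * 60)) + 40 := by
  have hroot : nodeAddr n m 0 = sampleAddr n m := by simp [nodeAddr]
  have hsamples : 3 * n ≤ sampleAddr n m := Nat.le_add_right _ _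
  have hfirst : nodeAddr n m 0 + (m + 4) ≤ nodeAddr n m 1 := nodeAddr_add_le Nat.zero_lt_one
  rw [splitting, run_seq, run_set]
  refine Run.seq (run_markRoot _ (by exact hm) (by exact hbase)) ?_
  rintro τ₁ F₁ ⟨hones, hmem₁, ht₁⟩
  have hlen₁ : τ₁.reg recLen = m + 4 := (F₁.reg rfl).trans (by simp [hm])
  have hbase₁ : τ₁.reg base = sampleAddr n m := (F₁.reg rfl).trans hbase
  simp only [run_seq, run_set]
  refine Run.mono (run_forLoop_of_time_le (by exact (F₁.reg (x := numInternal) rfl).trans hI)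
    (by decide) rfl rfl (r * (40 + m * 60) + 10) (fun j τ => SplitBelow n m r τ.mem j ∧
      τ.reg parent = nodeAddr n m j ∧ τ.reg child = nodeAddr n m (2 * r * j + 1) ∧
      ∀ a < nodeAddr n m 1, τ.mem a = τ₁.mem a) (fun _ _ _ => id) ?_ ?_) ?_
  · refine ⟨fun _ h => absurd h (Nat.not_lt_zero _), ?_, ?_, fun _ _ => rfl⟩
    all_goals simp [hbase₁, hlen₁, nodeAddr]
  · rintro j τ - - F ⟨hs, hparent, hchild, hmem⟩
    refine (run_splitNext τ ((F.reg rfl).trans ((F₁.reg rfl).trans hdim))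
      ((F.reg rfl).trans ((F₁.reg rfl).trans hm)) ((F.reg rfl).trans ((F₁.reg rfl).trans hr))
      ((F.reg rfl).trans hlen₁) hparent hchild hs hrn fun v hv => ?_).mono ?_
    · rw [hmem _ (by omega), hmem₁ _ (by omega)]
      exact hV v hv
    · rintro υ - ⟨hs, hparent, hchild, hmem', ht⟩
      exact ⟨by omega, hs, hparent, hchild, fun a ha => (hmem' a ha).trans (hmem a ha)⟩
  · rintro τ F ⟨⟨hs, hparent, hchild, hmem⟩, -, ht⟩
    refine ⟨fun t ht => ?_, hs, hparent, hchild, (F.reg rfl).trans hlen₁, fun a ha => ?_, ?_⟩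
    · rw [hmem _ (by omega), hroot, hones t ht]
    · exact (hmem a (by omega)).trans (hmem₁ a ha)
    · simp only [State.tick_time, State.setReg_time, Expr.cost] at ht ht₁
      have : I * (r * (40 + m * 60) + 10 + 8) ≤ I * (40 + r * (40 + m * 60)) :=
        Nat.mul_le_mul_left _ (by omega)
      omega

end

/-! ### Choosing the trees -/

section

/-- Find out which labels the samples at the record address in register `leafAddr` have. -/
def scan : Prog :=
  .set hasZero (lit 0) ;; .set hasOne (lit 0) ;;
  .set location (add (reg dim) (add (reg dim) (add (reg dim) (reg dim)))) ;;
  forLoop mark numSamples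
    (.cond (load (add (add (reg leafAddr) (lit 4)) (reg mark)))
      (.cond (load (reg location)) (.set hasOne (lit 1)) (.set hasZero (lit 1))) .skip ;;
    .set location (add (reg location) (add (reg dim) (lit 1))))

/-- Make a leaf at the record address in register `leafAddr`. If the samples there have different
labels then the leaf gets a size that exceeds the allowed one. -/
def leaf : Prog :=
  scan ;; .store (reg leafAddr) (sub (lit 1) (reg hasZero)) ;;
  .store (add (reg leafAddr) (lit 3)) (lit 1) ;;
  .cond (reg hasZero)
    (.cond (reg hasOne) (.store (add (reg leafAddr) (lit 3)) (add (reg maxSize) (lit 1))) .skip)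
    .skip

/-- Make leaves at all nodes; register `child` holds the address after the last record. -/
def leaves : Prog :=
  .set leafAddr (reg base) ;;
  .loop (sub (reg child) (reg leafAddr)) (leaf ;; .set leafAddr (add (reg leafAddr) (reg recLen)))

/-- All samples at the node `j` have the label `b`. -/
def Pure (n m : ℕ) (mem : ℕ → ℕ) (j : ℕ) (b : Bool) : Prop :=
  ∀ t < m, mem (nodeAddr n m j + 4 + t) ≠ 0 → mem (sampleAddr n t + n) = b.toNat

/-- The size of the tree that the record of the node `j` holds. -/
def treeSize (n m : ℕ) (mem : ℕ → ℕ) (j : ℕ) : ℕ := mem (nodeAddr n m j + 3)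

/-- The record of the node `j` holds a leaf that is consistent with its samples, or a leaf of size
`s + 1` if there is no consistent one. -/
def LeafAt (n m s : ℕ) (mem : ℕ → ℕ) (j : ℕ) : Prop :=
  (treeSize n m mem j = 1 ∧ ∃ b : Bool, mem (nodeAddr n m j) = b.toNat ∧ Pure n m mem j b) ∨
    (treeSize n m mem j = s + 1 ∧ ∀ b, ¬ Pure n m mem j b)

/-- The two memory contents hold the same samples and the same marks at all nodes. -/
structure SameMarks (n m : ℕ) (mem mem' : ℕ → ℕ) : Prop where
  sample : ∀ a < sampleAddr n m, mem' a = mem a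
  mark : ∀ j, ∀ t < m, mem' (nodeAddr n m j + 4 + t) = mem (nodeAddr n m j + 4 + t)

/-- The two memory contents agree outside the four cells that describe the tree at the node `i`. -/
def SameOff (n m i : ℕ) (mem mem' : ℕ → ℕ) : Prop :=
  ∀ a, a < nodeAddr n m i ∨ nodeAddr n m i + 4 ≤ a → mem' a = mem a

variable {m s : ℕ} {mem mem' mem'' : ℕ → ℕ} {i j : ℕ}

theorem SameMarks.refl (n m : ℕ) (mem : ℕ → ℕ) : SameMarks n m mem mem :=
  ⟨fun _ _ => rfl, fun _ _ _ => rfl⟩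

theorem SameMarks.trans (h : SameMarks n m mem mem') (h' : SameMarks n m mem' mem'') :
    SameMarks n m mem mem'' :=
  ⟨fun a ha => (h'.sample a ha).trans (h.sample a ha),
    fun j t ht => (h'.mark j t ht).trans (h.mark j t ht)⟩

theorem SameMarks.pure_iff (h : SameMarks n m mem mem') {b : Bool} :
    Pure n m mem' j b ↔ Pure n m mem j b := by
  refine forall₂_congr fun t ht => ?_
  rw [h.mark j t ht, h.sample _ (sampleAddr_add_lt ht le_rfl)]

theorem nodeAddr_add_lt_or_le {t : ℕ} (ht : t < m + 4) (h : j ≠ i ∨ 4 ≤ t) :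
    nodeAddr n m j + t < nodeAddr n m i ∨ nodeAddr n m i + 4 ≤ nodeAddr n m j + t := by
  rcases lt_trichotomy j i with hji | rfl | hij
  · have := nodeAddr_add_le (n := n) (m := m) hji
    omega
  · omega
  · have := nodeAddr_add_le (n := n) (m := m) hij
    omega

theorem SameOff.sameMarks (h : SameOff n m i mem mem') : SameMarks n m mem mem' := by
  refine ⟨fun a ha => h a (Or.inl (ha.trans_le (Nat.le_add_right _ _))), fun j t ht => ?_⟩
  rw [add_assoc]
  exact h _ (nodeAddr_add_lt_or_le (by omega) (by omega))

theorem SameOff.header (h : SameOff n m i mem mem') (hji : j ≠ i) {t : ℕ} (ht : t < 4) :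
    mem' (nodeAddr n m j + t) = mem (nodeAddr n m j + t) :=
  h _ (nodeAddr_add_lt_or_le (by omega) (Or.inl hji))

theorem SameOff.treeSize_eq (h : SameOff n m i mem mem') (hji : j ≠ i) :
    treeSize n m mem' j = treeSize n m mem j :=
  h.header hji (by omega)

theorem LeafAt.congr (hj : LeafAt n m s mem j) (h : SameOff n m i mem mem') (hji : j ≠ i) :
    LeafAt n m s mem' j := by
  have h₀ : mem' (nodeAddr n m j) = mem (nodeAddr n m j) := h.header hji (t := 0) (by omega)
  simpa only [LeafAt, h.sameMarks.pure_iff, h₀, h.treeSize_eq hji] using hj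

theorem run_scan (σ : State) (hdim : σ.reg dim = n) (hm : σ.reg numSamples = m)
    (haddr : σ.reg leafAddr = nodeAddr n m j) (hlabel : ∀ t < m, σ.mem (sampleAddr n t + n) ≤ 1) :
    Run f ω scan σ fun τ => (τ.reg hasZero = 0 ↔ Pure n m σ.mem j true) ∧
      (τ.reg hasOne = 0 ↔ Pure n m σ.mem j false) ∧ τ.time ≤ σ.time + m * 40 + 20 := by
  simp only [scan, run_seq, run_set]
  refine Run.mono (run_forLoop_of_time_le (by exact hm) (by decide) rfl rfl 30 (fun k τ =>
    τ.reg location = sampleAddr n k + n ∧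
    (τ.reg hasZero = 0 ↔
      ∀ t < k, σ.mem (nodeAddr n m j + 4 + t) ≠ 0 → σ.mem (sampleAddr n t + n) = 1) ∧
    (τ.reg hasOne = 0 ↔
      ∀ t < k, σ.mem (nodeAddr n m j + 4 + t) ≠ 0 → σ.mem (sampleAddr n t + n) = 0))
    (fun _ _ _ => id) ?_ ?_) ?_
  · refine ⟨?_, by simp, by simp⟩
    simp only [Expr.eval, State.tick_reg, State.setReg_reg, hdim, sampleAddr, zero_mul,
      OfNat.ofNat_eq_ofNat, OfNat.zero_ne_ofNat, Nat.reduceEqDiff, reduceIte]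
    omega
  · rintro k τ hk hmark F ⟨hloc, hzero, hone⟩
    have hdim' : τ.reg dim = n := (F.reg rfl).trans hdim
    have haddr' : τ.reg leafAddr = nodeAddr n m j := (F.reg rfl).trans haddr
    have hmem : τ.mem = σ.mem := F.mem rfl
    have := hlabel k hk
    simp only [run_seq, run_cond, run_set, run_skip, Expr.eval, Expr.cost, State.tick_reg,
      State.tick_mem, State.setReg_reg, State.tick_time, State.setReg_time, hdim', haddr', hmem,
      hmark, hloc, Nat.forall_lt_succ_right]
    have hsucc : sampleAddr n k + n + (n + 1) = sampleAddr n (k + 1) + n := by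
      simp only [sampleAddr]
      ring
    refine ⟨fun hmarked => ⟨fun hl => ⟨by omega, ?_⟩, fun hl => ⟨by omega, ?_⟩⟩,
      fun hmarked => ⟨by omega, ?_⟩⟩
    · have : σ.mem (sampleAddr n k + n) = 1 := by omega
      simp [hsucc, hzero, hmarked, this]
    · simp [hsucc, hone, hmarked, hl]
    · simp [hsucc, hzero, hone, hmarked]
  · rintro τ - ⟨⟨-, hzero, hone⟩, -, ht⟩
    refine ⟨hzero, hone, ht.trans ?_⟩
    simp only [State.tick_time, State.setReg_time, Expr.cost]
    omega

theorem run_leaf (σ : State) (hdim : σ.reg dim = n) (hs : σ.reg maxSize = s)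
    (hm : σ.reg numSamples = m) (haddr : σ.reg leafAddr = nodeAddr n m j)
    (hlabel : ∀ t < m, σ.mem (sampleAddr n t + n) ≤ 1) :
    Run f ω leaf σ fun τ => LeafAt n m s τ.mem j ∧
      SameOff n m j σ.mem τ.mem ∧ τ.time ≤ σ.time + m * 40 + 45 := by
  refine (run_scan σ hdim hm haddr hlabel).seq ?_
  rintro τ F ⟨hzero, hone, ht⟩
  have haddr' : τ.reg leafAddr = nodeAddr n m j := (F.reg rfl).trans haddr
  have hs' : τ.reg maxSize = s := (F.reg rfl).trans hs
  have hmem : τ.mem = σ.mem := F.mem rfl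
  suffices h : Run f ω _ τ fun υ => ((υ.mem (nodeAddr n m j + 3) = 1 ∧
        ∃ b : Bool, υ.mem (nodeAddr n m j) = b.toNat ∧ Pure n m σ.mem j b) ∨
      (υ.mem (nodeAddr n m j + 3) = s + 1 ∧ ∀ b, ¬ Pure n m σ.mem j b)) ∧
      (∀ a, a ≠ nodeAddr n m j → a ≠ nodeAddr n m j + 3 → υ.mem a = σ.mem a) ∧
      υ.time ≤ τ.time + 25 by
    refine h.mono ?_
    rintro υ - ⟨hleaf, hmem, ht'⟩
    have hoff : SameOff n m j σ.mem υ.mem := fun a ha => hmem a (by omega) (by omega)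
    refine ⟨?_, hoff, by omega⟩
    simpa only [LeafAt, treeSize, hoff.sameMarks.pure_iff] using hleaf
  simp only [run_seq, run_cond, run_store, run_skip, Expr.eval, Expr.cost, State.tick_reg,
    State.tick_mem, State.setMem_reg, State.setMem_mem, State.tick_time, State.setMem_time, haddr',
    hs', hmem]
  refine ⟨fun h => ⟨fun h' => ⟨Or.inr ⟨by simp, fun b hb => ?_⟩, fun a ha ha' => ?_, by omega⟩,
    fun h' => ⟨Or.inl ⟨by simp, false, ?_, hone.1 h'⟩, fun a ha ha' => ?_, by omega⟩⟩,
    fun h => ⟨Or.inl ⟨by simp, true, ?_, hzero.1 h⟩, fun a ha ha' => ?_, by omega⟩⟩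
  · cases b
    · exact h' (hone.2 hb)
    · exact h (hzero.2 hb)
  · simp [ha, ha']
  · simp [Nat.one_le_iff_ne_zero.2 h]
  · simp [ha, ha']
  · simp [h]
  · simp [ha, ha']

theorem run_leaves {J : ℕ} (σ : State) (hdim : σ.reg dim = n) (hs : σ.reg maxSize = s)
    (hm : σ.reg numSamples = m) (hbase : σ.reg base = sampleAddr n m)
    (hlen : σ.reg recLen = m + 4) (hchild : σ.reg child = nodeAddr n m J)
    (hlabel : ∀ t < m, σ.mem (sampleAddr n t + n) ≤ 1) :
    Run f ω leaves σ fun τ => (∀ j < J, LeafAt n m s τ.mem j) ∧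
      SameMarks n m σ.mem τ.mem ∧ τ.time ≤ σ.time + J * (m * 40 + 60) + 10 := by
  rw [leaves, run_seq, run_set]
  refine run_loop (fun k τ => k ≤ J ∧ τ.reg leafAddr = nodeAddr n m k ∧
    (∀ j < k, LeafAt n m s τ.mem j) ∧ SameMarks n m σ.mem τ.mem ∧
    τ.time ≤ σ.time + k * (m * 40 + 60) + 2) J ?_ ?_ ?_
  · exact ⟨Nat.zero_le J, by simp [hbase, nodeAddr], fun _ h => absurd h (Nat.not_lt_zero _),
      .refl n m _, by simp⟩
  · rintro k τ F ⟨-, haddr, hleaf, hmarks, ht⟩ he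
    have hchild' : τ.reg child = nodeAddr n m J := (F.reg rfl).trans hchild
    have hlen' : τ.reg recLen = m + 4 := (F.reg rfl).trans hlen
    have hkJ : k < J := by
      by_contra! hJk
      exact he (by simp [hchild', haddr, Nat.sub_eq_zero_of_le (nodeAddr_mono hJk)])
    refine ⟨hkJ, Run.seq (run_leaf _ ((F.reg rfl).trans hdim) ((F.reg rfl).trans hs)
      ((F.reg rfl).trans hm) haddr fun t ht => ?_) ?_⟩
    · exact (hmarks.sample _ (sampleAddr_add_lt ht le_rfl)).trans_le (hlabel t ht)
    rintro υ F' ⟨hleaf', hoff, ht'⟩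
    have haddr' : υ.reg leafAddr = nodeAddr n m k := (F'.reg rfl).trans haddr
    have hlen'' : υ.reg recLen = m + 4 := (F'.reg rfl).trans hlen'
    refine run_set.2 ⟨hkJ, ?_, fun j hj => ?_, hmarks.trans hoff.sameMarks, ?_⟩
    · simp [haddr', hlen'', nodeAddr_add]
    · obtain rfl | hj := Nat.eq_or_lt_of_le (Nat.lt_succ_iff.1 hj)
      · exact hleaf'
      · exact (hleaf j hj).congr hoff hj.ne
    · simp only [State.tick_time, State.setReg_time, Expr.cost, add_one_mul] at ht' ⊢
      omega
  · rintro k τ F ⟨hkJ, haddr, hleaf, hmarks, ht⟩ he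
    have hchild' : τ.reg child = nodeAddr n m J := (F.reg rfl).trans hchild
    obtain rfl : k = J := by
      by_contra hne
      have := nodeAddr_add_le (n := n) (m := m) (lt_of_le_of_ne hkJ hne)
      simp only [Expr.eval, hchild', haddr] at he
      omega
    exact ⟨hleaf, hmarks, by simp only [State.tick_time, Expr.cost]; omega⟩

end

section

/-- Make a tree at the record address in register `parent`, with the variable in position `var` of
the list at the root and the trees of the record in register `child` and the next one as children.
-/
def join : Prog :=
  .store (reg parent) (add (load (add (add (reg dim) (reg dim)) (reg var))) (lit 2)) ;;
  .store (add (reg parent) (lit 1)) (reg child) ;;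
  .store (add (reg parent) (lit 2)) (add (reg child) (reg recLen)) ;;
  .store (add (reg parent) (lit 3)) (reg size)

/-- Register `child` holds the address after the record of the second child for the variable in
position `var` of the list. Move it back to the first child, and if the trees at the two children
are smaller than the tree at the record address in register `parent` then join them there. -/
def tryVar : Prog :=
  .set child (sub (reg child) (add (reg recLen) (reg recLen))) ;;
  .set size (add (load (add (reg child) (lit 3)))
    (load (add (add (reg child) (reg recLen)) (lit 3)))) ;;
  .cond (sub (load (add (reg parent) (lit 3))) (reg size)) join .skip

/-- Try all variables at one node. -/
def improve : Prog :=
  .set var (reg numVars) ;; .loop (reg var) (.set var (sub (reg var) (lit 1)) ;; tryVar)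

/-- Go to the previous node, and choose the tree there. -/
def choosePrevious : Prog := .set parent (sub (reg parent) (reg recLen)) ;; improve

/-- Choose the trees at all nodes before the one with record address in register `parent`, from the
last one to the root, which is the output. -/
def choosing : Prog :=
  .loop (sub (reg parent) (reg base)) choosePrevious ;; .set dim (reg base)

/-- The record of the node `j` holds a tree whose root is labeled with the variable in position `v`
of the list and has the trees of the nodes `i` and `i + 1` as its children. -/
def ChoiceAt (n m : ℕ) (mem : ℕ → ℕ) (j i v : ℕ) : Prop :=
  mem (nodeAddr n m j) = mem (2 * n + v) + 2 ∧ mem (nodeAddr n m j + 1) = nodeAddr n m i ∧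
    mem (nodeAddr n m j + 2) = nodeAddr n m (i + 1) ∧
    treeSize n m mem j = treeSize n m mem i + treeSize n m mem (i + 1)

/-- The record of the node `j` holds the smallest tree among a leaf and the trees that query one of
the variables in the positions `k ≤ v < r` of the list first. -/
structure BestAt (n m s r : ℕ) (mem : ℕ → ℕ) (k j : ℕ) : Prop where
  attained : LeafAt n m s mem j ∨
    ∃ v, k ≤ v ∧ v < r ∧ ChoiceAt n m mem j (2 * r * j + 1 + 2 * v) v
  le_one : ∀ b, Pure n m mem j b → treeSize n m mem j ≤ 1
  le_add : ∀ v, k ≤ v → v < r → treeSize n m mem j ≤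
    treeSize n m mem (2 * r * j + 1 + 2 * v) + treeSize n m mem (2 * r * j + 1 + 2 * v + 1)

variable {m s r k i j v : ℕ} {mem mem' mem'' : ℕ → ℕ}

theorem lt_child (hv : v < r) : j < 2 * r * j + 1 + 2 * v := by
  have : 1 * j ≤ 2 * r * j := Nat.mul_le_mul_right _ (by omega)
  omega

theorem LeafAt.bestAt (h : LeafAt n m s mem j) : BestAt n m s r mem r j := by
  refine ⟨Or.inl h, fun b hb => ?_, fun v hv hv' => absurd hv' hv.not_gt⟩
  rcases h with ⟨h, -⟩ | ⟨-, h⟩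
  · exact h.le
  · exact absurd hb (h b)

theorem SameOff.trans (h : SameOff n m i mem mem') (h' : SameOff n m i mem' mem'') :
    SameOff n m i mem mem'' :=
  fun a ha => (h' a ha).trans (h a ha)

theorem SameMarks.position (h : SameMarks n m mem mem') (hv : v < n) :
    mem' (2 * n + v) = mem (2 * n + v) :=
  h.sample _ (lt_of_lt_of_le (by omega) (Nat.le_add_right (3 * n) _))

theorem ChoiceAt.congr (hj : ChoiceAt n m mem j i v) {l : ℕ} (h : SameOff n m l mem mem')
    (hlj : l < j) (hji : j < i) (hv : v < n) : ChoiceAt n m mem' j i v := by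
  have h₀ : mem' (nodeAddr n m j) = mem (nodeAddr n m j) := h.header hlj.ne' (t := 0) (by omega)
  simpa only [ChoiceAt, h₀, h.sameMarks.position hv, h.header hlj.ne' (t := 1) (by omega),
    h.header hlj.ne' (t := 2) (by omega), h.treeSize_eq hlj.ne',
    h.treeSize_eq (show i ≠ l by omega), h.treeSize_eq (show i + 1 ≠ l by omega)] using hj

theorem BestAt.congr (hj : BestAt n m s r mem k j) (h : SameOff n m i mem mem') (hij : i < j)
    (hrn : r ≤ n) : BestAt n m s r mem' k j := by
  refine ⟨hj.attained.imp (fun hl => hl.congr h hij.ne') ?_, fun b hb => ?_, fun v hv hvr => ?_⟩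
  · rintro ⟨v, hv, hvr, hc⟩
    exact ⟨v, hv, hvr, hc.congr h hij (lt_child hvr) (hvr.trans_le hrn)⟩
  · rw [h.treeSize_eq hij.ne']
    exact hj.le_one b (h.sameMarks.pure_iff.1 hb)
  · have := lt_child (j := j) hvr
    rw [h.treeSize_eq hij.ne', h.treeSize_eq (by omega), h.treeSize_eq (by omega)]
    exact hj.le_add v hv hvr

theorem SplitBelow.congr {I : ℕ} (hI : SplitBelow n m r mem I) (h : SameMarks n m mem mem')
    (hrn : r ≤ n) (hV : ∀ v < r, mem (2 * n + v) < n) : SplitBelow n m r mem' I := by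
  intro j hj v hv t ht
  have hsucc : nodeAddr n m (2 * r * j + 1 + 2 * v) + (m + 4) =
      nodeAddr n m (2 * r * j + 1 + 2 * v + 1) := by
    rw [nodeAddr_add _ 1, one_mul]
  have hs := hI j hj v hv t ht
  rw [hsucc] at hs ⊢
  rwa [h.position (hv.trans_le hrn), h.sample _ (sampleAddr_add_lt ht (hV v hv).le), h.mark _ t ht,
    h.mark _ t ht, h.mark _ t ht]

theorem BestAt.join (hj : BestAt n m s r mem (k + 1) j) (h : SameOff n m j mem mem') (hk : k < r)
    (hc : ChoiceAt n m mem' j (2 * r * j + 1 + 2 * k) k)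
    (hlt : treeSize n m mem' j < treeSize n m mem j) : BestAt n m s r mem' k j := by
  refine ⟨Or.inr ⟨k, le_rfl, hk, hc⟩, fun b hb => ?_, fun v hv hvr => ?_⟩
  · exact hlt.le.trans (hj.le_one b (h.sameMarks.pure_iff.1 hb))
  · obtain rfl | hv := Nat.eq_or_lt_of_le hv
    · exact hc.2.2.2.le
    · have := lt_child (j := j) hvr
      rw [h.treeSize_eq (show 2 * r * j + 1 + 2 * v ≠ j by omega),
        h.treeSize_eq (show 2 * r * j + 1 + 2 * v + 1 ≠ j by omega)]
      exact hlt.le.trans (hj.le_add v hv hvr)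

theorem BestAt.keep (hj : BestAt n m s r mem (k + 1) j)
    (hle : treeSize n m mem j ≤ treeSize n m mem (2 * r * j + 1 + 2 * k) +
      treeSize n m mem (2 * r * j + 1 + 2 * k + 1)) : BestAt n m s r mem k j := by
  refine ⟨hj.attained.imp_right ?_, hj.le_one, fun v hv hvr => ?_⟩
  · rintro ⟨v, hv, hc⟩
    exact ⟨v, by omega, hc⟩
  · obtain rfl | hv := Nat.eq_or_lt_of_le hv
    · exact hle
    · exact hj.le_add v hv hvr

theorem nodeAddr_succ (j : ℕ) : nodeAddr n m (j + 1) = nodeAddr n m j + (m + 4) := by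
  rw [nodeAddr_add, one_mul]

theorem run_join (σ : State) (hdim : σ.reg dim = n) (hlen : σ.reg recLen = m + 4)
    (hparent : σ.reg parent = nodeAddr n m j) (hchild : σ.reg child = nodeAddr n m i)
    (hvar : σ.reg var = v) (hsize : σ.reg size = treeSize n m σ.mem i + treeSize n m σ.mem (i + 1))
    (hji : j < i) (hv : v < n) :
    Run f ω join σ fun τ => ChoiceAt n m τ.mem j i v ∧ SameOff n m j σ.mem τ.mem ∧
      treeSize n m τ.mem j = σ.reg size ∧ τ.time ≤ σ.time + 30 := by
  suffices h : Run f ω join σ fun τ =>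
      (τ.mem (nodeAddr n m j) = σ.mem (n + n + v) + 2 ∧
        τ.mem (nodeAddr n m j + 1) = nodeAddr n m i ∧
        τ.mem (nodeAddr n m j + 2) = nodeAddr n m (i + 1) ∧ treeSize n m τ.mem j = σ.reg size) ∧
      SameOff n m j σ.mem τ.mem ∧ τ.time ≤ σ.time + 30 by
    refine h.mono ?_
    rintro τ - ⟨⟨hroot, hfst, hsnd, hsum⟩, hoff, ht⟩
    refine ⟨⟨?_, hfst, hsnd, ?_⟩, hoff, hsum, ht⟩
    · rw [hoff.sameMarks.position hv, hroot, two_mul]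
    · rw [hsum, hsize, hoff.treeSize_eq hji.ne', hoff.treeSize_eq (by omega)]
  have : n + n + v < nodeAddr n m j :=
    lt_of_lt_of_le (by omega) ((Nat.le_add_right (3 * n) _).trans (Nat.le_add_right _ _))
  simp only [join, run_seq, run_store, Expr.eval, Expr.cost, State.tick_reg, State.tick_mem,
    State.tick_time, State.setMem_reg, State.setMem_mem, State.setMem_time, hdim, hlen, hparent,
    hchild, hvar, ← nodeAddr_succ]
  refine ⟨by simp [treeSize], fun a ha => ?_, by omega⟩
  simp only [State.tick_mem, State.setMem_mem]
  rw [if_neg (by omega), if_neg (by omega), if_neg (by omega), if_neg (by omega)]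

theorem run_tryVar (σ : State) (hdim : σ.reg dim = n) (hlen : σ.reg recLen = m + 4)
    (hparent : σ.reg parent = nodeAddr n m j)
    (hchild : σ.reg child = nodeAddr n m (2 * r * j + 1 + 2 * (v + 1))) (hvar : σ.reg var = v)
    (hv : v < r) (hrn : r ≤ n) (hbest : BestAt n m s r σ.mem (v + 1) j) :
    Run f ω tryVar σ fun τ => BestAt n m s r τ.mem v j ∧
      τ.reg child = nodeAddr n m (2 * r * j + 1 + 2 * v) ∧ SameOff n m j σ.mem τ.mem ∧
      τ.time ≤ σ.time + 70 := by
  have hsub : nodeAddr n m (2 * r * j + 1 + 2 * (v + 1)) - (m + 4 + (m + 4)) =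
      nodeAddr n m (2 * r * j + 1 + 2 * v) := by
    rw [mul_add_one, ← add_assoc, nodeAddr_add _ 2]
    omega
  simp only [tryVar, run_seq, run_set, run_cond, run_skip]
  set τ : State := State.tick _ _ with hτ
  have hchild' : τ.reg child = nodeAddr n m (2 * r * j + 1 + 2 * v) := by
    simp [hτ, hchild, hlen, hsub]
  have hsize : τ.reg size = treeSize n m σ.mem (2 * r * j + 1 + 2 * v) +
      treeSize n m σ.mem (2 * r * j + 1 + 2 * v + 1) := by
    simp [hτ, hchild, hlen, hsub, treeSize, nodeAddr_succ]
  have hparent' : τ.reg parent = nodeAddr n m j := hparent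
  have htime : τ.time ≤ σ.time + 25 := by
    simp only [hτ, State.tick_time, State.setReg_time, Expr.cost]
    omega
  have hji := lt_child (j := j) hv
  refine ⟨fun hlt => ?_, fun hge => ⟨hbest.keep ?_, hchild', fun _ _ => rfl, ?_⟩⟩
  · simp only [Expr.eval, hparent', hsize] at hlt
    refine Run.mono (run_join _ (by exact hdim) (by exact hlen) (by exact hparent')
      (by exact hchild') (by exact hvar) (by exact hsize) hji (hv.trans_le hrn)) ?_
    rintro υ F ⟨hc, hoff, hsize', ht⟩
    refine ⟨hbest.join hoff hv hc ?_, (F.reg rfl).trans hchild', hoff, ?_⟩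
    · rw [hsize']
      exact lt_of_eq_of_lt hsize (Nat.lt_of_sub_ne_zero hlt)
    · simp only [State.tick_time, Expr.cost] at ht
      omega
  · simp only [Expr.eval, hparent', hsize] at hge
    exact Nat.le_of_sub_eq_zero hge
  · simp only [State.tick_time, Expr.cost]
    omega

theorem run_improve (σ : State) (hdim : σ.reg dim = n) (hr : σ.reg numVars = r)
    (hlen : σ.reg recLen = m + 4) (hparent : σ.reg parent = nodeAddr n m j)
    (hchild : σ.reg child = nodeAddr n m (2 * r * (j + 1) + 1)) (hrn : r ≤ n)
    (hleaf : LeafAt n m s σ.mem j) :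
    Run f ω improve σ fun τ => BestAt n m s r τ.mem 0 j ∧
      τ.reg child = nodeAddr n m (2 * r * j + 1) ∧ SameOff n m j σ.mem τ.mem ∧
      τ.time ≤ σ.time + r * 80 + 10 := by
  rw [improve, run_seq, run_set]
  refine run_loop (fun k τ => k ≤ r ∧ τ.reg var = r - k ∧
    τ.reg child = nodeAddr n m (2 * r * j + 1 + 2 * (r - k)) ∧ BestAt n m s r τ.mem (r - k) j ∧
    SameOff n m j σ.mem τ.mem ∧ τ.time ≤ σ.time + k * 80 + 4) r ?_ ?_ ?_
  · refine ⟨Nat.zero_le r, by simp [hr], ?_, hleaf.bestAt, fun _ _ => rfl, by simp⟩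
    simp only [State.tick_reg, State.setReg_reg]
    rw [if_neg (by decide), hchild, Nat.sub_zero]
    ring_nf
  · rintro k τ F ⟨-, hvar, hchild', hbest, hoff, ht⟩ he
    simp only [Expr.eval, hvar] at he
    have hk : k < r := by omega
    obtain ⟨v, hv⟩ : ∃ v, r - k = v + 1 := ⟨r - k - 1, by omega⟩
    rw [hv] at hvar hchild' hbest
    rw [run_seq, run_set, show r - (k + 1) = v by omega]
    refine ⟨hk, Run.mono (run_tryVar _ (by exact (F.reg (x := dim) rfl).trans hdim)
      (by exact (F.reg (x := recLen) rfl).trans hlen)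
      (by exact (F.reg (x := parent) rfl).trans hparent) (by exact hchild') (by simp [hvar])
      (by omega) hrn hbest) ?_⟩
    rintro υ F' ⟨hbest', hchild'', hoff', ht'⟩
    refine ⟨hk, (F'.reg rfl).trans (by simp [hvar]), hchild'', hbest', hoff.trans hoff', ?_⟩
    simp only [State.tick_time, State.setReg_time, Expr.cost] at ht'
    omega
  · rintro k τ - ⟨hk, hvar, hchild', hbest, hoff, ht⟩ he
    simp only [Expr.eval, hvar] at he
    rw [he] at hchild' hbest
    have : k * 80 ≤ r * 80 := Nat.mul_le_mul_right _ hk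
    exact ⟨hbest, hchild', hoff, by simp only [State.tick_time, Expr.cost]; omega⟩

/-- Trees have been chosen at the nodes `k ≤ j < I`, the other nodes still hold leaves, and the
registers point behind the node to be treated next. -/
structure Chosen (n m s r I k : ℕ) (σ : State) : Prop where
  parent : σ.reg parent = nodeAddr n m k
  child : σ.reg child = nodeAddr n m (2 * r * k + 1)
  best : ∀ j < I, k ≤ j → BestAt n m s r σ.mem 0 j
  leaf : ∀ j < 2 * r * I + 1, j < k ∨ I ≤ j → LeafAt n m s σ.mem j

theorem run_choosePrevious {I : ℕ} (σ : State) (hdim : σ.reg dim = n) (hr : σ.reg numVars = r)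
    (hlen : σ.reg recLen = m + 4) (h : Chosen n m s r I (j + 1) σ) (hrn : r ≤ n) (hj : j < I)
    (hI : I ≤ 2 * r * I + 1) :
    Run f ω choosePrevious σ fun τ => Chosen n m s r I j τ ∧ SameMarks n m σ.mem τ.mem ∧
      τ.time ≤ σ.time + (20 + r * 80) := by
  rw [choosePrevious, run_seq, run_set]
  refine Run.mono (run_improve _ (by exact hdim) (by exact hr) (by exact hlen)
    (by simp [h.parent, hlen, nodeAddr_succ]) (by exact h.child) hrn
    (h.leaf j (by omega) (by omega))) ?_
  rintro τ F ⟨hbest, hchild, hoff, ht⟩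
  refine ⟨⟨(F.reg rfl).trans (by simp [h.parent, hlen, nodeAddr_succ]), hchild,
    fun i hi hji => ?_, fun i hi hij => ?_⟩, hoff.sameMarks, ?_⟩
  · obtain rfl | hji := Nat.eq_or_lt_of_le hji
    · exact hbest
    · exact (h.best i hi hji).congr hoff hji hrn
  · exact (h.leaf i hi (by omega)).congr hoff (by omega)
  · simp only [State.tick_time, State.setReg_time, Expr.cost] at ht
    omega

theorem run_choosing {I : ℕ} (σ : State) (hdim : σ.reg dim = n)
    (hbase : σ.reg base = sampleAddr n m) (hr : σ.reg numVars = r) (hlen : σ.reg recLen = m + 4)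
    (hparent : σ.reg parent = nodeAddr n m I)
    (hchild : σ.reg child = nodeAddr n m (2 * r * I + 1)) (hrn : r ≤ n) (hI : I ≤ 2 * r * I + 1)
    (hleaf : ∀ j < 2 * r * I + 1, LeafAt n m s σ.mem j) :
    Run f ω choosing σ fun τ => (∀ j < I, BestAt n m s r τ.mem 0 j) ∧
      (∀ j < 2 * r * I + 1, I ≤ j → LeafAt n m s τ.mem j) ∧ τ.reg dim = sampleAddr n m ∧
      SameMarks n m σ.mem τ.mem ∧ τ.time ≤ σ.time + I * (30 + r * 80) + 10 := by
  have hroot {k : ℕ} : nodeAddr n m k ≤ nodeAddr n m 0 ↔ k = 0 := by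
    refine ⟨fun hk => ?_, fun hk => hk ▸ le_rfl⟩
    by_contra hne
    have := nodeAddr_add_le (n := n) (m := m) (Nat.pos_of_ne_zero hne)
    omega
  have hbase₀ : σ.reg base = nodeAddr n m 0 := hbase.trans (by simp [nodeAddr])
  rw [choosing, run_seq]
  refine run_loop (fun k τ => k ≤ I ∧ Chosen n m s r I (I - k) τ ∧ SameMarks n m σ.mem τ.mem ∧
    τ.time ≤ σ.time + k * (30 + r * 80)) I ?_ ?_ ?_
  · exact ⟨Nat.zero_le I, ⟨hparent, hchild, fun j hj hj' => absurd hj hj'.not_gt,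
      fun j hj _ => hleaf j hj⟩, .refl n m _, by simp⟩
  · rintro k τ F ⟨-, hτ, hmarks, ht⟩ he
    simp only [Expr.eval, (F.reg rfl).trans hbase₀, hτ.parent, ne_eq, Nat.sub_eq_zero_iff_le,
      hroot] at he
    have hk : k < I := by omega
    obtain ⟨j, hj⟩ := Nat.exists_eq_succ_of_ne_zero (Nat.sub_ne_zero_of_lt hk)
    rw [hj] at hτ
    refine ⟨hk, Run.mono (run_choosePrevious (τ.tick _) ((F.reg rfl).trans hdim)
      ((F.reg rfl).trans hr) ((F.reg rfl).trans hlen) ⟨hτ.parent, hτ.child, hτ.best, hτ.leaf⟩ hrn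
      (by omega) hI) ?_⟩
    rintro υ - ⟨hυ, hmarks', ht'⟩
    refine ⟨hk, (show I - (k + 1) = j by omega) ▸ hυ, hmarks.trans hmarks', ?_⟩
    simp only [State.tick_time, Expr.cost, add_one_mul] at ht' ⊢
    omega
  · rintro k τ F ⟨hk, hτ, hmarks, ht⟩ he
    simp only [Expr.eval, (F.reg rfl).trans hbase₀, hτ.parent, Nat.sub_eq_zero_iff_le, hroot] at he
    obtain rfl : k = I := by omega
    refine run_set.2 ⟨fun j hj => hτ.best j hj (by omega),
      fun j hj hj' => hτ.leaf j hj (Or.inr hj'), (F.reg rfl).trans hbase, hmarks, ?_⟩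
    simp only [State.tick_time, State.setReg_time, Expr.cost]
    omega

end

/-! ### Correctness of the search for a tree -/

section

/-- The variables that label the nodes of a tree. -/
def DTree.vars : DTree n → Finset (Fin n)
  | leaf _ => ∅
  | node i l r => insert i (l.vars ∪ r.vars)

/-- What the memory holds when the search among the trees with variables in `R` has ended; the
node `j` has level `l` if `internal R.card l ≤ j < internal R.card (l + 1)`. -/
structure Solved (f : Cube n → Bool) (X : ℕ → Cube n) (d s m : ℕ) (R : Finset (Fin n))
    (mem : ℕ → ℕ) : Prop where
  list : (Finset.range R.card).image (fun v => mem (2 * n + v)) = R.image (↑)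
  sample : ∀ t < m, SampleAt f mem (sampleAddr n t) (X t)
  root : ∀ t < m, mem (nodeAddr n m 0 + 4 + t) = 1
  split : SplitBelow n m R.card mem (internal R.card d)
  best : ∀ j < internal R.card d, BestAt n m s R.card mem 0 j
  leaf : ∀ j < internal R.card (d + 1), internal R.card d ≤ j → LeafAt n m s mem j

/-- The samples that reach the node `j` are those that satisfy `P`. -/
def MarksAt (X : ℕ → Cube n) (m : ℕ) (mem : ℕ → ℕ) (j : ℕ) (P : Cube n → Bool) : Prop :=
  ∀ t < m, mem (nodeAddr n m j + 4 + t) = (P (X t)).toNat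

/-- The tree `T` computes `f` on the first `m` samples, as far as they satisfy `P`. -/
def Fits (f : Cube n → Bool) (X : ℕ → Cube n) (m : ℕ) (P : Cube n → Bool) (T : DTree n) : Prop :=
  ∀ t < m, P (X t) → T.eval (X t) = f (X t)

theorem internal_mono (r : ℕ) : Monotone (internal r) := by
  refine monotone_nat_of_le_succ fun k => ?_
  induction k with
  | zero => exact Nat.zero_le _
  | succ k ih =>
    simp only [internal] at ih ⊢
    gcongr

theorem child_mem_Ico {r l j v : ℕ} (hj : j ∈ Set.Ico (internal r l) (internal r (l + 1)))
    (hv : v < r) {i : ℕ} (hi : i < 2) :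
    2 * r * j + 1 + 2 * v + i ∈ Set.Ico (internal r (l + 1)) (internal r (l + 2)) := by
  have hlow : 2 * r * internal r l ≤ 2 * r * j := Nat.mul_le_mul_left _ hj.1
  have hhigh : 2 * r * (j + 1) ≤ 2 * r * internal r (l + 1) := Nat.mul_le_mul_left _ hj.2
  have hint (k : ℕ) : internal r (k + 1) = 2 * r * internal r k + 1 := by
    rw [internal]
    ring
  rw [mul_add_one] at hhigh
  rw [Set.mem_Ico, hint l, hint (l + 1)]
  omega

variable {f : Cube n → Bool} {X : ℕ → Cube n} {d s m : ℕ} {R : Finset (Fin n)} {mem : ℕ → ℕ}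
  {j : ℕ} {P : Cube n → Bool}

theorem fits_node {i : Fin n} {T₀ T₁ : DTree n} :
    Fits f X m P (.node i T₀ T₁) ↔
      Fits f X m (fun x => P x && !x i) T₀ ∧ Fits f X m (fun x => P x && x i) T₁ := by
  simp only [Fits, DTree.eval, ← forall_and]
  refine forall₂_congr fun t _ => ?_
  cases P (X t) <;> cases X t i <;> simp

theorem exists_mem_eq_of_image_eq
    (h : (Finset.range R.card).image (fun v => mem (2 * n + v)) = R.image (↑)) {v : ℕ}
    (hv : v < R.card) : ∃ i ∈ R, mem (2 * n + v) = i := by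
  obtain ⟨i, hi, hiv⟩ := Finset.mem_image.1
    (h ▸ Finset.mem_image_of_mem (fun v => mem (2 * n + v)) (Finset.mem_range.2 hv))
  exact ⟨i, hi, hiv.symm⟩

namespace Solved

theorem exists_position (h : Solved f X d s m R mem) {i : Fin n} (hi : i ∈ R) :
    ∃ v < R.card, mem (2 * n + v) = i := by
  obtain ⟨v, hv, hvi⟩ := Finset.mem_image.1
    (h.list ▸ Finset.mem_image_of_mem ((↑) : Fin n → ℕ) hi)
  exact ⟨v, Finset.mem_range.1 hv, hvi⟩

theorem marksAt_child (h : Solved f X d s m R mem) (hj : j < internal R.card d) {v : ℕ}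
    (hv : v < R.card) {i : Fin n} (hi : mem (2 * n + v) = i) (hP : MarksAt X m mem j P) :
    MarksAt X m mem (2 * R.card * j + 1 + 2 * v) (fun x => P x && !x i) ∧
      MarksAt X m mem (2 * R.card * j + 1 + 2 * v + 1) (fun x => P x && x i) := by
  refine forall₂_and.1 fun t ht => ?_
  obtain ⟨h₀, h₁⟩ := h.split j hj v hv t ht
  rw [nodeAddr_succ, h₀, h₁, hP t ht, hi, (h.sample t ht).1 i]
  beta_reduce
  cases P (X t) <;> cases X t i <;> exact ⟨rfl, rfl⟩

theorem pure_iff (h : Solved f X d s m R mem) (hP : MarksAt X m mem j P) {b : Bool} :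
    Pure n m mem j b ↔ Fits f X m P (.leaf b) := by
  refine forall₂_congr fun t ht => ?_
  rw [hP t ht, (h.sample t ht).2]
  cases P (X t) <;> cases f (X t) <;> cases b <;> simp [DTree.eval]

theorem exists_leaf (h : Solved f X d s m R mem) (hP : MarksAt X m mem j P)
    (hj : LeafAt n m s mem j) (hs : treeSize n m mem j ≤ s) (k : ℕ) :
    ∃ T : DTree n, T.depth ≤ k ∧ T.size = treeSize n m mem j ∧ T.vars ⊆ R ∧
      T.StoredAt mem (nodeAddr n m j) ∧ Fits f X m P T := by
  rcases hj with ⟨hsize, b, hb, hpure⟩ | ⟨hsize, -⟩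
  · exact ⟨.leaf b, Nat.zero_le k, hsize.symm, Finset.empty_subset R, hb, (h.pure_iff hP).1 hpure⟩
  · omega

theorem exists_storedAt (h : Solved f X d s m R mem) (k : ℕ) : ∀ {l j P}, l + k = d →
    j ∈ Set.Ico (internal R.card l) (internal R.card (l + 1)) → MarksAt X m mem j P →
    treeSize n m mem j ≤ s →
    ∃ T : DTree n, T.depth ≤ k ∧ T.size = treeSize n m mem j ∧ T.vars ⊆ R ∧
      T.StoredAt mem (nodeAddr n m j) ∧ Fits f X m P T := by
  induction k with
  | zero =>
    rintro l j P rfl hj hP hs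
    exact h.exists_leaf hP (h.leaf j hj.2 hj.1) hs 0
  | succ k ih =>
    rintro l j P rfl hj hP hs
    have hj' : j < internal R.card (l + (k + 1)) := hj.2.trans_le (internal_mono _ (by omega))
    obtain hleaf | ⟨v, -, hv, hroot, hfst, hsnd, hsize⟩ := (h.best j hj').attained
    · exact h.exists_leaf hP hleaf hs _
    obtain ⟨i, hiR, hi⟩ := exists_mem_eq_of_image_eq h.list hv
    obtain ⟨hP₀, hP₁⟩ := h.marksAt_child hj' hv hi hP
    obtain ⟨T₀, hd₀, hs₀, hR₀, hm₀, hf₀⟩ := ih (j := 2 * R.card * j + 1 + 2 * v) (by omega)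
      (child_mem_Ico hj hv (i := 0) (by omega)) hP₀ (by omega)
    obtain ⟨T₁, hd₁, hs₁, hR₁, hm₁, hf₁⟩ := ih (by omega)
      (child_mem_Ico hj hv (i := 1) (by omega)) hP₁ (by omega)
    exact ⟨.node i T₀ T₁, Nat.succ_le_succ (max_le hd₀ hd₁),
      by rw [DTree.size, hs₀, hs₁, hsize],
      Finset.insert_subset hiR (Finset.union_subset hR₀ hR₁),
      ⟨by rw [hroot, hi], by rwa [hfst], by rwa [hsnd]⟩, fits_node.2 ⟨hf₀, hf₁⟩⟩

theorem treeSize_le (h : Solved f X d s m R mem) (T : DTree n) : ∀ {k l j P}, l + k = d →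
    j ∈ Set.Ico (internal R.card l) (internal R.card (l + 1)) → MarksAt X m mem j P →
    T.depth ≤ k → T.vars ⊆ R → Fits f X m P T → treeSize n m mem j ≤ T.size := by
  induction T with
  | leaf b =>
    rintro k l j P rfl hj hP - - hfit
    have hpure := (h.pure_iff hP).2 hfit
    rcases Nat.lt_or_ge j (internal R.card (l + k)) with hlt | hge
    · exact (h.best j hlt).le_one b hpure
    · exact ((h.leaf j (hj.2.trans_le (internal_mono _ (by omega))) hge).bestAt
        (r := R.card)).le_one b hpure
  | node i T₀ T₁ ih₀ ih₁ =>
    rintro k l j P rfl hj hP hd hR hfit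
    simp only [DTree.depth, DTree.vars, Finset.insert_subset_iff, Finset.union_subset_iff] at hd hR
    have hj' : j < internal R.card (l + k) := hj.2.trans_le (internal_mono _ (by omega))
    obtain ⟨v, hv, hi⟩ := h.exists_position hR.1
    obtain ⟨hP₀, hP₁⟩ := h.marksAt_child hj' hv hi hP
    obtain ⟨hfit₀, hfit₁⟩ := fits_node.1 hfit
    have h₀ := ih₀ (k := k - 1) (by omega) (child_mem_Ico hj hv (i := 0) (by omega)) hP₀ (by omega)
      hR.2.1 hfit₀
    have h₁ := ih₁ (k := k - 1) (by omega) (child_mem_Ico hj hv (i := 1) (by omega)) hP₁ (by omega)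
      hR.2.2 hfit₁
    exact ((h.best j hj').le_add v (Nat.zero_le v) hv).trans (Nat.add_le_add h₀ h₁)

theorem exists_tree (h : Solved f X d s m R mem) {T : DTree n} (hd : T.depth ≤ d)
    (hs : T.size ≤ s) (hR : T.vars ⊆ R) (hT : ∀ t < m, T.eval (X t) = f (X t)) :
    ∃ T' : DTree n, T'.depth ≤ d ∧ T'.size ≤ s ∧ T'.vars ⊆ R ∧
      T'.StoredAt mem (sampleAddr n m) ∧ ∀ t < m, T'.eval (X t) = f (X t) := by
  have hroot : MarksAt X m mem 0 fun _ => true := h.root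
  have hlevel : 0 ∈ Set.Ico (internal R.card 0) (internal R.card 1) := by simp [internal]
  have hle := h.treeSize_le T (zero_add d) hlevel hroot hd hR fun t ht _ => hT t ht
  obtain ⟨T', hd', hs', hR', hmem, hfit⟩ :=
    h.exists_storedAt d (zero_add d) hlevel hroot (hle.trans hs)
  rw [nodeAddr, zero_mul] at hmem
  exact ⟨T', hd', by omega, hR', hmem, fun t ht => hfit t ht rfl⟩

end Solved

end

/-! ### The learning algorithm -/

/-- Find a smallest tree that agrees with the samples. -/
def findTree : Prog := countInternal ;; splitting ;; leaves ;; choosing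

/-- The learning algorithm. -/
def learner : Prog := setup ;; sampling ;; findTree

theorem internal_succ_le (r d : ℕ) : internal r (d + 1) ≤ (2 * r + 1) ^ d := by
  induction d with
  | zero => simp [internal]
  | succ d ih =>
    have hpos : 1 ≤ (2 * r + 1) ^ d := Nat.one_le_pow _ _ (by omega)
    calc internal r (d + 2) = 2 * r * internal r (d + 1) + 1 := by rw [internal]; ring
      _ ≤ 2 * r * (2 * r + 1) ^ d + (2 * r + 1) ^ d := by gcongr
      _ = (2 * r + 1) ^ (d + 1) := by ring

theorem findTree_time_le {d m r I : ℕ} (hd : d < m) (hI : I = internal r d) :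
    d * (20 + 20 * r) + 10 + (m * 20 + I * (40 + r * (40 + m * 60)) + 40) +
        ((2 * r * I + 1) * (m * 40 + 60) + 10) + (I * (30 + r * 80) + 10) ≤
      300 * ((2 * r + 1) ^ d * (r + 1) * m) := by
  have hJ : 2 * r * I + 1 = internal r (d + 1) := by rw [hI, internal]; ring
  have hIJ : I ≤ internal r (d + 1) := hI ▸ internal_mono r d.le_succ
  have hJpos : 1 ≤ internal r (d + 1) := hJ ▸ Nat.succ_pos _
  have hpow := internal_succ_le r d
  rw [hJ]
  generalize internal r (d + 1) = J at *
  calc _ = I * (70 + 120 * r + 60 * (r * m)) + J * (40 * m + 60) +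
        1 * (20 * (d * (r + 1)) + 20 * m + 70) := by ring
    _ ≤ J * (70 + 120 * r + 60 * (r * m)) + J * (40 * m + 60) +
        J * (20 * (m * (r + 1)) + 20 * m + 70) := by gcongr
    _ ≤ J * (200 * (r + 1)) * 1 + J * (80 * ((r + 1) * m)) := by linarith [Nat.zero_le (J * r)]
    _ ≤ J * (200 * (r + 1)) * m + J * (80 * ((r + 1) * m)) := by gcongr; omega
    _ = 280 * (J * (r + 1) * m) := by ring
    _ ≤ 300 * ((2 * r + 1) ^ d * (r + 1) * m) := by gcongr; norm_num

/-- The registers hold the parameters of the search for a tree: samples of dimension `n`, depth `d`,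
size `s`, `m` samples, and `r` variables. -/
structure Parameters (n d s m r : ℕ) (σ : State) : Prop where
  dim : σ.reg dim = n
  maxDepth : σ.reg maxDepth = d
  maxSize : σ.reg maxSize = s
  numSamples : σ.reg numSamples = m
  base : σ.reg base = sampleAddr n m
  numVars : σ.reg numVars = r

theorem Parameters.frame {d s m r : ℕ} {p : Prog} {σ τ : State} (h : Parameters n d s m r σ)
    (F : Frame p σ τ)
    (hp : ∀ x ∈ [Reg.dim, Reg.maxDepth, Reg.maxSize, Reg.numSamples, Reg.base, Reg.numVars],
      p.writes x = false) :
    Parameters n d s m r τ := by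
  simp only [List.forall_mem_cons] at hp
  obtain ⟨h₀, h₁, h₂, h₃, h₄, h₅, -⟩ := hp
  exact ⟨(F.reg h₀).trans h.dim, (F.reg h₁).trans h.maxDepth, (F.reg h₂).trans h.maxSize,
    (F.reg h₃).trans h.numSamples, (F.reg h₄).trans h.base, (F.reg h₅).trans h.numVars⟩

theorem run_findTree {X : ℕ → Cube n} {R : Finset (Fin n)} {d s m : ℕ} (σ : State)
    (hσ : Parameters n d s m R.card σ)
    (hlist : (Finset.range R.card).image (fun v => σ.mem (2 * n + v)) = R.image (↑))
    (hX : ∀ t < m, SampleAt f σ.mem (sampleAddr n t) (X t)) (hdm : d < m) :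
    Run f ω findTree σ fun τ => Solved f X d s m R τ.mem ∧ τ.reg dim = sampleAddr n m ∧
      τ.time ≤ σ.time + 300 * ((2 * R.card + 1) ^ d * (R.card + 1) * m) := by
  have hrn : R.card ≤ n := by simpa using R.card_le_univ
  have hsamples : 3 * n ≤ sampleAddr n m := Nat.le_add_right _ _
  have hV : ∀ v < R.card, σ.mem (2 * n + v) < n := fun v hv => by
    obtain ⟨i, -, hi⟩ := exists_mem_eq_of_image_eq hlist hv
    exact hi ▸ i.2
  refine (run_countInternal σ hσ.maxDepth hσ.numVars).seq ?_
  rintro τ₁ F₁ ⟨hI, ht₁⟩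
  have h₁ := hσ.frame F₁ (by decide)
  have hmem₁ : τ₁.mem = σ.mem := F₁.mem rfl
  refine (run_splitting τ₁ h₁.dim h₁.numSamples h₁.base h₁.numVars hI hrn (by rwa [hmem₁])).seq ?_
  rintro τ₂ F₂ ⟨hroot, hsplit, hparent, hchild, hlen, hmem₂, ht₂⟩
  have h₂ := h₁.frame F₂ (by decide)
  rw [hmem₁] at hmem₂
  refine (run_leaves τ₂ h₂.dim h₂.maxSize h₂.numSamples h₂.base hlen hchild fun t ht => ?_).seq ?_
  · rw [hmem₂ _ (sampleAddr_add_lt ht le_rfl), (hX t ht).2]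
    exact Bool.toNat_le _
  rintro τ₃ F₃ ⟨hleaf, hmarks₃, ht₃⟩
  have h₃ := h₂.frame F₃ (by decide)
  have hint : internal R.card (d + 1) = 2 * R.card * internal R.card d + 1 := by
    rw [internal]; ring
  refine (run_choosing τ₃ h₃.dim h₃.base h₃.numVars ((F₃.reg rfl).trans hlen)
    ((F₃.reg rfl).trans hparent) ((F₃.reg rfl).trans hchild) hrn
    (hint ▸ internal_mono _ d.le_succ) hleaf).mono ?_
  rintro τ₄ - ⟨hbest, hleaf', hdim, hmarks₄, ht₄⟩
  have hmarks := hmarks₃.trans hmarks₄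
  have hmem : ∀ a < sampleAddr n m, τ₄.mem a = σ.mem a := fun a ha =>
    (hmarks.sample a ha).trans (hmem₂ a ha)
  have htime := findTree_time_le hdm (rfl : internal R.card d = _)
  refine ⟨⟨?_, fun t ht => ?_, fun t ht => (hmarks.mark 0 t ht).trans (hroot t ht),
    hsplit.congr hmarks hrn fun v hv => ?_, hbest, hint ▸ hleaf'⟩, hdim, by omega⟩
  · exact hlist ▸ Finset.image_congr fun v hv =>
      hmem _ (by have := Finset.mem_range.1 hv; omega)
  · exact (hX t ht).congr fun i hi => hmem _ (sampleAddr_add_lt ht hi)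
  · rw [hmem₂ _ (by omega)]
    exact hV v hv

theorem run_learner {d s N m : ℕ} (hn : 0 < n) (hs : 0 < s) (hN : 0 < N)
    (hm : sampleCount d s N = m) :
    Run f ω learner (State.init n d s N) fun τ => ∃ R,
      Leads f (fun t : Fin m => drawn n ω t) ∅ R ∧ Solved f (drawn n ω) d s m R τ.mem ∧
      τ.reg dim = sampleAddr n m ∧ τ.queries ≤ 2 * m + R.card * Nat.clog 2 n ∧
      τ.time ≤ 200 * (m * n) + R.card * ((Nat.clog 2 n + 2) * (80 * n)) +
        300 * ((2 * R.card + 1) ^ d * (R.card + 1) * m) := by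
  have hbound := add_le_sampleCount (d := d) (N := N) hs
  rw [hm] at hbound
  refine (run_setup (d := d) hs hN).seq ?_
  rintro τ₁ F₁ ⟨hm₁, hbase₁, ht₁⟩
  have hmem₁ : τ₁.mem = fun _ => 0 := F₁.mem rfl
  have hR₁ : Records (∅ : Finset (Fin n)) τ₁ :=
    ⟨F₁.reg rfl, hbase₁.ge, F₁.reg rfl, by simp [hmem₁], by simp⟩
  refine (run_sampling τ₁ hR₁ (hm₁.trans hm) hbase₁ (F₁.flips rfl) hn).seq ?_
  rintro τ₂ F₂ ⟨R, hlead, hR₂, hbase₂, hX, hq₂, ht₂⟩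
  have h₂ : Parameters n d s m R.card τ₂ := ⟨hR₂.dim, (F₂.reg rfl).trans (F₁.reg rfl),
    (F₂.reg rfl).trans (F₁.reg rfl), (F₂.reg rfl).trans (hm₁.trans hm), hbase₂, hR₂.numVars⟩
  refine (run_findTree τ₂ h₂ hR₂.list hX (by omega)).mono ?_
  rintro τ₃ F₃ ⟨hsolved, hdim, ht₃⟩
  have hq₁ : τ₁.queries = 0 := F₁.queries rfl
  have hmn : m ≤ m * n := Nat.le_mul_of_pos_right m hn
  have hassoc : m * (108 * n) = 108 * (m * n) := by ring
  refine ⟨R, hlead, hsolved, hdim, ?_, by omega⟩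
  rw [F₃.queries rfl]
  omega

end

open scoped Finset

/-! ### Boolean functions of bounded degree -/

/-- The polynomial over the field with two elements that represents `g` has degree less than `d`.
The recursion splits it into a part without the first variable and a multiple of that variable. -/
def DegreeLT : {n : ℕ} → ℕ → (Cube n → Bool) → Prop
  | _, 0, g => ∀ x, g x = false
  | 0, _ + 1, _ => True
  | _ + 1, d + 1, g => DegreeLT (d + 1) (fun x => g (Fin.cons false x)) ∧
      DegreeLT d fun x => g (Fin.cons false x) ^^ g (Fin.cons true x)

section

variable {n d : ℕ} {g h : Cube n → Bool}

theorem degreeLT_zero_iff : DegreeLT 0 g ↔ ∀ x, g x = false := by cases n <;> rfl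

theorem degreeLT_false (n d : ℕ) : DegreeLT d fun _ : Cube n => false := by
  induction n generalizing d with
  | zero => cases d <;> simp [DegreeLT]
  | succ n ih =>
    cases d with
    | zero => exact fun _ => rfl
    | succ d => exact ⟨ih (d + 1), ih d⟩

theorem degreeLT_const (b : Bool) : DegreeLT (d + 1) fun _ : Cube n => b := by
  induction n with
  | zero => trivial
  | succ n ih => exact ⟨ih, by simpa only [Bool.xor_self] using degreeLT_false n d⟩

theorem DegreeLT.xor (hg : DegreeLT d g) (hh : DegreeLT d h) :
    DegreeLT d fun x => g x ^^ h x := by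
  induction n generalizing d with
  | zero =>
    cases d with
    | zero => exact fun x => by simp only [hg x, hh x, Bool.xor_self]
    | succ d => trivial
  | succ n ih =>
    cases d with
    | zero => exact fun x => by simp only [hg x, hh x, Bool.xor_self]
    | succ d =>
      refine ⟨ih hg.1 hh.1, ?_⟩
      convert ih hg.2 hh.2 using 2 with x
      simp only [Bool.xor_assoc, Bool.xor_left_comm, Bool.xor_comm]

theorem DegreeLT.succ (hg : DegreeLT d g) : DegreeLT (d + 1) g := by
  induction n generalizing d with
  | zero => trivial
  | succ n ih =>
    cases d with
    | zero =>
      rw [show g = fun _ => false from funext hg]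
      exact degreeLT_false _ _
    | succ d => exact ⟨ih hg.1, ih hg.2⟩

theorem DegreeLT.slice {g : Cube (n + 1) → Bool} (hg : DegreeLT d g) (b : Bool) :
    DegreeLT d fun x => g (Fin.cons b x) := by
  cases d with
  | zero => 
    rw [show g = fun _ => false from funext hg]
    exact degreeLT_false _ _
  | succ d =>
    cases b with
    | false => exact hg.1
    | true =>
      convert hg.1.xor hg.2.succ using 2 with x
      simp

theorem DegreeLT.coord_and (hg : DegreeLT d g) (i : Fin n) :
    DegreeLT (d + 1) fun x => x i && g x := by
  induction n generalizing d with
  | zero => exact i.elim0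
  | succ n ih =>
    cases i using Fin.cases with
    | zero =>
      simp only [DegreeLT, Fin.cons_zero, Bool.false_and, Bool.true_and, Bool.false_xor]
      exact ⟨degreeLT_false n _, hg.slice true⟩
    | succ j =>
      simp only [DegreeLT, Fin.cons_succ, ← Bool.and_xor_distrib_left]
      refine ⟨ih (hg.slice false) j, ?_⟩
      cases d with
      | zero => simpa only [hg _, Bool.xor_self, Bool.and_false] using degreeLT_false n 0
      | succ d => exact ih hg.2 j

theorem DTree.degreeLT_eval (T : DTree n) (hd : T.depth ≤ d) : DegreeLT (d + 1) T.eval := by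
  induction T generalizing d with
  | leaf b => exact degreeLT_const b
  | node i l r ihl ihr =>
    obtain ⟨d, rfl⟩ := Nat.exists_eq_add_of_lt (Nat.lt_of_lt_of_le (Nat.succ_pos _) hd)
    obtain ⟨hl, hr⟩ : l.depth ≤ 0 + d ∧ r.depth ≤ 0 + d := by simpa [DTree.depth] using hd
    convert (ihl hl).succ.xor (((ihl hl).xor (ihr hr)).coord_and i) using 2 with x
    cases h : x i <;> simp [DTree.eval, h]

theorem card_filter_cons (p : Cube (n + 1) → Prop) [DecidablePred p] :
    #{x | p x} = #{x : Cube n | p (Fin.cons false x)} + #{x : Cube n | p (Fin.cons true x)} := by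
  simp only [Finset.card_filter]
  rw [← (Fin.consEquiv fun _ => Bool).sum_comp, Fintype.sum_prod_type, Fintype.sum_bool, add_comm]
  rfl

theorem DegreeLT.slice_not {g : Cube (n + 1) → Bool} (hg : DegreeLT (d + 1) g) {b : Bool}
    (hb : ∀ x, g (Fin.cons b x) = false) : DegreeLT d fun x => g (Fin.cons (!b) x) := by
  convert hg.2 using 2 with x
  cases b <;> simp [hb]

theorem DegreeLT.two_pow_le_card (hg : DegreeLT d g) (hne : ∃ x, g x = true) :
    2 ^ (n + 1) ≤ 2 ^ d * #{x | g x = true} := by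
  obtain ⟨x, hx⟩ := hne
  obtain _ | d := d
  · simp [degreeLT_zero_iff.1 hg x] at hx
  induction n generalizing d with
  | zero =>
    have hpos : 0 < #{x | g x = true} :=
      Finset.card_pos.2 ⟨x, by simpa only [Finset.mem_filter_univ]⟩
    calc 2 ^ 1 ≤ 2 ^ (d + 1) := Nat.pow_le_pow_right two_pos (by omega)
      _ ≤ _ := Nat.le_mul_of_pos_right _ hpos
  | succ n ih =>
    by_cases! hslices : ∀ b, ∃ y, g (Fin.cons b y) = true
    · obtain ⟨y, hy⟩ := hslices false
      obtain ⟨z, hz⟩ := hslices true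
      have hfalse := ih y hy d (hg.slice false)
      have htrue := ih z hz d (hg.slice true)
      rw [pow_succ, card_filter_cons, mul_add]
      omega
    · obtain ⟨b, hb⟩ := hslices
      simp only [Bool.not_eq_true, ne_eq] at hb
      have hx0 : x 0 = !b := Bool.eq_not_of_ne fun h => by
        simpa only [← h, Fin.cons_self_tail, hx, Bool.true_eq_false] using hb (Fin.tail x)
      obtain _ | d := d
      · simpa only [← hx0, Fin.cons_self_tail, hx, Bool.true_eq_false] using
          degreeLT_zero_iff.1 (hg.slice_not hb) (Fin.tail x)
      have hle := ih (Fin.tail x) (by rwa [← hx0, Fin.cons_self_tail]) d (hg.slice_not hb)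
      calc 2 ^ (n + 1 + 1) = 2 * 2 ^ (n + 1) := pow_succ' ..
        _ ≤ 2 * (2 ^ (d + 1) * #{y : Cube n | g (Fin.cons (!b) y) = true}) := by gcongr
        _ = 2 ^ (d + 1 + 1) * #{y : Cube n | g (Fin.cons (!b) y) = true} := by ring
        _ ≤ 2 ^ (d + 1 + 1) * #{x | g x = true} := by
          gcongr
          rw [card_filter_cons fun x => g x = true]
          cases b <;> simp

theorem DTree.two_pow_le_card_ne {T T' : DTree n} (hT : T.depth ≤ d) (hT' : T'.depth ≤ d)
    (h : T.eval ≠ T'.eval) : 2 ^ n ≤ 2 ^ d * #{x | T.eval x ≠ T'.eval x} := by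
  obtain ⟨x, hx⟩ := Function.ne_iff.1 h
  have hle := ((T.degreeLT_eval hT).xor (T'.degreeLT_eval hT')).two_pow_le_card
    ⟨x, by simpa using hx⟩
  rw [pow_succ, pow_succ, mul_right_comm] at hle
  simpa using Nat.le_of_mul_le_mul_right hle two_pos

end

/-! ### Restricting and counting trees -/

namespace DTree

variable {n : ℕ}

/-- The tree in which the variables outside `R` are replaced by `0`. -/
def restrict (R : Finset (Fin n)) : DTree n → DTree n
  | leaf b => leaf b
  | node i l r => if i ∈ R then node i (l.restrict R) (r.restrict R) else l.restrict R

theorem eval_restrict (R : Finset (Fin n)) (T : DTree n) (x : Cube n) :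
    (T.restrict R).eval x = T.eval (project R x) := by
  induction T with
  | leaf b => rfl
  | node i l r ihl ihr => by_cases hi : i ∈ R <;> simp [restrict, eval, hi, ihl, ihr, project]

theorem vars_restrict (R : Finset (Fin n)) (T : DTree n) : (T.restrict R).vars ⊆ R := by
  induction T with
  | leaf => exact Finset.empty_subset R
  | node i l r ihl ihr =>
    rw [restrict]
    split_ifs with hi
    · exact Finset.insert_subset hi (Finset.union_subset ihl ihr)
    · exact ihl

theorem size_restrict (R : Finset (Fin n)) (T : DTree n) : (T.restrict R).size ≤ T.size := by
  induction T with
  | leaf b => rfl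
  | node i l r ihl ihr =>
    rw [restrict]
    split_ifs <;> simp only [size] <;> omega

theorem depth_restrict (R : Finset (Fin n)) (T : DTree n) : (T.restrict R).depth ≤ T.depth := by
  induction T with
  | leaf b => rfl
  | node i l r ihl ihr =>
    rw [restrict]
    split_ifs <;> simp only [depth] <;> omega

theorem card_vars_lt_size (T : DTree n) : #T.vars < T.size := by
  induction T with
  | leaf => exact Nat.zero_lt_one
  | node i l r ihl ihr =>
    have hinsert := Finset.card_insert_le i (l.vars ∪ r.vars)
    have hunion := Finset.card_union_le l.vars r.vars
    simp only [vars, size]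
    omega

theorem eval_congr (T : DTree n) {x y : Cube n} (h : ∀ i ∈ T.vars, x i = y i) :
    T.eval x = T.eval y := by
  induction T with
  | leaf b => rfl
  | node i l r ihl ihr =>
    simp only [vars, Finset.forall_mem_insert, Finset.forall_mem_union] at h
    simp only [eval, h.1, ihl h.2.1, ihr h.2.2]

theorem mem_vars_of_relevant (T : DTree n) {i : Fin n} (h : Relevant T.eval i) : i ∈ T.vars := by
  obtain ⟨x, y, hxy, hne⟩ := h
  by_contra hi
  exact hne (T.eval_congr fun j hj => hxy j (ne_of_mem_of_not_mem hj hi))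

/-- The labels of a tree in preorder. -/
def preorder : DTree n → List (Fin n ⊕ Bool)
  | leaf b => [.inr b]
  | node i l r => .inl i :: (l.preorder ++ r.preorder)

theorem preorder_append_inj {T T' : DTree n} {u u' : List (Fin n ⊕ Bool)}
    (h : T.preorder ++ u = T'.preorder ++ u') : T = T' ∧ u = u' := by
  induction T generalizing T' u u' with
  | leaf b =>
    cases T' with
    | leaf b' => simpa [preorder] using h
    | node => simp [preorder] at h
  | node i l r ihl ihr =>
    cases T' with
    | leaf b' => simp [preorder] at h
    | node i' l' r' =>
      simp only [preorder, List.cons_append, List.append_assoc, List.cons.injEq,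
        Sum.inl.injEq] at h
      obtain ⟨hl, hrest⟩ := ihl h.2
      obtain ⟨hr, hu⟩ := ihr hrest
      exact ⟨by rw [h.1, hl, hr], hu⟩

theorem preorder_injective : Function.Injective (preorder : DTree n → _) := fun T T' h =>
  (preorder_append_inj (u := []) (u' := []) (by rw [h])).1

theorem length_preorder_add_one (T : DTree n) : T.preorder.length + 1 = 2 * T.size := by
  induction T with
  | leaf b => rfl
  | node i l r ihl ihr =>
    simp only [preorder, size, List.length_cons, List.length_append]
    omega

theorem mem_disjSum_of_mem_preorder {T : DTree n} {a : Fin n ⊕ Bool} (h : a ∈ T.preorder) :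
    a ∈ T.vars.disjSum Finset.univ := by
  induction T with
  | leaf b => simp_all [preorder]
  | node i l r ihl ihr =>
    simp only [preorder, List.mem_cons, List.mem_append] at h
    obtain rfl | h | h := h
    · simp [vars]
    · refine Finset.disjSum_mono ?_ subset_rfl (ihl h)
      grind [vars]
    · refine Finset.disjSum_mono ?_ subset_rfl (ihr h)
      grind [vars]

theorem exists_finset_card_le (V : Finset (Fin n)) (s : ℕ) :
    ∃ C : Finset (DTree n), #C ≤ (#V + 3) ^ (2 * s) ∧
      ∀ T : DTree n, T.size ≤ s → T.vars ⊆ V → T ∈ C := by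
  let trees : Set (DTree n) := {T | T.size ≤ s ∧ T.vars ⊆ V}
  let code (T : DTree n) (i : Fin (2 * s)) : Option (Fin n ⊕ Bool) := T.preorder[(i : ℕ)]?
  let codes := Fintype.piFinset fun _ : Fin (2 * s) =>
    Finset.insertNone (V.disjSum (Finset.univ : Finset Bool))
  have hmaps : Set.MapsTo code trees codes := by
    intro T hT
    refine Fintype.mem_piFinset.2 fun i => Finset.mem_insertNone.2 fun a ha => ?_
    exact Finset.disjSum_mono hT.2 subset_rfl
      (mem_disjSum_of_mem_preorder (List.mem_of_getElem? ha))
  have hinj : Set.InjOn code trees := by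
    intro T hT T' hT' h
    refine preorder_injective (List.ext_getElem? fun i => ?_)
    by_cases hi : i < 2 * s
    · exact congrFun h ⟨i, hi⟩
    · have hlen := T.length_preorder_add_one
      have hlen' := T'.length_preorder_add_one
      have hsize := hT.1
      have hsize' := hT'.1
      rw [List.getElem?_eq_none (by omega), List.getElem?_eq_none (by omega)]
  have hfin : trees.Finite := Set.Finite.of_injOn hmaps hinj codes.finite_toSet
  refine ⟨hfin.toFinset, ?_, fun T hsize hvars => hfin.mem_toFinset.2 ⟨hsize, hvars⟩⟩
  calc #hfin.toFinset ≤ #codes := Finset.card_le_card_of_injOn code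
        (by simpa using hmaps) (by simpa using hinj)
    _ = (#V + 3) ^ (2 * s) := by simp [codes, add_assoc]

end DTree

/-! ### Counting the bad sequences of samples -/

section

open scoped Classical in
theorem card_fin_succ_filter {α : Type*} [Fintype α] {t : ℕ} (P : (Fin (t + 1) → α) → Prop) :
    #{X | P X} = ∑ x, #{X : Fin t → α | P (Fin.cons x X)} := by
  simp only [Finset.card_filter]
  rw [← (Fin.consEquiv fun _ => α).sum_comp, Fintype.sum_prod_type]
  rfl

variable {n : ℕ} {f : Cube n → Bool}

/-- The set `R` contains all the variables on which `f` depends. -/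
def Covers (f : Cube n → Bool) (R : Finset (Fin n)) : Prop := ∀ x, f (project R x) = f x

/-- The samples `X` may lead from `R` to a set that does not cover `f`. -/
def Misses (f : Cube n → Bool) {t : ℕ} (R : Finset (Fin n)) (X : Fin t → Cube n) : Prop :=
  ∃ R', Leads f X R R' ∧ ¬ Covers f R'

theorem Covers.eq_of_leads {R R' : Finset (Fin n)} {t : ℕ} {X : Fin t → Cube n}
    (hR : Covers f R) (h : Leads f X R R') : R' = R := by
  induction t with
  | zero => exact h
  | succ t ih =>
    obtain ⟨S, hstep | ⟨hne, -, -⟩, h⟩ := h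
    · exact ih h
    · exact absurd (hR _) hne

theorem Covers.not_misses {R : Finset (Fin n)} (hR : Covers f R) {t : ℕ} (X : Fin t → Cube n) :
    ¬ Misses f R X := by
  rintro ⟨R', hlead, hR'⟩
  exact hR' (hR.eq_of_leads hlead ▸ hR)

theorem Misses.of_cons {R : Finset (Fin n)} {t : ℕ} {x : Cube n} {X : Fin t → Cube n}
    (h : Misses f R (Fin.cons x X : Fin (t + 1) → Cube n)) : ∃ S, Step f R x S ∧ Misses f S X := by
  obtain ⟨R', ⟨S, hstep, hlead⟩, hR'⟩ := h
  exact ⟨S, hstep, R', hlead, hR'⟩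

open scoped Classical in
theorem card_misses_succ_le {V R : Finset (Fin n)} (hV : ∀ i, Relevant f i → i ∈ V) (t : ℕ) :
    #{X : Fin (t + 1) → Cube n | Misses f R X} ≤
      #{x | f (project R x) = f x} * #{X : Fin t → Cube n | Misses f R X} +
      #{x | f (project R x) ≠ f x} *
        ∑ i ∈ V \ R, #{X : Fin t → Cube n | Misses f (insert i R) X} := by
  rw [card_fin_succ_filter, ← Finset.sum_filter_add_sum_filter_not _ fun x => f (project R x) = f x]
  gcongr
  · refine Finset.sum_le_card_nsmul _ _ _ fun x hx => Finset.card_le_card fun X hX => ?_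
    simp only [Finset.mem_filter_univ] at hx hX ⊢
    obtain ⟨S, hstep | ⟨hne, -, -⟩, hmiss⟩ := hX.of_cons
    · exact hmiss
    · exact absurd hx hne
  · refine Finset.sum_le_card_nsmul _ _ _ fun x hx => le_trans (Finset.card_le_card fun X hX => ?_)
      (Finset.card_biUnion_le (t := fun i => {X : Fin t → Cube n | Misses f (insert i R) X}))
    simp only [Finset.mem_filter_univ, Finset.mem_biUnion, Finset.mem_sdiff] at hx hX ⊢
    obtain ⟨S, hstep | ⟨-, hi, hrel⟩, hmiss⟩ := hX.of_cons
    · contradiction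
    · exact ⟨_, ⟨hV _ hrel, hi⟩, hmiss⟩

variable {d s : ℕ}

theorem one_sub_one_div_two_pow_nonneg (k : ℕ) : (0 : ℝ) ≤ 1 - 1 / 2 ^ k :=
  sub_nonneg.2 (div_le_one_of_le₀ (one_le_pow₀ one_le_two) (by positivity))

theorem card_eq_add_card_ne (f g : Cube n → Bool) :
    (#{x | f x = g x} + #{x | f x ≠ g x} : ℝ) = 2 ^ n := by
  have h := Finset.card_filter_add_card_filter_not (s := (Finset.univ : Finset (Cube n)))
    fun x => f x = g x
  rw [Finset.card_univ, Fintype.card_pi] at h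
  exact_mod_cast h.trans (by simp)

theorem DTree.card_eq_add_half_card_ne_le {T T' : DTree n} (hT : T.depth ≤ d)
    (hT' : T'.depth ≤ d) (h : T.eval ≠ T'.eval) :
    (#{x | T.eval x = T'.eval x} + #{x | T.eval x ≠ T'.eval x} / 2 : ℝ) ≤
      2 ^ n * (1 - 1 / 2 ^ (d + 1)) := by
  have hsum := card_eq_add_card_ne T.eval T'.eval
  have hne : (2 : ℝ) ^ n ≤ 2 ^ d * #{x | T.eval x ≠ T'.eval x} := mod_cast
    DTree.two_pow_le_card_ne hT hT' h
  have hdiv : (2 : ℝ) ^ n * (1 / 2 ^ (d + 1)) ≤ #{x | T.eval x ≠ T'.eval x} / 2 := by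
    rw [mul_one_div, div_le_iff₀ (by positivity), pow_succ]
    linarith
  linarith

theorem mul_pow_pred_le {w s : ℕ} (h : w ≤ s) :
    (w * (2 * s) ^ (w - 1) : ℝ) ≤ (2 * s) ^ w / 2 := by
  cases w with
  | zero => simp
  | succ w =>
    have hs : ((w + 1 : ℕ) : ℝ) ≤ s := mod_cast h
    calc (((w + 1 : ℕ) : ℝ) * (2 * s) ^ w : ℝ) ≤ s * (2 * s) ^ w := by gcongr
      _ = (2 * s) ^ (w + 1) / 2 := by ring

open scoped Classical in
theorem DTree.card_misses_succ_le_mul (T : DTree n) (hd : T.depth ≤ d) (hs : T.size ≤ s) {t : ℕ}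
    {Q : ℝ} (hQ : 0 ≤ Q) {R : Finset (Fin n)} (hR : ¬ Covers T.eval R)
    (h : ∀ R, (#{X : Fin t → Cube n | Misses T.eval R X} : ℝ) ≤ (2 * s) ^ #(T.vars \ R) * Q) :
    (#{X : Fin (t + 1) → Cube n | Misses T.eval R X} : ℝ) ≤
      (2 * s) ^ #(T.vars \ R) * Q * (2 ^ n * (1 - 1 / 2 ^ (d + 1))) := by
  have hrestrict : (T.restrict R).eval = fun x => T.eval (project R x) :=
    funext (T.eval_restrict R)
  have hagree := DTree.card_eq_add_half_card_ne_le ((T.depth_restrict R).trans hd) hd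
    fun h => hR fun x => by rw [← T.eval_restrict, h]
  simp only [hrestrict] at hagree
  have hw : #(T.vars \ R) ≤ s := (Finset.card_le_card Finset.sdiff_subset).trans
    (T.card_vars_lt_size.le.trans hs)
  -- A sample on which the projection to `R` is wrong extends `R` in at most `s` ways, and each of
  -- them lowers the exponent of `2 * s`; so these samples count only half.
  have hsum : (∑ i ∈ T.vars \ R, #{X : Fin t → Cube n | Misses T.eval (insert i R) X} : ℝ) ≤
      (2 * s) ^ #(T.vars \ R) / 2 * Q := by
    refine (Finset.sum_le_card_nsmul _ _ ((2 * s) ^ (#(T.vars \ R) - 1) * Q)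
      fun i hi => ?_).trans ?_
    · rw [← Finset.card_erase_of_mem hi, ← Finset.sdiff_insert]
      exact h (insert i R)
    · rw [nsmul_eq_mul, ← mul_assoc]
      gcongr
      exact mul_pow_pred_le hw
  calc (#{X : Fin (t + 1) → Cube n | Misses T.eval R X} : ℝ)
      ≤ #{x | T.eval (project R x) = T.eval x} * #{X : Fin t → Cube n | Misses T.eval R X} +
        #{x | T.eval (project R x) ≠ T.eval x} *
          ∑ i ∈ T.vars \ R, (#{X : Fin t → Cube n | Misses T.eval (insert i R) X} : ℝ) :=
        mod_cast card_misses_succ_le (fun _ => T.mem_vars_of_relevant) t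
    _ ≤ #{x | T.eval (project R x) = T.eval x} * ((2 * s) ^ #(T.vars \ R) * Q) +
        #{x | T.eval (project R x) ≠ T.eval x} * ((2 * s) ^ #(T.vars \ R) / 2 * Q) := by
        gcongr
        exact h R
    _ = (2 * s) ^ #(T.vars \ R) * Q * (#{x | T.eval (project R x) = T.eval x} +
        #{x | T.eval (project R x) ≠ T.eval x} / 2) := by ring
    _ ≤ (2 * s) ^ #(T.vars \ R) * Q * (2 ^ n * (1 - 1 / 2 ^ (d + 1))) := by gcongr

open scoped Classical in
theorem DTree.card_misses_le (T : DTree n) (hd : T.depth ≤ d) (hs : T.size ≤ s) (t : ℕ)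
    (R : Finset (Fin n)) :
    (#{X : Fin t → Cube n | Misses T.eval R X} : ℝ) ≤
      (2 * s) ^ #(T.vars \ R) * (2 ^ n * (1 - 1 / 2 ^ (d + 1))) ^ t := by
  have hq := one_sub_one_div_two_pow_nonneg (d + 1)
  have hs' : (1 : ℝ) ≤ s := mod_cast (Nat.zero_lt_of_lt T.card_vars_lt_size).trans_le hs
  induction t generalizing R with
  | zero =>
    rw [pow_zero, mul_one]
    calc (#{X : Fin 0 → Cube n | Misses T.eval R X} : ℝ) ≤ 1 :=
          mod_cast (Finset.card_filter_le _ _).trans (by simp)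
      _ ≤ _ := one_le_pow₀ (by linarith)
  | succ t ih =>
    by_cases hR : Covers T.eval R
    · rw [Finset.filter_false_of_mem fun X _ => hR.not_misses X, Finset.card_empty, Nat.cast_zero]
      positivity
    · rw [pow_succ, ← mul_assoc]
      exact T.card_misses_succ_le_mul hd hs (by positivity) hR ih

/-- A tree other than `f` in the class, with variables in `V`, is consistent with the samples. -/
def Fools (f : Cube n → Bool) (d s : ℕ) (V : Finset (Fin n)) {t : ℕ} (X : Fin t → Cube n) : Prop :=
  ∃ T : DTree n, T.depth ≤ d ∧ T.size ≤ s ∧ T.vars ⊆ V ∧ T.eval ≠ f ∧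
    ∀ k, T.eval (X k) = f (X k)

theorem DTree.card_forall_eval_eq_le {T T' : DTree n} (hT : T.depth ≤ d) (hT' : T'.depth ≤ d)
    (h : T.eval ≠ T'.eval) (t : ℕ) :
    (#{X : Fin t → Cube n | ∀ k, T.eval (X k) = T'.eval (X k)} : ℝ) ≤
      (2 ^ n * (1 - 1 / 2 ^ (d + 1))) ^ t := by
  have hpi : ({X | ∀ k, T.eval (X k) = T'.eval (X k)} : Finset (Fin t → Cube n)) =
      Fintype.piFinset fun _ => {x | T.eval x = T'.eval x} := by
    ext X
    simp
  rw [hpi, Fintype.card_piFinset_const, Nat.cast_pow]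
  gcongr
  exact (le_add_of_nonneg_right (by positivity)).trans (card_eq_add_half_card_ne_le hT hT' h)

open scoped Classical in
theorem DTree.card_fools_le (T : DTree n) (hd : T.depth ≤ d) (s : ℕ) (V : Finset (Fin n)) (t : ℕ) :
    (#{X : Fin t → Cube n | Fools T.eval d s V X} : ℝ) ≤
      (#V + 3) ^ (2 * s) * (2 ^ n * (1 - 1 / 2 ^ (d + 1))) ^ t := by
  obtain ⟨C, hcard, hC⟩ := exists_finset_card_le V s
  have hq := one_sub_one_div_two_pow_nonneg (d + 1)
  let others : Finset (DTree n) := {T' ∈ C | T'.depth ≤ d ∧ T'.eval ≠ T.eval}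
  have hsub : ({X | Fools T.eval d s V X} : Finset (Fin t → Cube n)) ⊆
      others.biUnion fun T' => {X | ∀ k, T'.eval (X k) = T.eval (X k)} := by
    intro X hX
    obtain ⟨T', hd', hs', hV', hne, heq⟩ := (Finset.mem_filter_univ _).1 hX
    exact Finset.mem_biUnion.2 ⟨T', Finset.mem_filter.2 ⟨hC T' hs' hV', hd', hne⟩,
      (Finset.mem_filter_univ _).2 heq⟩
  calc (#{X : Fin t → Cube n | Fools T.eval d s V X} : ℝ)
      ≤ ∑ T' ∈ others, (#{X : Fin t → Cube n | ∀ k, T'.eval (X k) = T.eval (X k)} : ℝ) :=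
        mod_cast (Finset.card_le_card hsub).trans Finset.card_biUnion_le
    _ ≤ #others • (2 ^ n * (1 - 1 / 2 ^ (d + 1))) ^ t :=
        Finset.sum_le_card_nsmul _ _ _ fun T' hT' =>
          have hT' := (Finset.mem_filter.1 hT').2
          card_forall_eval_eq_le hT'.1 hd hT'.2 t
    _ ≤ (#V + 3) ^ (2 * s) * (2 ^ n * (1 - 1 / 2 ^ (d + 1))) ^ t := by
        rw [nsmul_eq_mul]
        gcongr
        exact_mod_cast (Finset.card_filter_le _ _).trans hcard

end

/-! ### The probability of failure -/

section

open MeasureTheory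

instance : IsProbabilityMeasure coins := by
  unfold coins
  infer_instance

theorem coins_forall_lt_eq (N : ℕ) (w : ℕ → Bool) : coins {ω | ∀ k < N, ω k = w k} = 2⁻¹ ^ N := by
  have hpi : {ω : ℕ → Bool | ∀ k < N, ω k = w k} =
      Set.pi (Finset.range N : Set ℕ) fun k => {w k} := by
    ext ω
    simp
  rw [hpi, coins, Measure.infinitePi_pi _ fun k _ => MeasurableSet.singleton _]
  simp

variable {n : ℕ}

theorem coins_drawn_eq_le {M : ℕ} (X : Fin M → Cube n) :
    coins.real {ω | (fun t : Fin M => drawn n ω t) = X} ≤ (1 / 2) ^ (M * n) := by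
  let w : ℕ → Bool :=
    Function.extend Fin.val (fun k : Fin (M * n) => X k.divNat k.modNat) fun _ => false
  have hsub : {ω | (fun t : Fin M => drawn n ω t) = X} ⊆ {ω | ∀ k < M * n, ω k = w k} := by
    rintro ω rfl k hk
    have hw := Fin.val_injective.extend_apply
      (fun j : Fin (M * n) => drawn n ω j.divNat j.modNat) (fun _ => false) ⟨k, hk⟩
    exact (congrArg ω (Nat.div_add_mod' k n).symm).trans hw.symm
  refine (measureReal_mono hsub).trans_eq ?_
  rw [measureReal_def, coins_forall_lt_eq]
  simp

theorem coins_drawn_mem_le {M : ℕ} (B : Finset (Fin M → Cube n)) :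
    coins.real {ω | (fun t : Fin M => drawn n ω t) ∈ B} ≤ #B * (1 / 2) ^ (M * n) := by
  have hunion : {ω | (fun t : Fin M => drawn n ω t) ∈ B} =
      ⋃ X ∈ B, {ω | (fun t : Fin M => drawn n ω t) = X} := by
    ext ω
    simp
  calc coins.real {ω | (fun t : Fin M => drawn n ω t) ∈ B}
      ≤ ∑ X ∈ B, coins.real {ω | (fun t : Fin M => drawn n ω t) = X} :=
        hunion ▸ measureReal_biUnion_finset_le _ _
    _ ≤ #B • (1 / 2 : ℝ) ^ (M * n) :=
        Finset.sum_le_card_nsmul _ _ _ fun X _ => coins_drawn_eq_le X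
    _ = #B * (1 / 2) ^ (M * n) := nsmul_eq_mul _ _

theorem one_sub_one_div_pow_mul_le {Q : ℕ} (hQ : 1 ≤ Q) (E : ℕ) :
    (1 - 1 / (Q : ℝ)) ^ (Q * E) ≤ (1 / 2) ^ E := by
  have hQ' : (1 : ℝ) ≤ Q := mod_cast hQ
  rw [pow_mul]
  gcongr
  · exact pow_nonneg (sub_nonneg.2 (div_le_one_of_le₀ hQ' (by positivity))) Q
  · exact (Real.one_sub_div_pow_le_exp_neg hQ').trans Real.exp_neg_one_lt_half.le

variable {d s : ℕ}

open scoped Classical in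
theorem DTree.card_misses_or_fools_le (T : DTree n) (hd : T.depth ≤ d) (hs : T.size ≤ s) (t : ℕ) :
    (#{X : Fin t → Cube n | Misses T.eval ∅ X ∨ Fools T.eval d s T.vars X} : ℝ) ≤
      2 * (2 ^ (s.size + 1)) ^ (2 * s) * (2 ^ n * (1 - 1 / 2 ^ (d + 1))) ^ t := by
  have hvars := T.card_vars_lt_size
  have hsize : 2 * s + 2 ≤ 2 ^ (s.size + 1) := by
    have := Nat.lt_size_self s
    rw [pow_succ]
    omega
  have hq := one_sub_one_div_two_pow_nonneg (d + 1)
  have hmisses : (2 * s : ℝ) ^ #(T.vars \ ∅) ≤ (2 ^ (s.size + 1)) ^ (2 * s) := by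
    rw [Finset.sdiff_empty]
    calc (2 * s : ℝ) ^ #T.vars ≤ (2 ^ (s.size + 1)) ^ #T.vars := by
          gcongr
          exact_mod_cast (by omega : 2 * s ≤ 2 ^ (s.size + 1))
      _ ≤ (2 ^ (s.size + 1)) ^ (2 * s) :=
          pow_le_pow_right₀ (one_le_pow₀ one_le_two) (by omega)
  have hfools : (#T.vars + 3 : ℝ) ^ (2 * s) ≤ (2 ^ (s.size + 1)) ^ (2 * s) := by
    gcongr
    exact_mod_cast (by omega : #T.vars + 3 ≤ 2 ^ (s.size + 1))
  calc (#{X : Fin t → Cube n | Misses T.eval ∅ X ∨ Fools T.eval d s T.vars X} : ℝ)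
      ≤ #{X : Fin t → Cube n | Misses T.eval ∅ X} +
        #{X : Fin t → Cube n | Fools T.eval d s T.vars X} := by
        rw [Finset.filter_or]
        exact_mod_cast Finset.card_union_le _ _
    _ ≤ (2 ^ (s.size + 1)) ^ (2 * s) * (2 ^ n * (1 - 1 / 2 ^ (d + 1))) ^ t +
        (2 ^ (s.size + 1)) ^ (2 * s) * (2 ^ n * (1 - 1 / 2 ^ (d + 1))) ^ t := by
        refine add_le_add ((T.card_misses_le hd hs t ∅).trans ?_)
          ((T.card_fools_le hd s T.vars t).trans ?_) <;> gcongr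
    _ = 2 * (2 ^ (s.size + 1)) ^ (2 * s) * (2 ^ n * (1 - 1 / 2 ^ (d + 1))) ^ t := by ring

theorem DTree.coins_misses_or_fools_le (T : DTree n) (hd : T.depth ≤ d) (hs : T.size ≤ s) (N : ℕ) :
    coins.real {ω | Misses T.eval ∅ (fun t : Fin (sampleCount d s N) => drawn n ω t) ∨
      Fools T.eval d s T.vars (fun t : Fin (sampleCount d s N) => drawn n ω t)} ≤
      (1 / 2) ^ N.size := by
  classical
  let bad : Finset (Fin (sampleCount d s N) → Cube n) :=
    {X | Misses T.eval ∅ X ∨ Fools T.eval d s T.vars X}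
  have hpow : (1 - 1 / 2 ^ (d + 1) : ℝ) ^ sampleCount d s N ≤
      (1 / 2) ^ (2 * s * (s.size + 1) + N.size + 1) := mod_cast
    one_sub_one_div_pow_mul_le (Nat.one_le_two_pow (n := d + 1)) _
  calc _ = coins.real {ω | (fun t : Fin (sampleCount d s N) => drawn n ω t) ∈ bad} := by
        simp only [bad, Finset.mem_filter_univ]
    _ ≤ #bad * (1 / 2) ^ (sampleCount d s N * n) := coins_drawn_mem_le bad
    _ ≤ 2 * (2 ^ (s.size + 1)) ^ (2 * s) * (2 ^ n * (1 - 1 / 2 ^ (d + 1))) ^ sampleCount d s N *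
        (1 / 2) ^ (sampleCount d s N * n) := by
        gcongr
        exact T.card_misses_or_fools_le hd hs _
    _ = 2 * (2 ^ (s.size + 1)) ^ (2 * s) * (1 - 1 / 2 ^ (d + 1)) ^ sampleCount d s N := by
        rw [mul_pow, mul_comm (sampleCount d s N) n, pow_mul (1 / 2), one_div_pow, one_div_pow]
        field_simp
    _ ≤ 2 * (2 ^ (s.size + 1)) ^ (2 * s) * (1 / 2) ^ (2 * s * (s.size + 1) + N.size + 1) := by
        gcongr
    _ = (1 / 2) ^ N.size := by
        rw [← pow_mul, pow_succ, pow_add, mul_comm (s.size + 1), one_div_pow, one_div_pow]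
        field_simp

end

section

open MeasureTheory

variable {n d s m : ℕ}

theorem Leads.subset {f : Cube n → Bool} {t : ℕ} {X : Fin t → Cube n} {R R' V : Finset (Fin n)}
    (h : Leads f X R R') (hR : R ⊆ V) (hV : ∀ i, Relevant f i → i ∈ V) : R' ⊆ V := by
  induction t generalizing R with
  | zero => exact (h : R' = R) ▸ hR
  | succ t ih =>
    obtain ⟨S, ⟨-⟩ | ⟨-, -, hrel⟩, h⟩ := h
    · exact ih h hR
    · exact ih h (Finset.insert_subset (hV _ hrel) hR)

theorem Solved.outputsTree {T : DTree n} {X : ℕ → Cube n} {R : Finset (Fin n)} {τ : State}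
    (h : Solved T.eval X d s m R τ.mem) (hd : T.depth ≤ d) (hs : T.size ≤ s)
    (hlead : Leads T.eval (fun t : Fin m => X t) ∅ R) (hreg : τ.reg 0 = sampleAddr n m)
    (hmisses : ¬ Misses T.eval ∅ fun t : Fin m => X t)
    (hfools : ¬ Fools T.eval d s T.vars fun t : Fin m => X t) : OutputsTree d s T.eval τ := by
  have hcovers : Covers T.eval R := not_not.1 fun hR => hmisses ⟨R, hlead, hR⟩
  obtain ⟨T', hd', hs', hvars, hstored, hfit⟩ := h.exists_tree ((T.depth_restrict R).trans hd)
    ((T.size_restrict R).trans hs) (T.vars_restrict R) fun t _ => by rw [T.eval_restrict, hcovers]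
  have hR : R ⊆ T.vars :=
    hlead.subset (Finset.empty_subset _) fun _ => T.mem_vars_of_relevant
  exact ⟨T', hd', hs', hreg ▸ hstored, not_not.1 fun hne =>
    hfools ⟨T', hd', hs', hvars.trans hR, hne, fun k => hfit k k.2⟩⟩

theorem DTree.coins_outputsTree_ge (T : DTree n) (hd : T.depth ≤ d) (hs : T.size ≤ s)
    (hn : 0 < n) {N : ℕ} (hN : 0 < N) :
    1 - (1 / 2) ^ N.size ≤ coins.real {ω | ∃ τ,
      Exec T.eval ω learner (State.init n d s N) τ ∧ OutputsTree d s T.eval τ} := by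
  set good := {ω | ∃ τ, Exec T.eval ω learner (State.init n d s N) τ ∧ OutputsTree d s T.eval τ}
  set bad := {ω | Misses T.eval ∅ (fun t : Fin (sampleCount d s N) => drawn n ω t) ∨
    Fools T.eval d s T.vars (fun t : Fin (sampleCount d s N) => drawn n ω t)}
  have hs₀ : 0 < s := (Nat.zero_lt_of_lt T.card_vars_lt_size).trans_le hs
  have hcover : Set.univ ⊆ good ∪ bad := by
    refine fun ω _ => or_iff_not_imp_right.2 fun hω => ?_
    obtain ⟨hmisses, hfools⟩ := not_or.1 hω
    obtain ⟨τ, hexec, R, hlead, hsolved, hreg, -, -⟩ :=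
      run_learner (f := T.eval) (ω := ω) (d := d) hn hs₀ hN rfl
    exact ⟨τ, hexec, hsolved.outputsTree hd hs hlead hreg hmisses hfools⟩
  have hbad : coins.real bad ≤ (1 / 2) ^ N.size := T.coins_misses_or_fools_le hd hs N
  calc 1 - (1 / 2) ^ N.size ≤ coins.real Set.univ - coins.real bad := by
        rw [probReal_univ]
        gcongr
    _ ≤ coins.real (good ∪ bad) - coins.real bad := by
        gcongr
        exact measure_ne_top _ _
    _ ≤ coins.real good := sub_le_iff_le_add.2 (measureReal_union_le _ _)

end

/-! ### The bounds -/

section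

open Real

theorem natCast_size_le_logb {a : ℕ} (ha : 0 < a) : (a.size : ℝ) ≤ logb 2 a + 1 := by
  obtain ⟨k, hk⟩ := Nat.exists_eq_add_one.2 (Nat.size_pos.2 ha)
  have hpow : (2 : ℝ) ^ k ≤ a := mod_cast Nat.lt_size.1 (hk ▸ k.lt_succ_self)
  rw [hk, Nat.cast_succ]
  gcongr
  exact (le_logb_iff_rpow_le one_lt_two (mod_cast ha)).2 (by rwa [rpow_natCast])

theorem natCast_clog_le_logb {a : ℕ} (ha : 0 < a) : (Nat.clog 2 a : ℝ) ≤ logb 2 a + 1 := by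
  rw [← natCeil_logb_natCast]
  exact (Nat.ceil_lt_add_one (logb_nonneg one_lt_two (mod_cast ha))).le

theorem logb_two_natCast_le (a : ℕ) : logb 2 a ≤ a := by
  obtain rfl | ha := a.eq_zero_or_pos
  · simp
  · rw [logb_le_iff_le_rpow one_lt_two (mod_cast ha), rpow_natCast]
    exact_mod_cast Nat.lt_two_pow_self.le

variable {n d s r : ℕ} {δ : ℝ}

theorem one_le_logb_one_div (hδ : 0 < δ) (hδ' : δ ≤ 1 / 2) : 1 ≤ logb 2 (1 / δ) := by
  rw [le_logb_iff_rpow_le one_lt_two (by positivity), rpow_one, le_div_iff₀ hδ]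
  linarith

theorem logb_two_div_eq (hs : 0 < s) (hδ : 0 < δ) :
    logb 2 (s / δ) = logb 2 s + logb 2 (1 / δ) := by
  rw [← logb_mul (by positivity) (by positivity), mul_one_div]

theorem one_div_two_pow_size_ceil_le (hδ : 0 < δ) : (1 / 2 : ℝ) ^ ⌈1 / δ⌉₊.size ≤ δ := by
  rw [one_div_pow, one_div_le (by positivity) hδ]
  exact (Nat.le_ceil _).trans (mod_cast (Nat.lt_size_self _).le)

theorem sampleCount_le (hs : 0 < s) (hδ : 0 < δ) (hδ' : δ ≤ 1 / 2) :
    (sampleCount d s ⌈1 / δ⌉₊ : ℝ) ≤ 18 * (s * (2 ^ d * logb 2 (s / δ))) := by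
  have hs₁ : (1 : ℝ) ≤ s := mod_cast hs
  have hlog_s : 0 ≤ logb 2 (s : ℝ) := logb_nonneg one_lt_two hs₁
  have hL := one_le_logb_one_div hδ hδ'
  have hceil : (⌈1 / δ⌉₊ : ℝ) ≤ 2 * (1 / δ) := by
    have hdiv : 2 ≤ 1 / δ := (le_div_iff₀ hδ).2 (by linarith)
    linarith [Nat.ceil_lt_add_one (show 0 ≤ 1 / δ by positivity)]
  have hsize : (⌈1 / δ⌉₊.size : ℝ) ≤ logb 2 (1 / δ) + 2 := by
    have hN : 0 < ⌈1 / δ⌉₊ := Nat.ceil_pos.2 (by positivity)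
    have hle := logb_le_logb_of_le one_lt_two (mod_cast hN) hceil
    rw [logb_mul two_ne_zero (by positivity), logb_self_eq_one one_lt_two] at hle
    linarith [natCast_size_le_logb hN]
  have hfactor : (2 * s * (s.size + 1) + ⌈1 / δ⌉₊.size + 1 : ℝ) ≤ 9 * (s * logb 2 (s / δ)) := by
    have hsum : (2 * s * (s.size + 1) : ℝ) ≤ 2 * s * (logb 2 s + 1 + 1) := by
      gcongr
      exact natCast_size_le_logb hs
    rw [logb_two_div_eq hs hδ]
    nlinarith
  rw [sampleCount]
  push_cast
  calc (2 : ℝ) ^ (d + 1) * (2 * s * (s.size + 1) + ⌈1 / δ⌉₊.size + 1)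
      ≤ 2 ^ (d + 1) * (9 * (s * logb 2 (s / δ))) := by gcongr
    _ = 18 * (s * (2 ^ d * logb 2 (s / δ))) := by ring

/-- The number of queries in the theorem, up to an absolute constant. -/
noncomputable def queryBound (n d s : ℕ) (δ : ℝ) : ℝ :=
  s * (2 ^ d * logb 2 (s / δ) + logb 2 n)

theorem sampleCount_le_queryBound (hn : 0 < n) (hs : 0 < s) (hδ : 0 < δ) (hδ' : δ ≤ 1 / 2) :
    (sampleCount d s ⌈1 / δ⌉₊ : ℝ) ≤ 18 * queryBound n d s δ := by
  refine (sampleCount_le hs hδ hδ').trans ?_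
  rw [queryBound]
  gcongr
  exact le_add_of_nonneg_right (logb_nonneg one_lt_two (mod_cast hn))

theorem mul_one_add_logb_le_queryBound (hs : 0 < s) (hδ : 0 < δ) (hδ' : δ ≤ 1 / 2) :
    s * (1 + logb 2 n) ≤ queryBound n d s δ := by
  have hlog : 1 ≤ logb 2 (s / δ) := by
    rw [logb_two_div_eq hs hδ]
    exact le_add_of_nonneg_of_le (logb_nonneg one_lt_two (mod_cast hs))
      (one_le_logb_one_div hδ hδ')
  rw [queryBound]
  gcongr
  exact one_le_mul_of_one_le_of_one_le (one_le_pow₀ one_le_two) hlog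

theorem mul_clog_le_queryBound (hn : 0 < n) (hr : r ≤ s) (hs : 0 < s) (hδ : 0 < δ)
    (hδ' : δ ≤ 1 / 2) : r * Nat.clog 2 n ≤ queryBound n d s δ :=
  calc (r * Nat.clog 2 n : ℝ) ≤ s * (1 + logb 2 n) := by
        gcongr
        rw [add_comm]
        exact natCast_clog_le_logb hn
    _ ≤ queryBound n d s δ := mul_one_add_logb_le_queryBound hs hδ hδ'

theorem le_queryBound (hn : 0 < n) (hr : r ≤ s) (hs : 0 < s) (hδ : 0 < δ) (hδ' : δ ≤ 1 / 2) :
    r ≤ queryBound n d s δ := by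
  have hlog : 0 ≤ logb 2 (n : ℝ) := logb_nonneg one_lt_two (mod_cast hn)
  calc (r : ℝ) ≤ s := mod_cast hr
    _ ≤ s * (1 + logb 2 n) := le_mul_of_one_le_right (by positivity) (by linarith)
    _ ≤ queryBound n d s δ := mul_one_add_logb_le_queryBound hs hδ hδ'

theorem search_le (hd : 0 < d) (hr : 0 < r) (hrs : r < s) (hδ : 0 < δ) (hδ' : δ ≤ 1 / 2) :
    (300 * ((2 * r + 1) ^ d * (r + 1) * sampleCount d s ⌈1 / δ⌉₊) : ℝ) ≤
      s ^ (100 * d) * logb 2 (1 / δ) := by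
  set L := logb 2 (1 / δ)
  have hs : 0 < s := hr.trans hrs
  have hs₂ : (2 : ℝ) ≤ s := mod_cast (by omega : 2 ≤ s)
  have hrs' : (r + 1 : ℝ) ≤ s := mod_cast hrs
  have hL : 1 ≤ L := one_le_logb_one_div hδ hδ'
  have hlog : logb 2 (s / δ) ≤ 2 * s * L := by
    rw [logb_two_div_eq hs hδ]
    nlinarith [logb_two_natCast_le s]
  have hconst : (10800 : ℝ) ≤ s ^ 14 := by
    calc (10800 : ℝ) ≤ 2 ^ 14 := by norm_num
      _ ≤ s ^ 14 := by gcongr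
  calc (300 * ((2 * r + 1) ^ d * (r + 1) * sampleCount d s ⌈1 / δ⌉₊) : ℝ)
      ≤ 300 * ((2 * s) ^ d * s * (18 * (s * (2 ^ d * (2 * s * L))))) := by
        gcongr
        · linarith
        · exact (sampleCount_le hs hδ hδ').trans (by gcongr)
    _ = 10800 * (2 ^ d * s ^ d * s ^ 3 * 2 ^ d) * L := by
        rw [mul_pow]
        ring
    _ ≤ s ^ 14 * (s ^ d * s ^ d * s ^ 3 * s ^ d) * L := by gcongr
    _ = s ^ (3 * d + 17) * L := by ring
    _ ≤ s ^ (100 * d) * L := by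
        gcongr
        · linarith
        · omega

theorem search_le_add (hn : 0 < n) (hrd : r = 0 ∨ 0 < d) (hrs : r < s) (hδ : 0 < δ)
    (hδ' : δ ≤ 1 / 2) :
    (300 * ((2 * r + 1) ^ d * (r + 1) * sampleCount d s ⌈1 / δ⌉₊) : ℝ) ≤
      s ^ (100 * d) * logb 2 (1 / δ) + 6000 * (queryBound n d s δ * n) := by
  have hs : 0 < s := r.zero_le.trans_lt hrs
  have hn₁ : (1 : ℝ) ≤ n := mod_cast hn
  have hcount := sampleCount_le_queryBound (d := d) hn hs hδ hδ'
  have hY : 0 ≤ queryBound n d s δ := mod_cast le_queryBound hn s.zero_le hs hδ hδ'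
  have hL := one_le_logb_one_div hδ hδ'
  obtain rfl | hr := r.eq_zero_or_pos
  · calc _ = (300 * sampleCount d s ⌈1 / δ⌉₊ : ℝ) := by simp
      _ ≤ 6000 * (queryBound n d s δ * n) := by
          linarith [le_mul_of_one_le_right hY hn₁]
      _ ≤ _ := le_add_of_nonneg_left (by positivity)
  · exact (search_le (hrd.resolve_left hr.ne') hr hrs hδ hδ').trans
      (le_add_of_nonneg_right (by positivity))

theorem collect_le (hn : 0 < n) (hrs : r ≤ s) (hs : 0 < s) (hδ : 0 < δ) (hδ' : δ ≤ 1 / 2) :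
    (200 * (sampleCount d s ⌈1 / δ⌉₊ * n) + r * ((Nat.clog 2 n + 2) * (80 * n)) : ℝ) ≤
      4000 * (queryBound n d s δ * n) := by
  have hcount := sampleCount_le_queryBound (d := d) hn hs hδ hδ'
  have hclog := mul_clog_le_queryBound (d := d) hn hrs hs hδ hδ'
  have hr := le_queryBound (d := d) hn hrs hs hδ hδ'
  calc _ = (200 * sampleCount d s ⌈1 / δ⌉₊ + 80 * (r * Nat.clog 2 n + 2 * r)) * (n : ℝ) := by ring
    _ ≤ (4000 * queryBound n d s δ) * n := by
        gcongr
        linarith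
    _ = 4000 * (queryBound n d s δ * n) := by ring

theorem DTree.depth_pos_of_vars_nonempty {T : DTree n} (h : T.vars.Nonempty) : 0 < T.depth := by
  cases T with
  | leaf b => simp [vars] at h
  | node i l r => exact Nat.succ_pos _

theorem DTree.learner_halts (T : DTree n) (hd : T.depth ≤ d) (hs : T.size ≤ s) (hn : 0 < n)
    (hδ : 0 < δ) (hδ' : δ ≤ 1 / 2) (ω : ℕ → Bool) :
    ∃ τ, Exec T.eval ω learner (State.init n d s ⌈1 / δ⌉₊) τ ∧
      (τ.queries : ℝ) ≤ 100 * queryBound n d s δ ∧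
      (τ.time : ℝ) ≤ s ^ (100 * d) * logb 2 (1 / δ) + 100 * (100 * queryBound n d s δ * n) := by
  have hs₀ : 0 < s := (Nat.zero_lt_of_lt T.card_vars_lt_size).trans_le hs
  obtain ⟨τ, hexec, R, hlead, -, -, hqueries, htime⟩ := run_learner (f := T.eval) (ω := ω)
    (d := d) hn hs₀ (Nat.ceil_pos.2 (one_div_pos.2 hδ)) rfl
  have hR : R ⊆ T.vars :=
    hlead.subset (Finset.empty_subset _) fun _ => T.mem_vars_of_relevant
  have hrs : #R < s := ((Finset.card_le_card hR).trans_lt T.card_vars_lt_size).trans_le hs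
  have hrd : #R = 0 ∨ 0 < d := R.card.eq_zero_or_pos.imp_right fun hr =>
    (depth_pos_of_vars_nonempty ((Finset.card_pos.1 hr).mono hR)).trans_le hd
  refine ⟨τ, hexec, ?_, ?_⟩
  · have : (τ.queries : ℝ) ≤ 2 * sampleCount d s ⌈1 / δ⌉₊ + #R * Nat.clog 2 n :=
      mod_cast hqueries
    linarith [sampleCount_le_queryBound (d := d) hn hs₀ hδ hδ',
      mul_clog_le_queryBound (d := d) hn hrs.le hs₀ hδ hδ']
  · have : (τ.time : ℝ) ≤ 200 * (sampleCount d s ⌈1 / δ⌉₊ * n) +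
        #R * ((Nat.clog 2 n + 2) * (80 * n)) +
        300 * ((2 * #R + 1) ^ d * (#R + 1) * sampleCount d s ⌈1 / δ⌉₊) := mod_cast htime
    linarith [collect_le (d := d) hn hrs.le hs₀ hδ hδ', search_le_add hn hrd hrs hδ hδ']

end

end DTLearn

theorem mainTheorem7 :
    ∃ (p : DTLearn.Prog) (c : ℕ), ∀ (n d s : ℕ) (δ : ℝ), 1 ≤ n → 0 < δ → δ ≤ 1 / 2 →
      ∃ m : ℝ,
        m ≤ c * (s * (2 ^ d * Real.logb 2 (s / δ) + Real.logb 2 n)) ∧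
        DTLearn.ExactlyProperlyLearns p n d s δ m
          ((s : ℝ) ^ (c * d) * Real.logb 2 (1 / δ) + c * (m * n)) := by
  refine ⟨DTLearn.learner, 100, fun n d s δ hn hδ hδ' =>
    ⟨100 * DTLearn.queryBound n d s δ, le_rfl, ?_⟩⟩
  rintro f ⟨T, hd, hs, rfl⟩
  have hN : 0 < ⌈1 / δ⌉₊ := Nat.ceil_pos.2 (one_div_pos.2 hδ)
  exact ⟨T.learner_halts hd hs hn hδ hδ',
    (sub_le_sub_left (DTLearn.one_div_two_pow_size_ceil_le hδ) 1).trans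
      (T.coins_outputsTree_ge hd hs hn hN)⟩
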